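/- **Setting.** In a self-contained $k$-witness problem $\Pi$, an instance consists of a non-empty universe $U$ of $n$ elements, a parameter $k$ and a collection of witnesses, each a subset of $U$ with exactly $k$ elements; $N$ denotes the number of witnesses. The decision version asks, for an instance and a set $X\subseteq U$, whether some witness is contained in $X$. A randomised decision oracle with error probability at most $c$ answers each query $X$ independently of everything before and, for every $X$, correctly with probability at least $1-c$. Algorithms are programs of a randomised random access machine with unit-cost addition, truncated subtraction, comparison, random array access and uniform random choice from $\{0,\dots,m\}$. **Theorem.** Let $c<\frac12$. There are a randomised oracle algorithm $\mathcal A$ and a constant $C$, both depending only on $c$, such that the following holds for every self-contained $k$-witness problem $\Pi$, all real $0<\epsilon<1$ and $0<\delta\le\frac12$, and every integer $M\ge 1$. The algorithm receives an instance of $\Pi$, the number $M$, and $\epsilon$ and $\delta$ (presented by rational numbers $\epsilon'\in[\epsilon/2,\epsilon]$ and $\delta'\in[\delta/2,\delta]$). 1. Given any randomised decision oracle for the instance with error probability at most $c$, with probability at least $1-\delta$ the algorithm $\mathcal A$ halts and - if $N\le M$, outputs a number $N'$ such that $(1-\epsilon)N\le N'\le N$; - if $N\ge M$, outputs either a number $N'$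 such that $(1-\epsilon)N\le N'\le M$ or "More than $M$". Moreover, if $n\ge2$, then $\mathcal A$ always makes at most $C\,2^{Ck}\cdot\log^3 n\cdot M\cdot\log(\delta^{-1})$ oracle calls. 2. If $D$ is a randomised algorithm that solves the decision version of $\Pi$ with error probability at most $c$ and always halts in time at most $g(k)\cdot n^{a}$, for some function $g$ and some $a\in\mathbb N$, then the algorithm obtained from $\mathcal A$ by executing each oracle call by $D$ satisfies the same guarantee on its output, and its expected running time is at most $C\,2^{Ck}\cdot g(k)\cdot n^{a+C}\cdot M\cdot\log(\delta^{-1})$. -/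

import Mathlib

open scoped ENNReal

noncomputable section

/-- A self-contained `k`-witness problem. An instance `I` is presented by a word, has the universe
`Fin (size I)` and the parameter `par I`, and its witnesses are sets of exactly `par I` elements. -/
structure WitnessProblem where
  Instance : Type
  word : Instance → List Bool
  size : Instance → ℕ
  size_pos : ∀ I, 0 < size I
  par : Instance → ℕ
  witnesses : (I : Instance) → Finset (Finset (Fin (size I)))
  card_eq : ∀ I, ∀ W ∈ witnesses I, W.card = par I

namespace WitnessProblem

/-- The total number of witnesses of an instance. -/
def count (Q : WitnessProblem) (I : Q.Instance) : ℕ := (Q.witnesses I).card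

open Classical in
/-- The correct answer to the decision question for `X ⊆ U`: is some witness contained in `X`? -/
def answer (Q : WitnessProblem) (I : Q.Instance) (X : Finset (Fin (Q.size I))) : Bool :=
  decide (∃ W ∈ Q.witnesses I, W ⊆ X)

end WitnessProblem

/-! ### A randomised random access machine with oracle calls and procedure calls

Programs are written in a structured language over natural-number variables and arrays of natural
numbers. Every elementary command takes one unit of time; the arithmetic operations are addition,
truncated subtraction and comparison. -/

/-- The read-only input of a program: the size `n` of the universe (as an index), the parameter `k`,
the word that presents the instance, a subset of the universe, and a list of further numbers. -/
structure Input (n : ℕ) where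
  k : ℕ
  word : List Bool
  set : Finset (Fin n)
  nums : List ℕ

/-- The memory: infinitely many variables and infinitely many arrays. -/
structure Store where
  var : ℕ → ℕ
  arr : ℕ → ℕ → ℕ

/-- The memory at the start of a program or of a procedure. -/
def Store.init : Store := ⟨fun _ => 0, fun _ _ => 0⟩

def Store.setVar (s : Store) (x v : ℕ) : Store := ⟨Function.update s.var x v, s.arr⟩

def Store.setArr (s : Store) (a i v : ℕ) : Store :=
  ⟨s.var, Function.update s.arr a (Function.update (s.arr a) i v)⟩

inductive Expr where
  | lit (m : ℕ)
  | var (x : ℕ)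
  | arr (a : ℕ) (i : Expr)
  /-- The size of the universe. -/
  | size
  /-- The parameter. -/
  | par
  /-- The length of the input word. -/
  | wordLen
  /-- The letter of the input word at a given position, as `0` or `1`. -/
  | wordAt (i : Expr)
  /-- Whether a given element belongs to the input set, as `0` or `1`. -/
  | inSet (i : Expr)
  /-- An additional input number. -/
  | num (i : ℕ)
  | add (e f : Expr)
  | sub (e f : Expr)
  | lt (e f : Expr)
  | eq (e f : Expr)

open Classical in
def Expr.eval {n : ℕ} (inp : Input n) (s : Store) : Expr → ℕ
  | .lit m => m
  | .var x => s.var x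
  | .arr a i => s.arr a (i.eval inp s)
  | .size => n
  | .par => inp.k
  | .wordLen => inp.word.length
  | .wordAt i => (inp.word.getD (i.eval inp s) false).toNat
  | .inSet i => if ∃ x ∈ inp.set, (x : ℕ) = i.eval inp s then 1 else 0
  | .num i => inp.nums.getD i 0
  | .add e f => e.eval inp s + f.eval inp s
  | .sub e f => e.eval inp s - f.eval inp s
  | .lt e f => if e.eval inp s < f.eval inp s then 1 else 0
  | .eq e f => if e.eval inp s = f.eval inp s then 1 else 0

inductive Cmd where
  /-- `x := e` -/
  | assign (x : ℕ) (e : Expr)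
  /-- `a[i] := e` -/
  | write (a : ℕ) (i e : Expr)
  /-- `x :=` a uniformly random element of `{0, …, e}` -/
  | rand (x : ℕ) (e : Expr)
  /-- `x :=` the oracle's answer for the set `{i < n | a[i] ≠ 0}` -/
  | ora (x a : ℕ)
  /-- `x :=` the answer of the procedure `D`, which is run with a fresh memory on the same instance
  and the set `{i < n | a[i] ≠ 0}` -/
  | call (x a : ℕ) (D : Cmd)
  | seq (c d : Cmd)
  | ite (e : Expr) (c d : Cmd)
  /-- while `e ≠ 0` do `c` -/
  | loop (e : Expr) (c : Cmd)

/-- The program contains no oracle call. -/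
def Cmd.OracleFree : Cmd → Prop
  | .assign _ _ => True
  | .write _ _ _ => True
  | .rand _ _ => True
  | .ora _ _ => False
  | .call _ _ D => D.OracleFree
  | .seq c d => c.OracleFree ∧ d.OracleFree
  | .ite _ c d => c.OracleFree ∧ d.OracleFree
  | .loop _ c => c.OracleFree

/-- `P.link D` is the program `P` in which every oracle call is replaced by a call of the procedure
`D`. -/
def Cmd.link (P D : Cmd) : Cmd :=
  match P with
  | .assign x e => .assign x e
  | .write a i e => .write a i e
  | .rand x e => .rand x e
  | .ora x a => .call x a D
  | .call x a D' => .call x a (D'.link D)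
  | .seq c d => .seq (c.link D) (d.link D)
  | .ite e c d => .ite e (c.link D) (d.link D)
  | .loop e c => .loop e (c.link D)

/-- An activation of a program or procedure: its input, its memory, the commands still to be
executed. -/
structure Frame (n : ℕ) where
  inp : Input n
  st : Store
  todo : List Cmd

/-- A configuration: the current activation, the suspended ones (each with the variable that
receives the answer of the procedure it waits for), and the number of oracle calls made so far. -/
structure Config (n : ℕ) where
  cur : Frame n
  stack : List (ℕ × Frame n)
  calls : ℕ

/-- The yes/no answer of a decision program: yes iff variable `0` is nonzero at the end. -/
def Store.yes (s : Store) : Bool := s.var 0 != 0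

/-- The output of a counting program: `none` stands for "More than `M`", `some N'` for the number
`N'`. -/
def Store.output (s : Store) : Option ℕ := if s.var 0 = 0 then some (s.var 1) else none

/-- The subset of the universe that is stored in array `a`. -/
def Store.query (s : Store) (n a : ℕ) : Finset (Fin n) :=
  Finset.univ.filter fun i => s.arr a (i : ℕ) ≠ 0

/-- One unit of time. The oracle `O` answers each query by a fresh random bit, independent of
everything before, whose law depends on the queried set. -/
def step {n : ℕ} (O : Finset (Fin n) → PMF Bool) (γ : Config n) : PMF (Config n) :=
  let inp := γ.cur.inp
  let s := γ.cur.st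
  match γ.cur.todo with
  | [] =>
    match γ.stack with
    | [] => PMF.pure γ
    | (x, f) :: rest =>
      PMF.pure ⟨⟨f.inp, f.st.setVar x s.yes.toNat, f.todo⟩, rest, γ.calls⟩
  | .assign x e :: K => PMF.pure ⟨⟨inp, s.setVar x (e.eval inp s), K⟩, γ.stack, γ.calls⟩
  | .write a i e :: K =>
    PMF.pure ⟨⟨inp, s.setArr a (i.eval inp s) (e.eval inp s), K⟩, γ.stack, γ.calls⟩
  | .rand x e :: K =>
    (PMF.uniformOfFintype (Fin (e.eval inp s + 1))).map fun r =>
      ⟨⟨inp, s.setVar x (r : ℕ), K⟩, γ.stack, γ.calls⟩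
  | .ora x a :: K =>
    (O (s.query n a)).map fun b => ⟨⟨inp, s.setVar x b.toNat, K⟩, γ.stack, γ.calls + 1⟩
  | .call x a D :: K =>
    PMF.pure ⟨⟨⟨inp.k, inp.word, s.query n a, []⟩, Store.init, [D]⟩,
      (x, ⟨inp, s, K⟩) :: γ.stack, γ.calls⟩
  | .seq c d :: K => PMF.pure ⟨⟨inp, s, c :: d :: K⟩, γ.stack, γ.calls⟩
  | .ite e c d :: K =>
    PMF.pure ⟨⟨inp, s, (if e.eval inp s ≠ 0 then c else d) :: K⟩, γ.stack, γ.calls⟩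
  | .loop e c :: K =>
    PMF.pure ⟨⟨inp, s, if e.eval inp s ≠ 0 then c :: .loop e c :: K else K⟩, γ.stack, γ.calls⟩

def Config.Halted {n : ℕ} (γ : Config n) : Prop := γ.cur.todo = [] ∧ γ.stack = []

/-- The law of the configuration of the program `P` on input `inp` after `t` units of time. -/
def run {n : ℕ} (O : Finset (Fin n) → PMF Bool) (P : Cmd) (inp : Input n) : ℕ → PMF (Config n)
  | 0 => PMF.pure ⟨⟨inp, Store.init, [P]⟩, [], 0⟩
  | t + 1 => (run O P inp t).bind (step O)

/-- The probability that `P` halts with a final memory in `S`. -/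
def haltProb {n : ℕ} (O : Finset (Fin n) → PMF Bool) (P : Cmd) (inp : Input n) (S : Set Store) :
    ℝ≥0∞ :=
  ⨆ t, (run O P inp t).toOuterMeasure {γ | γ.Halted ∧ γ.cur.st ∈ S}

/-- The expected running time of `P`, as the sum over `t` of the probability that `P` has not halted
after `t` units of time. -/
def expectedTime {n : ℕ} (O : Finset (Fin n) → PMF Bool) (P : Cmd) (inp : Input n) : ℝ≥0∞ :=
  ∑' t, (run O P inp t).toOuterMeasure {γ | ¬ γ.Halted}

/-- Whatever the random choices and the oracle's answers, `P` halts within `T` units of time. -/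
def HaltsWithin {n : ℕ} (O : Finset (Fin n) → PMF Bool) (P : Cmd) (inp : Input n) (T : ℕ) : Prop :=
  ∀ γ ∈ (run O P inp T).support, γ.Halted

/-- Whatever the random choices and the oracle's answers, `P` makes at most `B` oracle calls. -/
def CallsAtMost {n : ℕ} (O : Finset (Fin n) → PMF Bool) (P : Cmd) (inp : Input n) (B : ℝ) : Prop :=
  ∀ t, ∀ γ ∈ (run O P inp t).support, (γ.calls : ℝ) ≤ B

/-- The trivial oracle with which oracle-free programs are run. -/
def noOracle (n : ℕ) : Finset (Fin n) → PMF Bool := fun _ => PMF.pure false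

namespace WitnessProblem

/-- `O` is a randomised decision oracle for the instance `I` with error probability at most `c`. -/
def IsOracle (Q : WitnessProblem) (I : Q.Instance) (c : ℝ)
    (O : Finset (Fin (Q.size I)) → PMF Bool) : Prop :=
  ∀ X, ENNReal.ofReal (1 - c) ≤ O X (Q.answer I X)

/-- The input of a decision program for `Q`. -/
def decisionInput (Q : WitnessProblem) (I : Q.Instance) (X : Finset (Fin (Q.size I))) :
    Input (Q.size I) :=
  ⟨Q.par I, Q.word I, X, []⟩

/-- `D` is a randomised algorithm that solves the decision version of `Q` with error probability at
most `c`. -/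
def DecidedBy (Q : WitnessProblem) (c : ℝ) (D : Cmd) : Prop :=
  D.OracleFree ∧ ∀ (I : Q.Instance) (X : Finset (Fin (Q.size I))),
    ENNReal.ofReal (1 - c) ≤
      haltProb (noOracle _) D (Q.decisionInput I X) {s | s.yes = Q.answer I X}

/-- The input of a counting program for `Q`: the instance, the threshold `M`, and two rational
numbers, each given by numerator and denominator. -/
def countingInput (Q : WitnessProblem) (I : Q.Instance) (M : ℕ) (e d : ℚ) : Input (Q.size I) :=
  ⟨Q.par I, Q.word I, Finset.univ, [M, e.num.toNat, e.den, d.num.toNat, d.den]⟩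

/-- The outputs that are allowed when the number of witnesses is `N`. -/
def GoodOutput (N M : ℕ) (ε : ℝ) (out : Option ℕ) : Prop :=
  (N ≤ M → ∃ N' : ℕ, out = some N' ∧ (1 - ε) * (N : ℝ) ≤ (N' : ℝ) ∧ N' ≤ N) ∧
  (M ≤ N → (∃ N' : ℕ, out = some N' ∧ (1 - ε) * (N : ℝ) ≤ (N' : ℝ) ∧ N' ≤ M) ∨ out = none)

end WitnessProblem

/-- The rational number `r` presents the real number `x` to a program: it approximates `x` from
below within a factor of two (for rational `x`, one may take `r = x`). -/
def Presents (r : ℚ) (x : ℝ) : Prop := x / 2 ≤ (r : ℝ) ∧ (r : ℝ) ≤ x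

end

/-! The program counts exactly: with probability at least `1 - δ` it reports `N` itself if `N ≤ M`,
and "more than `M`" otherwise (`WitnessProblem.goodOutput_exact`).

One trial gives every element an independent uniform label of `L = 2 * l + 4` bits, where `n ≤ 2 ^ l
≤ 2 * n`; so `L` is logarithmic in `n`, and the labels are distinct except with probability 1/16
(`card_not_injective_le`). Consider `k`-tuples of dyadic blocks of labels, all of the same width. A
tuple is good if it is sorted and the union of its blocks contains a witness; the second condition
is a decision query. Starting with `k` copies of the full block, the search splits the blocks of
each good tuple into halves, which gives `2 ^ k` children. The parent of a good tuple is good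
(`GoodNode.of_child`), so no good tuple is missed. If the labels are distinct, the good tuples of
width one are exactly the increasing enumerations of the label sets of the witnesses
(`goodCount_zero`). Counting good leaves therefore counts witnesses, and sorting ensures that each
is counted once.

The tree is small on average. At a level with `B` blocks there are at most `(B + k).choose k` sorted
tuples, and a fixed witness lies in the union of a fixed tuple with probability at most `(min k B /
B) ^ k`. The product of the two is at most `8 ^ k` (`choose_mul_min_pow_le`), hence a level has at
most `8 ^ k * N` good nodes in expectation, and the root at most `16 ^ k * L * N` proper descendants
(`sum_descCount_root_le`). By Markov's inequality (`card_large_tree_le`) a trial may give up and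
report "more than `M`" when its queue exceeds a capacity of order `16 ^ k * L * M`.

Each query is decided by a vote over many oracle answers, so reliable that a union bound over the
whole queue costs only 1/16 (`capacity_mul_le`). A trial thus fails with probability at most 1/16 +
1/8 + 1/16 = 1/4, and a second vote, over a number of trials proportional to `log δ⁻¹`, reduces this
below `δ`. Both votes follow Boyer and Moore and are analysed by a multiplicative potential
(`Triple.majority`).

The program is verified in a Hoare logic of expectations: `Triple` bounds time, oracle calls and the
expected final value of a potential. It is stated for an abstract `Machine`, with one instance for a
genuine oracle and one for calls of a decision procedure, so both halves of the theorem come from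
one derivation. Since a triple is proved from every memory that satisfies its hypotheses, the
independence of repeated experiments never has to be stated. -/

noncomputable section

/-! ### Expectations over `PMF`s -/

/-- The expectation of a nonnegative function. -/
def PMF.expect {α : Type*} (p : PMF α) (f : α → ℝ≥0∞) : ℝ≥0∞ := ∑' a, p a * f a

theorem PMF.expect_pure {α : Type*} (a : α) (f : α → ℝ≥0∞) : (PMF.pure a).expect f = f a := by
  unfold PMF.expect
  rw [tsum_eq_single a]
  · simp
  · intro b hb
    simp [PMF.pure_apply, hb]

theorem PMF.expect_bind {α β : Type*} (p : PMF α) (k : α → PMF β) (f : β → ℝ≥0∞) :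
    (p.bind k).expect f = p.expect fun a => (k a).expect f := by
  unfold PMF.expect
  simp only [PMF.bind_apply, ← ENNReal.tsum_mul_right, ← ENNReal.tsum_mul_left]
  rw [ENNReal.tsum_comm]
  simp only [mul_assoc]

theorem PMF.expect_map {α β : Type*} (p : PMF α) (g : α → β) (f : β → ℝ≥0∞) :
    (p.map g).expect f = p.expect fun a => f (g a) := by
  rw [← PMF.bind_pure_comp, PMF.expect_bind]
  simp [PMF.expect_pure]

theorem PMF.expect_mono {α : Type*} (p : PMF α) {f g : α → ℝ≥0∞}
    (h : ∀ a ∈ p.support, f a ≤ g a) : p.expect f ≤ p.expect g := by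
  refine ENNReal.tsum_le_tsum fun a => ?_
  by_cases ha : a ∈ p.support
  · gcongr
    exact h a ha
  · rw [PMF.mem_support_iff, not_not] at ha
    simp [ha]

theorem PMF.expect_congr {α : Type*} (p : PMF α) {f g : α → ℝ≥0∞}
    (h : ∀ a ∈ p.support, f a = g a) : p.expect f = p.expect g :=
  le_antisymm (p.expect_mono fun a ha => (h a ha).le) (p.expect_mono fun a ha => (h a ha).ge)

theorem PMF.expect_const {α : Type*} (p : PMF α) (a : ℝ≥0∞) : p.expect (fun _ => a) = a := by
  unfold PMF.expect
  rw [ENNReal.tsum_mul_right, PMF.tsum_coe, one_mul]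

theorem PMF.expect_affine {α : Type*} (p : PMF α) (a b : ℝ≥0∞) (f : α → ℝ≥0∞) :
    p.expect (fun x => a + b * f x) = a + b * p.expect f := by
  have h := p.expect_const a
  unfold PMF.expect at *
  simp only [mul_add]
  rw [ENNReal.tsum_add, h, ← ENNReal.tsum_mul_left]
  simp only [mul_left_comm]

theorem PMF.expect_bool (p : PMF Bool) (f : Bool → ℝ≥0∞) :
    p.expect f = p true * f true + p false * f false := by
  unfold PMF.expect
  rw [tsum_fintype, Fintype.sum_bool]

theorem PMF.toOuterMeasure_eq_expect {α : Type*} (p : PMF α) (S : Set α) [DecidablePred (· ∈ S)] :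
    p.toOuterMeasure S = p.expect fun a => if a ∈ S then 1 else 0 := by
  rw [PMF.toOuterMeasure_apply]
  unfold PMF.expect
  refine tsum_congr fun a => ?_
  by_cases h : a ∈ S <;> simp [h]

/-! ### Reachability with time bounds and expectations -/

/-- From `x`, every path of the Markov chain `stp` arrives within `T` steps at a state satisfying
`Term`, and the expectation of `f` at the first recorded arrival is at most `v`. -/
inductive Reach {X : Type*} (stp : X → PMF X) (Term : X → Prop) (f : X → ℝ≥0∞) :
    X → ℕ → ℝ≥0∞ → Prop
  | done {x T v} : Term x → f x ≤ v → Reach stp Term f x T v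
  | step {x T v} (u : X → ℝ≥0∞) : (∀ y ∈ (stp x).support, Reach stp Term f y T (u y)) →
      (stp x).expect u ≤ v → Reach stp Term f x (T + 1) v

namespace Reach

variable {X : Type*} {stp : X → PMF X} {Term Term' : X → Prop} {f f' : X → ℝ≥0∞} {x : X}
  {T T' : ℕ} {v v' : ℝ≥0∞}

theorem mono (h : Reach stp Term f x T v) (hT : T ≤ T') (hv : v ≤ v') :
    Reach stp Term f x T' v' := by
  induction h generalizing T' v' with
  | done h1 h2 => exact .done h1 (h2.trans hv)
  | step u _ hu ih =>
    obtain ⟨T'', rfl⟩ : ∃ t, T' = t + 1 := ⟨T' - 1, by omega⟩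
    exact .step u (fun y hy => ih y hy (by omega) le_rfl) (hu.trans hv)

/-- Sequential composition: the function whose expectation the first phase bounds is the bound with
which the second phase starts. -/
theorem bind (h : Reach stp Term f x T v)
    (h' : ∀ y, Term y → Reach stp Term' f' y T' (f y)) : Reach stp Term' f' x (T + T') v := by
  induction h with
  | done h1 h2 => exact (h' _ h1).mono (by omega) h2
  | step u _ hu ih =>
    rw [add_right_comm]
    exact .step u (fun y hy => ih y hy) hu

/-- Weakening of the final condition. -/
theorem conseq (h : Reach stp Term f x T v) (h' : ∀ y, Term y → Term' y ∧ f' y ≤ f y) :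
    Reach stp Term' f' x T v :=
  h.bind (T' := 0) fun y hy => .done (h' y hy).1 (h' y hy).2

theorem affine (a b : ℝ≥0∞) (h : Reach stp Term f x T v) :
    Reach stp Term (fun y => a + b * f y) x T (a + b * v) := by
  induction h with
  | done h1 h2 => exact .done h1 (by gcongr)
  | step u _ hu ih =>
    refine .step (fun y => a + b * u y) ih ?_
    rw [PMF.expect_affine]
    gcongr

/-- Termination within the time bound does not depend on the function; this serves to discard an
expectation and keep the rest. -/
theorem const (a : ℝ≥0∞) (h : Reach stp Term f x T v) : Reach stp Term (fun _ => a) x T a := by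
  induction h with
  | done h1 h2 => exact .done h1 le_rfl
  | step u _ hu ih => exact .step (fun _ => a) ih (PMF.expect_const _ _).le

theorem of_pure {y : X} (hs : stp x = PMF.pure y) (h : Reach stp Term f y T v) :
    Reach stp Term f x (T + 1) v := by
  refine .step (fun _ => v) ?_ ?_
  · rw [hs]
    simpa using h
  · rw [PMF.expect_const]

theorem of_map {α : Type*} {p : PMF α} {g : α → X} (hs : stp x = p.map g) (u : X → ℝ≥0∞)
    (h : ∀ a ∈ p.support, Reach stp Term f (g a) T (u (g a)))
    (hu : p.expect (fun a => u (g a)) ≤ v) : Reach stp Term f x (T + 1) v := by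
  refine .step u ?_ ?_
  · rw [hs]
    intro y hy
    obtain ⟨a, ha, rfl⟩ := (PMF.mem_support_map_iff _ _ _).1 hy
    exact h a ha
  · rwa [hs, PMF.expect_map]

end Reach

/-- The law of a Markov chain after a number of steps. -/
def chain {X : Type*} (stp : X → PMF X) : ℕ → X → PMF X
  | 0, x => PMF.pure x
  | t + 1, x => (chain stp t x).bind stp

/-- The definition appends steps at the end, whereas `Reach` removes them at the front. -/
theorem chain_succ {X : Type*} (stp : X → PMF X) (t : ℕ) (x : X) :
    chain stp (t + 1) x = (stp x).bind (chain stp t) := by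
  induction t generalizing x with
  | zero =>
    simp only [chain, PMF.pure_bind]
    exact (PMF.bind_pure _).symm
  | succ t ih =>
    rw [chain, ih, PMF.bind_bind]
    rfl

theorem chain_add {X : Type*} (stp : X → PMF X) (t t' : ℕ) (x : X) :
    chain stp (t + t') x = (chain stp t x).bind (chain stp t') := by
  induction t' with
  | zero => exact (PMF.bind_pure _).symm
  | succ t' ih =>
    rw [← add_assoc, chain, ih, PMF.bind_bind]
    rfl

theorem chain_of_fixed {X : Type*} {stp : X → PMF X} {x : X} (h : stp x = PMF.pure x) (t : ℕ) :
    chain stp t x = PMF.pure x := by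
  induction t with
  | zero => rfl
  | succ t ih => rw [chain, ih, PMF.pure_bind, h]

theorem run_eq_chain {n : ℕ} (O : Finset (Fin n) → PMF Bool) (P : Cmd) (inp : Input n) (t : ℕ) :
    run O P inp t = chain (step O) t ⟨⟨inp, Store.init, [P]⟩, [], 0⟩ := by
  induction t with
  | zero => rfl
  | succ t ih => rw [run, ih, chain]

/-- If all final states are absorbing, the chain has settled after the time bound. -/
theorem Reach.chain_settled {X : Type*} {stp : X → PMF X} {Term : X → Prop} {f : X → ℝ≥0∞} {x : X}
    {T : ℕ} {v : ℝ≥0∞} (h : Reach stp Term f x T v) (hT : ∀ y, Term y → stp y = PMF.pure y)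
    {t : ℕ} (ht : T ≤ t) :
    (∀ y ∈ (chain stp t x).support, Term y) ∧ (chain stp t x).expect f ≤ v := by
  induction h generalizing t with
  | done h1 h2 =>
    rw [chain_of_fixed (hT _ h1), PMF.expect_pure]
    simpa using ⟨h1, h2⟩
  | step u _ hu ih =>
    obtain ⟨t, rfl⟩ : ∃ t', t = t' + 1 := ⟨t - 1, by omega⟩
    rw [chain_succ]
    constructor
    · intro y hy
      obtain ⟨z, hz, hy⟩ := (PMF.mem_support_bind_iff _ _ _).1 hy
      exact (ih z hz (by omega)).1 y hy
    · rw [PMF.expect_bind]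
      exact (PMF.expect_mono _ fun y hy => (ih y hy (by omega)).2).trans hu

theorem Config.Halted.step_eq {n : ℕ} {γ : Config n} (h : γ.Halted)
    (O : Finset (Fin n) → PMF Bool) : step O γ = PMF.pure γ := by
  obtain ⟨⟨inp, s, K⟩, stack, q⟩ := γ
  obtain ⟨rfl, rfl⟩ := h
  rfl

theorem step_rand {n : ℕ} (O : Finset (Fin n) → PMF Bool) (inp : Input n) (s : Store) (x : ℕ)
    (e : Expr) (K : List Cmd) (stack : List (ℕ × Frame n)) (q : ℕ) :
    step O ⟨⟨inp, s, .rand x e :: K⟩, stack, q⟩ =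
      (PMF.uniformOfFintype (Fin (e.eval inp s + 1))).map fun r =>
        ⟨⟨inp, s.setVar x (r : ℕ), K⟩, stack, q⟩ := by
  simp only [step]
  exact PMF.map_comp (fun r : Fin (e.eval inp s + 1) => (r : ℕ)) _ _

/-! ### Triples for commands -/

/-- The command may change the variable. -/
def Cmd.modVar : Cmd → ℕ → Bool
  | .assign x _, y => x == y
  | .write _ _ _, _ => false
  | .rand x _, y => x == y
  | .ora x _, y => x == y
  | .call x _ _, y => x == y
  | .seq c d, y => c.modVar y || d.modVar y
  | .ite _ c d, y => c.modVar y || d.modVar y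
  | .loop _ c, y => c.modVar y

/-- The command may change the array. -/
def Cmd.modArr : Cmd → ℕ → Bool
  | .assign _ _, _ => false
  | .write a _ _, b => a == b
  | .rand _ _, _ => false
  | .ora _ _, _ => false
  | .call _ _ _, _ => false
  | .seq c d, b => c.modArr b || d.modArr b
  | .ite _ c d, b => c.modArr b || d.modArr b
  | .loop _ c, b => c.modArr b

/-- The memories `s` and `t` agree on everything that `c` may not change. -/
structure Keeps (c : Cmd) (s t : Store) : Prop where
  var : ∀ x, c.modVar x = false → t.var x = s.var x
  arr : ∀ a, c.modArr a = false → t.arr a = s.arr a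

theorem Keeps.refl (c : Cmd) (s : Store) : Keeps c s s := ⟨fun _ _ => rfl, fun _ _ => rfl⟩

theorem Keeps.trans {c : Cmd} {s t u : Store} (h : Keeps c s t) (h' : Keeps c t u) : Keeps c s u :=
  ⟨fun x hx => (h'.var x hx).trans (h.var x hx), fun x hx => (h'.arr x hx).trans (h.arr x hx)⟩

theorem Keeps.of_imp {c d : Cmd} {s t : Store} (h : Keeps c s t)
    (hv : ∀ x, d.modVar x = false → c.modVar x = false)
    (ha : ∀ x, d.modArr x = false → c.modArr x = false) : Keeps d s t :=
  ⟨fun x hx => h.var x (hv x hx), fun x hx => h.arr x (ha x hx)⟩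

theorem Keeps.seq_left {c d : Cmd} {s t : Store} (h : Keeps c s t) : Keeps (.seq c d) s t :=
  h.of_imp (fun _ hx => (Bool.or_eq_false_iff.1 hx).1) fun _ hx => (Bool.or_eq_false_iff.1 hx).1

theorem Keeps.seq_right {c d : Cmd} {s t : Store} (h : Keeps d s t) : Keeps (.seq c d) s t :=
  h.of_imp (fun _ hx => (Bool.or_eq_false_iff.1 hx).2) fun _ hx => (Bool.or_eq_false_iff.1 hx).2

theorem Keeps.ite {e : Expr} {c d : Cmd} {s t : Store} {p : Prop} [Decidable p]
    (h : Keeps (if p then c else d) s t) : Keeps (.ite e c d) s t := by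
  split_ifs at h
  · exact h.of_imp (fun _ hx => (Bool.or_eq_false_iff.1 hx).1)
      fun _ hx => (Bool.or_eq_false_iff.1 hx).1
  · exact h.of_imp (fun _ hx => (Bool.or_eq_false_iff.1 hx).2)
      fun _ hx => (Bool.or_eq_false_iff.1 hx).2

theorem Keeps.setVar {c : Cmd} (s : Store) {x v : ℕ} (h : c.modVar x = true) :
    Keeps c s (s.setVar x v) := by
  refine ⟨fun y hy => Function.update_of_ne ?_ _ _, fun _ _ => rfl⟩
  rintro rfl
  simp [h] at hy

theorem Keeps.setArr {c : Cmd} (s : Store) {a i v : ℕ} (h : c.modArr a = true) :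
    Keeps c s (s.setArr a i v) := by
  refine ⟨fun _ _ => rfl, fun y hy => Function.update_of_ne ?_ _ _⟩
  rintro rfl
  simp [h] at hy

/-- An implementation of the programming language: `tr` says how commands are represented, and
every elementary command takes at most `cost` steps of the chain `stp`. Oracle calls are answered by
`O`, and `cnt` measures how many of them have been made. -/
structure Machine {n : ℕ} (inp : Input n) where
  stp : Config n → PMF (Config n)
  tr : Cmd → Cmd
  cnt : ℕ → ℕ
  cost : ℕ
  O : Finset (Fin n) → PMF Bool
  cost_pos : 1 ≤ cost
  stp_assign : ∀ x e s K q, stp ⟨⟨inp, s, tr (.assign x e) :: K⟩, [], q⟩ =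
    PMF.pure ⟨⟨inp, s.setVar x (e.eval inp s), K⟩, [], q⟩
  stp_write : ∀ a i e s K q, stp ⟨⟨inp, s, tr (.write a i e) :: K⟩, [], q⟩ =
    PMF.pure ⟨⟨inp, s.setArr a (i.eval inp s) (e.eval inp s), K⟩, [], q⟩
  stp_rand : ∀ x e s K q, stp ⟨⟨inp, s, tr (.rand x e) :: K⟩, [], q⟩ =
    (PMF.uniformOfFintype (Fin (e.eval inp s + 1))).map fun r =>
      ⟨⟨inp, s.setVar x (r : ℕ), K⟩, [], q⟩
  stp_seq : ∀ c d s K q, stp ⟨⟨inp, s, tr (.seq c d) :: K⟩, [], q⟩ =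
    PMF.pure ⟨⟨inp, s, tr c :: tr d :: K⟩, [], q⟩
  stp_ite : ∀ e c d s K q, stp ⟨⟨inp, s, tr (.ite e c d) :: K⟩, [], q⟩ =
    PMF.pure ⟨⟨inp, s, tr (if e.eval inp s ≠ 0 then c else d) :: K⟩, [], q⟩
  stp_loop : ∀ e c s K q, stp ⟨⟨inp, s, tr (.loop e c) :: K⟩, [], q⟩ =
    PMF.pure ⟨⟨inp, s, if e.eval inp s ≠ 0 then tr c :: tr (.loop e c) :: K else K⟩, [], q⟩
  reach_ora : ∀ x a s K q (Term : Config n → Prop) (f : Config n → ℝ≥0∞) (T : ℕ)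
    (u : Bool → ℝ≥0∞),
    (∀ b q', cnt q' ≤ cnt q + 1 →
      Reach stp Term f ⟨⟨inp, s.setVar x b.toNat, K⟩, [], q'⟩ T (u b)) →
    Reach stp Term f ⟨⟨inp, s, tr (.ora x a) :: K⟩, [], q⟩ (T + cost) ((O (s.query n a)).expect u)

/-- Started in memory `s`, the command `c` always finishes within `T` units of time and with at most
`B` oracle calls, and the expectation of `f` at the final memory is at most `v`. -/
def Triple {n : ℕ} {inp : Input n} (M : Machine inp) (c : Cmd) (s : Store) (T B : ℕ)
    (f : Store → ℝ≥0∞) (v : ℝ≥0∞) : Prop :=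
  ∀ K q, Reach M.stp
    (fun γ => ∃ t q', γ = ⟨⟨inp, t, K⟩, [], q'⟩ ∧ M.cnt q' ≤ M.cnt q + B ∧ Keeps c s t)
    (fun γ => f γ.cur.st) ⟨⟨inp, s, M.tr c :: K⟩, [], q⟩ (T * M.cost) v

namespace Triple

variable {n : ℕ} {inp : Input n} {M : Machine inp} {c d : Cmd} {s : Store}
  {T T' B B' : ℕ} {f g : Store → ℝ≥0∞} {v v' : ℝ≥0∞}

theorem conseq (h : Triple M c s T B f v) (hT : T ≤ T') (hB : B ≤ B')
    (hf : ∀ t, Keeps c s t → g t ≤ f t) (hv : v ≤ v') : Triple M c s T' B' g v' := by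
  intro K q
  refine ((h K q).conseq ?_).mono (Nat.mul_le_mul_right _ hT) hv
  rintro _ ⟨t, q', rfl, hb, hk⟩
  exact ⟨⟨t, q', rfl, by omega, hk⟩, hf t hk⟩

theorem affine (a b : ℝ≥0∞) (h : Triple M c s T B f v) :
    Triple M c s T B (fun t => a + b * f t) (a + b * v) :=
  fun K q => (h K q).affine a b

theorem const (a : ℝ≥0∞) (h : Triple M c s T B f v) : Triple M c s T B (fun _ => a) a :=
  fun K q => (h K q).const a

theorem rand (x : ℕ) (e : Expr) :
    Triple M (.rand x e) s 1 0 f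
      (∑ r : Fin (e.eval inp s + 1), ((e.eval inp s + 1 : ℕ) : ℝ≥0∞)⁻¹ * f (s.setVar x r)) := by
  intro K q
  refine (Reach.of_map (T := 0) (M.stp_rand ..) (fun γ => f γ.cur.st)
    (fun r _ => .done ⟨_, q, rfl, by omega, ?_⟩ le_rfl) ?_).mono (by simpa using M.cost_pos) le_rfl
  · unfold PMF.expect
    rw [tsum_fintype]
    simp
  · exact Keeps.setVar _ (by simp [Cmd.modVar])

theorem ora (x a : ℕ) :
    Triple M (.ora x a) s 1 1 f
      (M.O (s.query n a) true * f (s.setVar x 1) + M.O (s.query n a) false * f (s.setVar x 0)) := by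
  intro K q
  have := M.reach_ora x a s K q
    (fun γ => ∃ t q', γ = ⟨⟨inp, t, K⟩, [], q'⟩ ∧ M.cnt q' ≤ M.cnt q + 1 ∧ Keeps (.ora x a) s t)
    (fun γ => f γ.cur.st) 0 (fun b => f (s.setVar x b.toNat)) fun b q' hq' =>
      .done ⟨_, q', rfl, hq', Keeps.setVar _ (by simp [Cmd.modVar])⟩ le_rfl
  rw [PMF.expect_bool] at this
  exact this.mono (by omega) le_rfl

theorem seq (h : Triple M c s T B g v)
    (h' : ∀ t, Keeps c s t → Triple M d t T' B' f (g t)) :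
    Triple M (.seq c d) s (T + T' + 1) (B + B') f v := by
  intro K q
  have hc := M.cost_pos
  refine (Reach.of_pure (M.stp_seq ..) ((h (M.tr d :: K) q).bind (T' := T' * M.cost)
    ?_)).mono (by rw [add_mul, add_mul]; omega) le_rfl
  rintro _ ⟨t, q', rfl, hb, hk⟩
  refine (h' t hk K q').conseq ?_
  rintro _ ⟨u, q'', rfl, hb', hk'⟩
  exact ⟨⟨u, q'', rfl, by omega, hk.seq_left.trans hk'.seq_right⟩, le_rfl⟩

theorem ite (e : Expr) (h : Triple M (if e.eval inp s ≠ 0 then c else d) s T B f v) :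
    Triple M (.ite e c d) s (T + 1) B f v := by
  intro K q
  have hc := M.cost_pos
  refine (Reach.of_pure (M.stp_ite ..) ((h K q).conseq ?_)).mono (by rw [add_mul]; omega) le_rfl
  rintro _ ⟨t, b, rfl, hb, hk⟩
  exact ⟨⟨t, b, rfl, hb, hk.ite⟩, le_rfl⟩

end Triple

/-- `c` leads from memory `s` to memory `t` within `T` units of time, without oracle calls. -/
def Det {n : ℕ} (inp : Input n) (c : Cmd) (s : Store) (T : ℕ) (t : Store) : Prop :=
  Keeps c s t ∧ ∀ (M : Machine inp) K q, Reach M.stp (fun γ => γ = ⟨⟨inp, t, K⟩, [], q⟩)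
    (fun _ => 0) ⟨⟨inp, s, M.tr c :: K⟩, [], q⟩ (T * M.cost) 0

-- In a deterministic run the final configuration is known, so the expectation carries no
-- information. It is kept at `0` and replaced by any value through `Reach.const`.
namespace Det

variable {n : ℕ} {inp : Input n} {c d : Cmd} {s t u : Store} {T T' : ℕ}

theorem mono (h : Det inp c s T t) (hT : T ≤ T') : Det inp c s T' t :=
  ⟨h.1, fun M K q => (h.2 M K q).mono (Nat.mul_le_mul_right _ hT) le_rfl⟩

theorem triple (h : Det inp c s T t) (M : Machine inp) (f : Store → ℝ≥0∞) :
    Triple M c s T 0 f (f t) := by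
  intro K q
  refine ((h.2 M K q).const (f t)).conseq ?_
  rintro _ rfl
  exact ⟨⟨t, q, rfl, le_rfl, h.1⟩, le_rfl⟩

theorem assign (x : ℕ) (e : Expr) : Det inp (.assign x e) s 1 (s.setVar x (e.eval inp s)) :=
  ⟨Keeps.setVar _ (by simp [Cmd.modVar]), fun M _ _ =>
    Reach.mono (T := 0 + 1) (v := 0) (Reach.of_pure (M.stp_assign ..) (.done rfl le_rfl))
      (by simpa using M.cost_pos) le_rfl⟩

theorem write (a : ℕ) (i e : Expr) :
    Det inp (.write a i e) s 1 (s.setArr a (i.eval inp s) (e.eval inp s)) :=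
  ⟨Keeps.setArr _ (by simp [Cmd.modArr]), fun M _ _ =>
    Reach.mono (T := 0 + 1) (v := 0) (Reach.of_pure (M.stp_write ..) (.done rfl le_rfl))
      (by simpa using M.cost_pos) le_rfl⟩

theorem triple_seq {M : Machine inp} {f : Store → ℝ≥0∞} {v : ℝ≥0∞} {B : ℕ}
    (h : Det inp c s T t) (h' : Triple M d t T' B f v) :
    Triple M (.seq c d) s (T + T' + 1) B f v := by
  intro K q
  have hc := M.cost_pos
  refine (Reach.of_pure (M.stp_seq ..) (((h.2 M (M.tr d :: K) q).const v).bind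
    (T' := T' * M.cost) ?_)).mono (by rw [add_mul, add_mul]; omega) le_rfl
  rintro _ rfl
  refine (h' K q).conseq ?_
  rintro _ ⟨u, b, rfl, hb, hk⟩
  exact ⟨⟨u, b, rfl, hb, h.1.seq_left.trans hk.seq_right⟩, le_rfl⟩

theorem seq (h : Det inp c s T t) (h' : Det inp d t T' u) :
    Det inp (.seq c d) s (T + T' + 1) u := by
  refine ⟨h.1.seq_left.trans h'.1.seq_right, fun M K q => ?_⟩
  have hc := M.cost_pos
  refine (Reach.of_pure (M.stp_seq ..) ((h.2 M (M.tr d :: K) q).bind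
    (T' := T' * M.cost) ?_)).mono (by rw [add_mul, add_mul]; omega) le_rfl
  rintro _ rfl
  exact h'.2 M K q

theorem ite (e : Expr) (h : Det inp (if e.eval inp s ≠ 0 then c else d) s T t) :
    Det inp (.ite e c d) s (T + 1) t := by
  refine ⟨h.1.ite, fun M K q => ?_⟩
  have hc := M.cost_pos
  exact (Reach.of_pure (M.stp_ite ..) (h.2 M K q)).mono (by rw [add_mul]; omega) le_rfl

theorem loop_done {e : Expr} (he : e.eval inp s = 0) : Det inp (.loop e c) s 1 s := by
  refine ⟨Keeps.refl _ _, fun M K q => ?_⟩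
  refine (Reach.of_pure (T := 0) (M.stp_loop ..) (.done ?_ le_rfl)).mono
    (by simpa using M.cost_pos) le_rfl
  simp [he]

theorem loop_step {e : Expr} (he : e.eval inp s ≠ 0) (h : Det inp c s T t)
    (h' : Det inp (.loop e c) t T' u) : Det inp (.loop e c) s (T + T' + 1) u := by
  refine ⟨Keeps.trans (h.1.of_imp (fun _ h => h) fun _ h => h) h'.1, fun M K q => ?_⟩
  have hc := M.cost_pos
  refine (Reach.of_pure (M.stp_loop ..) ?_).mono (T := T * M.cost + T' * M.cost + 1)
    (by rw [add_mul, add_mul]; omega) le_rfl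
  rw [if_pos he]
  refine (h.2 M _ q).bind ?_
  rintro _ rfl
  exact h'.2 M K q

end Det

/-! ### Counting loops -/

/-- `for x := 0, …, e - 1 do c` -/
def Cmd.forTo (x : ℕ) (e : Expr) (c : Cmd) : Cmd :=
  .seq (.assign x (.lit 0))
    (.loop (.lt (.var x) e) (.seq c (.assign x (.add (.var x) (.lit 1)))))

theorem Keeps.forTo_start {x : ℕ} {e : Expr} {c : Cmd} (s : Store) (v : ℕ) :
    Keeps (.forTo x e c) s (s.setVar x v) :=
  Keeps.setVar _ (by simp [Cmd.forTo, Cmd.modVar])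

theorem Keeps.forTo_body {x : ℕ} {e : Expr} {c : Cmd} {s t : Store} (h : Keeps c s t) :
    Keeps (.forTo x e c) s t := by
  refine h.of_imp (fun y hy => ?_) fun y hy => ?_
  · simp only [Cmd.forTo, Cmd.modVar, Bool.or_eq_false_iff] at hy
    exact hy.2.1
  · simp only [Cmd.forTo, Cmd.modArr, Bool.or_eq_false_iff] at hy
    exact hy.2.1

section forTo

variable {n : ℕ} {inp : Input n} {M : Machine inp} {c : Cmd} {s : Store}
  {x N T B : ℕ} {e : Expr}

/-- `V i` bounds the final expectation at the start of round `i`; the induction runs over the number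
of remaining rounds. A round costs three units besides its body (test, sequencing, increment), and
the loop three more (sequencing, initialisation, last test). -/
theorem Triple.forTo (V : ℕ → Store → ℝ≥0∞)
    (he : ∀ t, Keeps (.forTo x e c) s t → e.eval inp t = N) (hx : c.modVar x = false)
    (h : ∀ i < N, ∀ t, Keeps (.forTo x e c) s t → t.var x = i →
      Triple M c t T B (fun u => V (i + 1) (u.setVar x (i + 1))) (V i t)) :
    Triple M (.forTo x e c) s (N * (T + 3) + 3) (N * B) (V N) (V 0 (s.setVar x 0)) := by
  have key : ∀ j ≤ N, ∀ t, Keeps (.forTo x e c) s t → t.var x = N - j →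
      Triple M (.loop (.lt (.var x) e) (.seq c (.assign x (.add (.var x) (.lit 1))))) t
        (j * (T + 3) + 1) (j * B) (V N) (V (N - j) t) := by
    intro j
    induction j with
    | zero =>
      intro _ t ht htx
      have h0 : (Expr.lt (.var x) e).eval inp t = 0 := by simp [Expr.eval, he t ht, htx]
      simpa using (Det.loop_done h0).triple M (V N)
    | succ j ih =>
      intro hj t ht htx
      have h0 : (Expr.lt (.var x) e).eval inp t ≠ 0 := by
        simp only [Expr.eval, he t ht, htx]
        rw [if_pos (by omega)]
        exact one_ne_zero
      have hb := h (N - (j + 1)) (by omega) t ht htx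
      have hN : N - (j + 1) + 1 = N - j := by omega
      intro K q
      have hc := M.cost_pos
      have hm : (j + 1) * (T + 3) * M.cost = j * (T + 3) * M.cost + T * M.cost + 3 * M.cost := by
        ring
      refine (Reach.of_pure (M.stp_loop ..) ?_).mono
        (T := T * M.cost + (M.cost + (j * (T + 3) + 1) * M.cost) + 1 + 1)
        (by rw [add_mul, add_mul, hm]; omega) le_rfl
      rw [if_pos h0]
      refine Reach.of_pure (M.stp_seq ..) ((hb _ q).bind ?_)
      rintro _ ⟨u, b, rfl, hbB, hu⟩
      have hux : u.var x = N - (j + 1) := (hu.var x hx).trans htx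
      have hk : Keeps (.forTo x e c) s (u.setVar x (N - j)) :=
        (ht.trans hu.forTo_body).trans (Keeps.forTo_start _ _)
      refine (Reach.of_pure (M.stp_assign ..) ?_).mono (T := (j * (T + 3) + 1) * M.cost + 1)
        (by omega) le_rfl
      simp only [Expr.eval, hux, hN]
      refine (ih (by omega) _ hk (by simp [Store.setVar]) K b).conseq ?_
      rintro _ ⟨w, b', rfl, hb', hw⟩
      refine ⟨⟨w, b', rfl, by rw [add_mul]; omega, ?_⟩, le_rfl⟩
      refine Keeps.trans (t := u.setVar x (N - j)) ?_ hw
      refine (hu.seq_left.trans (Keeps.setVar _ ?_)).of_imp (fun _ h => h) fun _ h => h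
      simp [Cmd.modVar]
  have h0 := key N le_rfl (s.setVar x 0) (Keeps.forTo_start _ _) (by simp [Store.setVar])
  rw [Nat.sub_self] at h0
  have := (Det.assign (inp := inp) (s := s) x (.lit 0)).triple_seq h0
  exact this.conseq (by omega) le_rfl (fun _ _ => le_rfl) le_rfl

theorem Det.forTo (Inv : ℕ → Store → Prop)
    (he : ∀ t, Keeps (.forTo x e c) s t → e.eval inp t = N) (hx : c.modVar x = false)
    (h0 : Inv 0 (s.setVar x 0))
    (h : ∀ i < N, ∀ t, Keeps (.forTo x e c) s t → t.var x = i → Inv i t →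
      ∃ u, Det inp c t T u ∧ Inv (i + 1) (u.setVar x (i + 1))) :
    ∃ t, Det inp (.forTo x e c) s (N * (T + 3) + 3) t ∧ Inv N t := by
  have key : ∀ j ≤ N, ∀ t, Keeps (.forTo x e c) s t → t.var x = N - j → Inv (N - j) t →
      ∃ u, Det inp (.loop (.lt (.var x) e) (.seq c (.assign x (.add (.var x) (.lit 1))))) t
        (j * (T + 3) + 1) u ∧ Inv N u := by
    intro j
    induction j with
    | zero =>
      intro _ t ht htx hI
      have h0 : (Expr.lt (.var x) e).eval inp t = 0 := by simp [Expr.eval, he t ht, htx]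
      exact ⟨t, by simpa using Det.loop_done h0, hI⟩
    | succ j ih =>
      intro hj t ht htx hI
      have h0 : (Expr.lt (.var x) e).eval inp t ≠ 0 := by
        simp only [Expr.eval, he t ht, htx]
        rw [if_pos (by omega)]
        exact one_ne_zero
      obtain ⟨u, hu, hIu⟩ := h (N - (j + 1)) (by omega) t ht htx hI
      have hux : u.var x = N - (j + 1) := (hu.1.var x hx).trans htx
      have hN : N - (j + 1) + 1 = N - j := by omega
      rw [hN] at hIu
      have hk : Keeps (.forTo x e c) s (u.setVar x (N - j)) :=
        (ht.trans hu.1.forTo_body).trans (Keeps.forTo_start _ _)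
      obtain ⟨w, hw, hIw⟩ := ih (by omega) _ hk (by simp [Store.setVar]) hIu
      have hd := hu.seq (Det.assign x (.add (.var x) (.lit 1)))
      simp only [Expr.eval, hux, hN] at hd
      exact ⟨w, (hd.loop_step h0 hw).mono (by ring_nf; omega), hIw⟩
  obtain ⟨t, ht, hI⟩ := key N le_rfl (s.setVar x 0) (Keeps.forTo_start _ _)
    (by simp [Store.setVar]) (by simpa using h0)
  exact ⟨t, (Det.seq (Det.assign x (.lit 0)) ht).mono (by omega), hI⟩

end forTo

/-! ### Execution with an oracle -/

/-- Programs run as they are, with the oracle `O`. -/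
def oracleMachine {n : ℕ} (inp : Input n) (O : Finset (Fin n) → PMF Bool) : Machine inp where
  stp := step O
  tr := id
  cnt := id
  cost := 1
  O := O
  cost_pos := le_rfl
  stp_assign _ _ _ _ _ := rfl
  stp_write _ _ _ _ _ _ := rfl
  stp_rand _ _ _ _ _ := step_rand ..
  stp_seq _ _ _ _ _ := rfl
  stp_ite _ _ _ _ _ _ := rfl
  stp_loop _ _ _ _ _ := rfl
  reach_ora x a s K q Term f T u h := by
    refine Reach.of_map (p := O (s.query n a))
      (g := fun b => ⟨⟨inp, s.setVar x b.toNat, K⟩, [], q + 1⟩) rfl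
      -- `Reach` wants a function of the configuration, so the answer is read back from the variable
      -- that has just received it.
      (fun γ => u (γ.cur.st.var x != 0)) (fun b _ => ?_) ?_
    · have hb : ((s.setVar x b.toNat).var x != 0) = b := by
        cases b <;> simp [Store.setVar]
      simp only [hb]
      exact h b (q + 1) le_rfl
    · refine (PMF.expect_congr _ fun b _ => ?_).le
      cases b <;> simp [Store.setVar]

/-! ### Execution with a procedure in place of the oracle -/

/-- The configuration `γ` of a procedure, as part of a configuration of the calling program. -/
def Config.inside {n : ℕ} (x : ℕ) (fr : Frame n) (q : ℕ) (γ : Config n) : Config n :=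
  ⟨γ.cur, γ.stack ++ [(x, fr)], q + γ.calls⟩

theorem Config.inside_injective {n : ℕ} (x : ℕ) (fr : Frame n) (q : ℕ) :
    Function.Injective (Config.inside x fr q) := by
  rintro ⟨c, st, k⟩ ⟨c', st', k'⟩ h
  simp only [Config.inside, Config.mk.injEq, List.append_cancel_right_eq, add_right_inj] at h
  obtain ⟨rfl, rfl, rfl⟩ := h
  rfl

/-- A running procedure never looks at the frames below its own; only after it has halted does the
caller's frame matter. -/
theorem step_inside {n : ℕ} (O : Finset (Fin n) → PMF Bool) (x : ℕ) (fr : Frame n) (q : ℕ)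
    {γ : Config n} (h : ¬ γ.Halted) :
    step O (γ.inside x fr q) = (step O γ).map (Config.inside x fr q) := by
  obtain ⟨⟨inp, s, todo⟩, stack, calls⟩ := γ
  match todo, stack with
  | [], [] => exact absurd ⟨rfl, rfl⟩ h
  | [], (y, f) :: rest => simp [step, Config.inside, PMF.pure_map]
  | .assign _ _ :: _, _ => simp [step, Config.inside, PMF.pure_map]
  | .write _ _ _ :: _, _ => simp [step, Config.inside, PMF.pure_map]
  | .rand _ _ :: _, _ =>
    simp only [Config.inside, step_rand, PMF.map_comp]
    rfl
  | .ora _ _ :: _, _ =>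
    simp only [Config.inside, step, PMF.map_comp]
    rfl
  | .call _ _ _ :: _, _ => simp [step, Config.inside, PMF.pure_map]
  | .seq _ _ :: _, _ => simp [step, Config.inside, PMF.pure_map]
  | .ite _ _ _ :: _, _ =>
    simp only [step, Config.inside, PMF.pure_map]
    rfl
  | .loop _ _ :: _, _ =>
    simp only [step, Config.inside, PMF.pure_map]
    rfl

/-- The call behaves like one draw from the law of the procedure's final configuration, followed by
the rest of the caller. Runs that halt before time `T` return at once, so `T` is only an upper
bound. -/
theorem reach_inside {n : ℕ} {O : Finset (Fin n) → PMF Bool} {x : ℕ} {fr : Frame n} {q : ℕ}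
    {Term : Config n → Prop} {f : Config n → ℝ≥0∞} {T' : ℕ} {w : Config n → ℝ≥0∞}
    (hw : ∀ γ : Config n, γ.Halted → Reach (step O) Term f (γ.inside x fr q) T' (w γ)) (T : ℕ)
    (γ : Config n) (hT : ∀ γ' ∈ (chain (step O) T γ).support, γ'.Halted) :
    Reach (step O) Term f (γ.inside x fr q) (T' + T) ((chain (step O) T γ).expect w) := by
  induction T generalizing γ with
  | zero =>
    have : γ.Halted := hT γ (by simp [chain])
    simpa [chain, PMF.expect_pure] using hw γ this
  | succ T ih =>
    by_cases hγ : γ.Halted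
    · rw [chain_of_fixed (hγ.step_eq O), PMF.expect_pure]
      exact (hw γ hγ).mono (by omega) le_rfl
    · rw [chain_succ] at hT ⊢
      rw [PMF.expect_bind]
      refine Reach.of_map (step_inside O x fr q hγ)
        -- The bound is known on embedded configurations only; `0` elsewhere is a dummy value that
        -- is never used, and injectivity of the embedding makes the extension well behaved.
        (Function.extend (Config.inside x fr q) (fun γ' => (chain (step O) T γ').expect w) 0)
        (fun γ' hγ' => ?_) ?_
      · rw [(Config.inside_injective x fr q).extend_apply]
        exact ih γ' fun γ'' h'' => hT γ'' ((PMF.mem_support_bind_iff _ _ _).2 ⟨γ', hγ', h''⟩)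
      · simp only [(Config.inside_injective x fr q).extend_apply]
        exact le_rfl

/-- The law of the answer of the procedure `D` for the set `X`, if it halts within `T` steps. -/
def answerLaw {n : ℕ} (k : ℕ) (w : List Bool) (D : Cmd) (T : ℕ) (X : Finset (Fin n)) : PMF Bool :=
  (run (noOracle n) D ⟨k, w, X, []⟩ T).map fun γ => γ.cur.st.yes

/-- Programs run with all oracle calls executed by `D`, which always halts within `T` steps. -/
def linkMachine {n : ℕ} (inp : Input n) (D : Cmd) (T : ℕ)
    (hD : ∀ X : Finset (Fin n), HaltsWithin (noOracle n) D ⟨inp.k, inp.word, X, []⟩ T) :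
    Machine inp where
  stp := step (noOracle n)
  tr c := c.link D
  cnt _ := 0
  -- One unit to enter the procedure, `T` to run it, one to return.
  cost := T + 2
  O := answerLaw inp.k inp.word D T
  cost_pos := by omega
  stp_assign _ _ _ _ _ := rfl
  stp_write _ _ _ _ _ _ := rfl
  stp_rand _ _ _ _ _ := step_rand ..
  stp_seq _ _ _ _ _ := rfl
  stp_ite e c d s K q := by
    simp only [Cmd.link, step]
    split_ifs <;> rfl
  stp_loop _ _ _ _ _ := rfl
  reach_ora x a s K q Term f T' u h := by
    have hX := hD (s.query n a)
    unfold HaltsWithin at hX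
    rw [run_eq_chain] at hX
    have := reach_inside (x := x) (fr := ⟨inp, s, K⟩) (q := q) (Term := Term) (f := f)
      (w := fun γ => u γ.cur.st.yes) (T' := T' + 1) (O := noOracle n) (fun γ hγ => by
        obtain ⟨⟨inp', s', todo⟩, stack, calls⟩ := γ
        obtain ⟨rfl, rfl⟩ := hγ
        exact Reach.of_pure rfl (h s'.yes (q + calls) (by omega))) T _ hX
    unfold answerLaw
    rw [PMF.expect_map, run_eq_chain]
    rw [show T' + (T + 2) = T' + 1 + T + 1 by omega]
    exact Reach.of_pure rfl this

/-! ### Consequences for complete programs -/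

section Sound

variable {n : ℕ} {inp : Input n} {P : Cmd} {T B : ℕ} {f : Store → ℝ≥0∞} {v : ℝ≥0∞}

theorem Triple.settled {M : Machine inp}
    (hH : ∀ γ : Config n, γ.Halted → M.stp γ = PMF.pure γ)
    (h : Triple M P Store.init T B f v) {t : ℕ} (ht : T * M.cost ≤ t) :
    (∀ γ ∈ (chain M.stp t ⟨⟨inp, Store.init, [M.tr P]⟩, [], 0⟩).support,
      γ.Halted ∧ M.cnt γ.calls ≤ M.cnt 0 + B) ∧
    (chain M.stp t ⟨⟨inp, Store.init, [M.tr P]⟩, [], 0⟩).expect (fun γ => f γ.cur.st) ≤ v := by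
  have := (h [] 0).chain_settled (by
    rintro _ ⟨s, q, rfl, -, -⟩
    exact hH _ ⟨rfl, rfl⟩) ht
  refine ⟨fun γ hγ => ?_, this.2⟩
  obtain ⟨s, q, rfl, hq, -⟩ := this.1 γ hγ
  exact ⟨⟨rfl, rfl⟩, hq⟩

/-- Markov's inequality: `f` dominates the indicator of the complement of `S`, so its expectation
bounds the probability of failure. -/
theorem le_haltProb_of_expect {O : Finset (Fin n) → PMF Bool} {S : Set Store} {t : ℕ}
    (hf : ∀ s, s ∉ S → 1 ≤ f s) (hh : ∀ γ ∈ (run O P inp t).support, γ.Halted)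
    (hv : (run O P inp t).expect (fun γ => f γ.cur.st) ≤ v) : 1 - v ≤ haltProb O P inp S := by
  classical
  refine le_trans ?_ (le_iSup _ t)
  rw [tsub_le_iff_right, PMF.toOuterMeasure_eq_expect]
  refine le_trans ?_ (add_le_add_right hv _)
  unfold PMF.expect
  rw [← ENNReal.tsum_add, ← PMF.tsum_coe (run O P inp t)]
  refine ENNReal.tsum_le_tsum fun γ => ?_
  rw [← mul_add]
  by_cases hγ : γ ∈ (run O P inp t).support
  · refine le_mul_of_one_le_right zero_le ?_
    by_cases hS : γ.cur.st ∈ S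
    · simp [hS, hh γ hγ]
    · exact (hf _ hS).trans le_add_self
  · rw [PMF.mem_support_iff, not_not] at hγ
    simp [hγ]

theorem calls_le_of_mem_step {O : Finset (Fin n) → PMF Bool} {γ γ' : Config n}
    (h : γ' ∈ (step O γ).support) : γ.calls ≤ γ'.calls := by
  obtain ⟨⟨inp, s, todo⟩, stack, calls⟩ := γ
  match todo, stack with
  | [], [] =>
    simp only [step, PMF.mem_support_pure_iff] at h
    rw [h]
  | [], (y, f) :: rest =>
    simp only [step, PMF.mem_support_pure_iff] at h
    rw [h]
  | .assign _ _ :: _, _ | .write _ _ _ :: _, _ | .call _ _ _ :: _, _ | .seq _ _ :: _, _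
  | .ite _ _ _ :: _, _ | .loop _ _ :: _, _ =>
    simp only [step, PMF.mem_support_pure_iff] at h
    rw [h]
  | .rand _ _ :: _, _ =>
    rw [step_rand, PMF.mem_support_map_iff] at h
    obtain ⟨r, -, rfl⟩ := h
    exact le_rfl
  | .ora _ _ :: _, _ =>
    simp only [step] at h
    obtain ⟨r, -, rfl⟩ := (PMF.mem_support_map_iff _ _ _).1 h
    exact Nat.le_succ _

theorem exists_calls_le_chain (O : Finset (Fin n) → PMF Bool) (γ : Config n) (t : ℕ) :
    ∃ γ' ∈ (chain (step O) t γ).support, γ.calls ≤ γ'.calls := by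
  induction t with
  | zero => exact ⟨γ, by simp [chain], le_rfl⟩
  | succ t ih =>
    obtain ⟨γ', h1, h2⟩ := ih
    obtain ⟨γ'', h3⟩ := (step O γ').support_nonempty
    exact ⟨γ'', (PMF.mem_support_bind_iff _ _ _).2 ⟨γ', h1, h3⟩, h2.trans (calls_le_of_mem_step h3)⟩

/-- The triple only limits the calls of finished runs. An unfinished configuration is extended to a
finished one, and the number of calls never decreases on the way. -/
theorem Triple.callsAtMost {O : Finset (Fin n) → PMF Bool}
    (h : Triple (oracleMachine inp O) P Store.init T B f v) {b : ℝ} (hb : (B : ℝ) ≤ b) :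
    CallsAtMost O P inp b := by
  intro t γ hγ
  refine le_trans ?_ hb
  rw [run_eq_chain] at hγ
  obtain ⟨γ', h1, h2⟩ := exists_calls_le_chain O γ (T * 1)
  have h3 : γ' ∈ (chain (step O) (t + T * 1) ⟨⟨inp, Store.init, [P]⟩, [], 0⟩).support := by
    rw [chain_add]
    exact (PMF.mem_support_bind_iff _ _ _).2 ⟨γ, hγ, h1⟩
  have h4 := ((h.settled (fun γ hγ => hγ.step_eq O) (t := t + T * 1) (Nat.le_add_left _ _)).1
    γ' h3).2
  have h5 : γ'.calls ≤ 0 + B := h4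
  exact_mod_cast h2.trans (by simpa using h5)

theorem Triple.le_haltProb {O : Finset (Fin n) → PMF Bool}
    (h : Triple (oracleMachine inp O) P Store.init T B f v) {S : Set Store}
    (hf : ∀ s, s ∉ S → 1 ≤ f s) : 1 - v ≤ haltProb O P inp S := by
  have := h.settled (fun γ hγ => hγ.step_eq O) le_rfl
  refine le_haltProb_of_expect (f := f) (t := T * (oracleMachine inp O).cost) hf ?_ ?_
  · rw [run_eq_chain]
    exact fun γ hγ => (this.1 γ hγ).1
  · rw [run_eq_chain]
    exact this.2

section Link

variable {D : Cmd} {TD : ℕ}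
  {hD : ∀ X : Finset (Fin n), HaltsWithin (noOracle n) D ⟨inp.k, inp.word, X, []⟩ TD}

theorem Triple.le_haltProb_link (h : Triple (linkMachine inp D TD hD) P Store.init T B f v)
    {S : Set Store} (hf : ∀ s, s ∉ S → 1 ≤ f s) :
    1 - v ≤ haltProb (noOracle n) (P.link D) inp S := by
  have := h.settled (fun γ hγ => hγ.step_eq _) le_rfl
  refine le_haltProb_of_expect (f := f) (t := T * (linkMachine inp D TD hD).cost) hf ?_ ?_
  · rw [run_eq_chain]
    exact fun γ hγ => (this.1 γ hγ).1
  · rw [run_eq_chain]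
    exact this.2

/-- The time bound holds for every run, so the terms of the series vanish from there on and the
earlier ones are at most `1`. -/
theorem Triple.expectedTime_le_link (h : Triple (linkMachine inp D TD hD) P Store.init T B f v) :
    expectedTime (noOracle n) (P.link D) inp ≤ (T * (TD + 2) : ℕ) := by
  unfold expectedTime
  have hz : ∀ t ∉ Finset.range (T * (TD + 2)),
      (run (noOracle n) (P.link D) inp t).toOuterMeasure {γ | ¬ γ.Halted} = 0 := by
    intro t ht
    rw [PMF.toOuterMeasure_apply_eq_zero_iff, Set.disjoint_left]
    intro γ hγ hn
    rw [run_eq_chain] at hγ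
    exact hn ((h.settled (fun γ hγ => hγ.step_eq _)
      (by simpa [linkMachine] using ht)).1 γ hγ).1
  rw [tsum_eq_sum hz]
  refine (Finset.sum_le_card_nsmul _ _ 1 fun t _ => ?_).trans (by simp)
  refine ((PMF.toOuterMeasure_mono _ (Set.subset_univ _))).trans_eq ?_
  exact (PMF.toOuterMeasure_apply_eq_one_iff _ _).2 (Set.subset_univ _)

end Link

/-- A decision procedure that halts in time answers like an oracle. -/
theorem haltProb_le_answerLaw {k : ℕ} {w : List Bool} {D : Cmd} {TD : ℕ} {X : Finset (Fin n)}
    (hD : HaltsWithin (noOracle n) D ⟨k, w, X, []⟩ TD) (b : Bool) :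
    haltProb (noOracle n) D ⟨k, w, X, []⟩ {s | s.yes = b} ≤ answerLaw k w D TD X b := by
  classical
  refine iSup_le fun t => ?_
  -- `D` has settled at time `TD`, so its answer has the same law at time `TD + t`, where it can be
  -- compared with the event at time `t`.
  have h1 : answerLaw k w D TD X b =
      (run (noOracle n) D ⟨k, w, X, []⟩ (TD + t)).expect
        (fun γ => if γ.cur.st.yes = b then 1 else 0) := by
    have h2 : answerLaw k w D TD X b = (answerLaw k w D TD X).expect
        (fun b' => if b' = b then 1 else 0) := by
      unfold PMF.expect
      rw [tsum_eq_single b] <;> simp +contextual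
    rw [h2, answerLaw, PMF.expect_map, run_eq_chain, run_eq_chain, chain_add, PMF.expect_bind]
    refine PMF.expect_congr _ fun γ hγ => ?_
    rw [chain_of_fixed, PMF.expect_pure]
    refine Config.Halted.step_eq (hD γ ?_) _
    rwa [run_eq_chain]
  rw [h1, PMF.toOuterMeasure_eq_expect, run_eq_chain, run_eq_chain, add_comm TD, chain_add,
    PMF.expect_bind]
  refine PMF.expect_mono _ fun γ _ => ?_
  by_cases hγ : γ.Halted
  · rw [chain_of_fixed (hγ.step_eq _), PMF.expect_pure]
    by_cases hb : γ.cur.st.yes = b <;> simp [hb, hγ]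
  · simp [hγ]

end Sound

/-! ### Majority votes -/

theorem Store.var_setVar (s : Store) (x v y : ℕ) :
    (s.setVar x v).var y = if y = x then v else s.var y := by
  simp [Store.setVar, Function.update_apply]

theorem Store.arr_setVar (s : Store) (x v : ℕ) : (s.setVar x v).arr = s.arr := rfl

theorem Store.var_setArr (s : Store) (a i v : ℕ) : (s.setArr a i v).var = s.var := rfl

theorem Store.arr_setArr (s : Store) (a i v b j : ℕ) :
    (s.setArr a i v).arr b j = if b = a ∧ j = i then v else s.arr b j := by
  by_cases hb : b = a
  · subst hb
    by_cases hj : j = i <;> simp [Store.setArr, hj]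
  · simp [Store.setArr, hb]

/-- One step of the Boyer–Moore majority vote: the vote is `x`, the candidate `y`, its lead `z`. -/
def Cmd.vote (x y z : ℕ) : Cmd :=
  .ite (.var z)
    (.ite (.eq (.var y) (.var x)) (.assign z (.add (.var z) (.lit 1)))
      (.assign z (.sub (.var z) (.lit 1))))
    (.seq (.assign y (.var x)) (.assign z (.lit 1)))

/-- The Boyer–Moore majority vote over `e` executions of `c`, whose results are in `x`. -/
def Cmd.majority (i : ℕ) (e : Expr) (c : Cmd) (x y z : ℕ) : Cmd :=
  .seq (.assign z (.lit 0)) (.forTo i e (.seq c (.vote x y z)))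

theorem Det.vote {n : ℕ} {inp : Input n} (s : Store) (x y z : ℕ) :
    Det inp (.vote x y z) s 4
      (if s.var z ≠ 0 then if s.var y = s.var x then s.setVar z (s.var z + 1)
        else s.setVar z (s.var z - 1) else (s.setVar y (s.var x)).setVar z 1) := by
  refine Det.ite (T := 3) _ ?_
  by_cases h : s.var z = 0
  · simpa [Expr.eval, h] using
      (Det.assign (inp := inp) (s := s) y (.var x)).seq (Det.assign z (.lit 1))
  · simp only [Expr.eval, ne_eq, h, not_false_eq_true, if_true]
    refine (Det.ite (T := 1) _ ?_).mono (T := 2) (by omega)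
    by_cases h' : s.var y = s.var x
    · simpa [Expr.eval, h'] using Det.assign (inp := inp) (s := s) z (.add (.var z) (.lit 1))
    · simpa [Expr.eval, h'] using Det.assign (inp := inp) (s := s) z (.sub (.var z) (.lit 1))

/-- The potential of a majority vote with respect to the correct result `w`. -/
def votePotential (α β : ℝ≥0∞) (w y z : ℕ) (s : Store) : ℝ≥0∞ :=
  if s.var y = w then β ^ s.var z else α ^ s.var z

/-- A correct vote multiplies the potential by `β`. A wrong one multiplies it by `α`, except when
vote and candidate are both wrong and different: then the potential drops to `α ^ m`, below the
allowed `α ^ (m + 2)`. -/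
theorem votePotential_vote_le {α β : ℝ≥0∞} (hα : 1 ≤ α) (hαβ : α * β = 1) {w x y z : ℕ}
    (hyz : y ≠ z) (s : Store) :
    votePotential α β w y z (if s.var z ≠ 0 then if s.var y = s.var x
        then s.setVar z (s.var z + 1) else s.setVar z (s.var z - 1)
        else (s.setVar y (s.var x)).setVar z 1) ≤
      votePotential α β w y z s * if s.var x = w then β else α := by
  have hp : ∀ m, α ^ m ≤ α ^ (m + 1 + 1) := fun m => pow_le_pow_right₀ hα (by omega)
  unfold votePotential
  obtain hz | ⟨m, hm⟩ : s.var z = 0 ∨ ∃ m, s.var z = m + 1 := by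
    rcases Nat.eq_zero_or_eq_succ_pred (s.var z) with h | h
    exacts [.inl h, .inr ⟨_, h⟩]
  · by_cases hw : s.var x = w <;> simp [hz, Store.var_setVar, hyz, hw]
  · have hβα : β * α = 1 := by rw [mul_comm, hαβ]
    by_cases hyx : s.var y = s.var x
    · by_cases hw : s.var x = w <;> simp [hm, Store.var_setVar, hyz, hyx, hw, pow_succ]
    · by_cases hw : s.var x = w
      · have hyw : s.var y ≠ w := fun h => hyx (h.trans hw.symm)
        simp [hm, Store.var_setVar, hyz, hw, hyw, pow_succ, mul_assoc, hαβ]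
      · by_cases hyw : s.var y = w
        · have hwx : w ≠ s.var x := fun h => hw h.symm
          simp [hm, Store.var_setVar, hyz, hwx, hw, hyw, pow_succ, mul_assoc, hβα]
        · simpa [hm, Store.var_setVar, hyz, hyx, hw, hyw, pow_succ] using hp m

/-- The potential is `1` at the start, shrinks by the factor `ρ` per round in expectation, and is at
least `1` whenever the final candidate is wrong. No majority has to be shown to exist, and the
results need not be binary. -/
theorem Triple.majority {n : ℕ} {inp : Input n} {M : Machine inp} {c : Cmd} {s : Store}
    {i x y z N T B w : ℕ} {e : Expr} {α β ρ p : ℝ≥0∞} (hα : 1 ≤ α) (hαβ : α * β = 1)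
    (hρ : β + (α - β) * p ≤ ρ) (hyz : y ≠ z) (hiy : y ≠ i) (hiz : z ≠ i)
    (hci : c.modVar i = false) (hcy : c.modVar y = false) (hcz : c.modVar z = false)
    (he : ∀ t, Keeps (.majority i e c x y z) s t → e.eval inp t = N)
    (h : ∀ t, Keeps (.majority i e c x y z) s t →
      Triple M c t T B (fun u => if u.var x = w then 0 else 1) p) :
    Triple M (.majority i e c x y z) s (N * (T + 8) + 5) (N * B)
      (fun u => if u.var y = w then 0 else 1) (ρ ^ N) := by
  have hβ : β ≤ α := by
    refine le_trans ?_ hα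
    calc β = 1 * β := (one_mul _).symm
      _ ≤ α * β := by gcongr
      _ = 1 := hαβ
  have hk0 : ∀ t, Keeps (.forTo i e (.seq c (.vote x y z))) (s.setVar z 0) t →
      Keeps (.majority i e c x y z) s t := fun t ht =>
    Keeps.trans (t := s.setVar z 0) (Keeps.setVar _ (by simp [Cmd.majority, Cmd.modVar]))
      ht.seq_right
  have hci' : (Cmd.seq c (.vote x y z)).modVar i = false := by
    simp [Cmd.vote, Cmd.modVar, hci, hiy, hiz]
  have hfor := Triple.forTo (M := M) (x := i) (e := e) (c := .seq c (.vote x y z))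
    (s := s.setVar z 0) (N := N) (T := T + 4 + 1) (B := B + 0)
    (fun j t => ρ ^ (N - j) * votePotential α β w y z t) (fun t ht => he t (hk0 t ht)) hci' (by
      intro j hj t ht htj
      set V := votePotential α β w y z t
      have h1 := (h t (hk0 t ht)).affine (ρ ^ (N - (j + 1)) * (V * β))
        (ρ ^ (N - (j + 1)) * (V * (α - β)))
      refine (Triple.seq (T' := 4) (B' := 0) h1 fun u hu => ?_).conseq le_rfl le_rfl
        (fun _ _ => le_rfl) ?_
      · refine ((Det.vote u x y z).triple M _).conseq le_rfl le_rfl (fun _ _ => le_rfl) ?_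
        have hV : votePotential α β w y z u = V := by
          simp only [V, votePotential, hu.var y hcy, hu.var z hcz]
        have h2 := votePotential_vote_le hα hαβ (w := w) (x := x) hyz u
        rw [hV] at h2
        have h3 : ∀ (r : Store) (v : ℕ), votePotential α β w y z (r.setVar i v) =
            votePotential α β w y z r := by
          intro r v
          simp [votePotential, Store.var_setVar, hiy, hiz]
        rw [h3]
        calc _ ≤ ρ ^ (N - (j + 1)) * (V * if u.var x = w then β else α) := by gcongr
          _ ≤ _ := by
            split_ifs
            · simp
            · rw [mul_one, ← mul_add, ← mul_add, add_tsub_cancel_of_le hβ]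
      · calc _ = ρ ^ (N - (j + 1)) * V * (β + (α - β) * p) := by ring
          _ ≤ ρ ^ (N - (j + 1)) * V * ρ := by gcongr
          _ = ρ ^ (N - j) * V := by
            rw [show N - j = N - (j + 1) + 1 by omega, pow_succ]
            ring)
  refine ((Det.assign z (.lit 0)).triple_seq hfor).conseq (by ring_nf; omega) (by simp) ?_ ?_
  · intro t _
    simp only [Nat.sub_self, pow_zero, one_mul, votePotential]
    split_ifs
    · exact zero_le
    · exact one_le_pow₀ hα
  · simp [votePotential, Store.var_setVar, hiz]

/-- Constants for the majority vote over results of error probability at most `c < 1/2`. -/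
theorem exists_vote_constants {c : ℝ} (hc0 : 0 ≤ c) (hc : c < 1 / 2) :
    ∃ (α β : ℝ≥0∞) (r : ℕ), 1 ≤ α ∧ α * β = 1 ∧ 1 ≤ r ∧
      (β + (α - β) * ENNReal.ofReal c) ^ r ≤ 2⁻¹ := by
  have h1 : (0 : ℝ) < 2 * (1 - c) := by linarith
  have hle : 1 / (2 * (1 - c)) ≤ 2 * (1 - c) := by
    rw [div_le_iff₀ h1]
    nlinarith
  -- With `α = 2 * (1 - c)` and `β = α⁻¹` the expected factor is `1 / 2 + 2 * c * (1 - c)`, which is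
  -- below `1` exactly because `c ≠ 1 / 2`; this choice also covers `c = 0`.
  have hρ : (1 / (2 * (1 - c)) + (2 * (1 - c) - 1 / (2 * (1 - c))) * c : ℝ) < 1 := by
    have : (1 / (2 * (1 - c)) + (2 * (1 - c) - 1 / (2 * (1 - c))) * c : ℝ) =
        1 / 2 + 2 * c * (1 - c) := by
      have h2 : (1 - c : ℝ) ≠ 0 := by linarith
      field_simp
      ring
    rw [this]
    nlinarith
  have hρ0 : (0 : ℝ) ≤ 1 / (2 * (1 - c)) + (2 * (1 - c) - 1 / (2 * (1 - c))) * c := by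
    have : (0 : ℝ) ≤ 1 / (2 * (1 - c)) := by positivity
    have := mul_nonneg (sub_nonneg.2 hle) hc0
    linarith
  obtain ⟨r, hr⟩ := exists_pow_lt_of_lt_one (show (0 : ℝ) < 1 / 2 by norm_num) hρ
  refine ⟨ENNReal.ofReal (2 * (1 - c)), ENNReal.ofReal (1 / (2 * (1 - c))), r + 1, ?_, ?_,
    by omega, ?_⟩
  · rw [ENNReal.one_le_ofReal]
    linarith
  · rw [← ENNReal.ofReal_mul h1.le, mul_one_div_cancel h1.ne', ENNReal.ofReal_one]
  · rw [← ENNReal.ofReal_sub _ (by positivity), ← ENNReal.ofReal_mul (sub_nonneg.2 hle),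
      ← ENNReal.ofReal_add (by positivity) (mul_nonneg (sub_nonneg.2 hle) hc0),
      ← ENNReal.ofReal_pow hρ0]
    rw [show (2⁻¹ : ℝ≥0∞) = ENNReal.ofReal (1 / 2) by
      rw [one_div, ENNReal.ofReal_inv_of_pos (by norm_num)]; simp]
    refine ENNReal.ofReal_le_ofReal ?_
    exact (pow_le_pow_of_le_one hρ0 hρ.le (Nat.le_succ r)).trans hr.le

/-! ### The search tree

Every element `a` of the universe carries a label `lab a`. A node of the search tree consists of a
number `r` and a tuple `v` of left end points of blocks of `2 ^ r` consecutive labels. -/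

open Finset

/-- The elements whose labels lie in one of the blocks of width `2 ^ r` that begin at `v i`. -/
def blockSet {n k : ℕ} (lab : Fin n → ℕ) (r : ℕ) (v : Fin k → ℕ) : Finset (Fin n) :=
  {a | ∃ i, v i ≤ lab a ∧ lab a < v i + 2 ^ r}

/-- The node is sorted and its blocks contain a member of `F`. -/
def GoodNode {n k : ℕ} (F : Finset (Finset (Fin n))) (lab : Fin n → ℕ) (r : ℕ) (v : Fin k → ℕ) :
    Prop :=
  Monotone v ∧ ∃ W ∈ F, W ⊆ blockSet lab r v

/-- The child with number `b` of a node; its blocks have width `2 ^ r`. -/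
def childNode {k : ℕ} (r : ℕ) (v : Fin k → ℕ) (b : ℕ) : Fin k → ℕ :=
  fun i => v i + b / 2 ^ (i : ℕ) % 2 * 2 ^ r

open Classical in
/-- The number of proper descendants of a node in the search tree. -/
def descCount {n k : ℕ} (F : Finset (Finset (Fin n))) (lab : Fin n → ℕ) :
    ℕ → (Fin k → ℕ) → ℕ
  | 0, _ => 0
  | r + 1, v => if GoodNode F lab (r + 1) v then
      ∑ b ∈ range (2 ^ k), (1 + descCount F lab r (childNode r v b)) else 0

open Classical in
/-- The number of good leaves below a node of the search tree. -/
def leafCount {n k : ℕ} (F : Finset (Finset (Fin n))) (lab : Fin n → ℕ) :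
    ℕ → (Fin k → ℕ) → ℕ
  | 0, v => if GoodNode F lab 0 v then 1 else 0
  | r + 1, v => if GoodNode F lab (r + 1) v then
      ∑ b ∈ range (2 ^ k), leafCount F lab r (childNode r v b) else 0

/-- Tuples of block numbers at depth `j`. -/
def blockTuples (k j : ℕ) : Finset (Fin k → ℕ) := Fintype.piFinset fun _ => range (2 ^ j)

theorem mem_blockTuples {k j : ℕ} {x : Fin k → ℕ} : x ∈ blockTuples k j ↔ ∀ i, x i < 2 ^ j := by
  simp [blockTuples]

theorem sum_range_two_pow {α : Type*} [AddCommMonoid α] (k : ℕ) (G : (Fin k → ℕ) → α) :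
    ∑ b ∈ range (2 ^ k), G (fun i => b / 2 ^ (i : ℕ) % 2) =
      ∑ c : Fin k → Fin 2, G (fun i => c i) := by
  rw [Finset.sum_range fun b => G (fun i => b / 2 ^ (i : ℕ) % 2)]
  refine Fintype.sum_equiv finFunctionFinEquiv.symm _ _ fun b => ?_
  simp [finFunctionFinEquiv]

/-- Every tuple of block numbers at depth `j + 1` is `2 * x + c` for a unique tuple `x` at depth `j`
and a unique vector `c` of bits. -/
theorem sum_blockTuples_children {α : Type*} [AddCommMonoid α] (k j r : ℕ)
    (G : (Fin k → ℕ) → α) :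
    ∑ x ∈ blockTuples k j, ∑ b ∈ range (2 ^ k), G (childNode r (fun i => x i * 2 ^ (r + 1)) b) =
      ∑ y ∈ blockTuples k (j + 1), G (fun i => y i * 2 ^ r) := by
  have h1 : ∀ x : Fin k → ℕ,
      ∑ b ∈ range (2 ^ k), G (childNode r (fun i => x i * 2 ^ (r + 1)) b) =
      ∑ c : Fin k → Fin 2, G (fun i => (2 * x i + c i) * 2 ^ r) := by
    intro x
    rw [← sum_range_two_pow k fun c => G (fun i => (2 * x i + c i) * 2 ^ r)]
    refine Finset.sum_congr rfl fun b _ => congrArg G (funext fun i => ?_)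
    simp only [childNode]
    ring
  simp only [h1]
  rw [← Finset.sum_product']
  refine Finset.sum_bij' (fun p _ i => 2 * p.1 i + p.2 i)
    (fun y _ => (fun i => y i / 2, fun i => ⟨y i % 2, Nat.mod_lt _ two_pos⟩)) ?_ ?_ ?_ ?_ ?_
  · rintro ⟨x, c⟩ h
    simp only [mem_product, mem_blockTuples, mem_univ, and_true] at h ⊢
    intro i
    have := h i
    have := (c i).isLt
    rw [pow_succ]
    omega
  · intro y h
    simp only [mem_product, mem_blockTuples, mem_univ, and_true] at h ⊢
    intro i
    have := h i
    rw [pow_succ] at this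
    omega
  · rintro ⟨x, c⟩ -
    refine Prod.ext (funext fun i => ?_) (funext fun i => Fin.ext ?_)
    · have := (c i).isLt
      simp only
      omega
    · have := (c i).isLt
      simp only
      omega
  · intro y _
    refine funext fun i => ?_
    simp only
    omega
  · rintro ⟨x, c⟩ -
    rfl

/-! ### Counting the nodes of the search tree level by level -/

section Tree

variable {n k : ℕ} {F : Finset (Finset (Fin n))} {lab : Fin n → ℕ}

theorem GoodNode.of_child {r : ℕ} {x : Fin k → ℕ} {b : ℕ}
    (h : GoodNode F lab r (childNode r (fun i => x i * 2 ^ (r + 1)) b)) :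
    GoodNode F lab (r + 1) (fun i => x i * 2 ^ (r + 1)) := by
  obtain ⟨hm, W, hW, hs⟩ := h
  have hpos : 0 < 2 ^ r := by positivity
  refine ⟨fun i i' hi => ?_, W, hW, fun a ha => ?_⟩
  · have := hm hi
    simp only [childNode] at this
    have h1 : b / 2 ^ (i' : ℕ) % 2 ≤ 1 := by omega
    have h2 : x i * 2 ^ (r + 1) ≤ x i' * 2 ^ (r + 1) + 1 * 2 ^ r :=
      (Nat.le_add_right _ _).trans (this.trans (by gcongr))
    rw [pow_succ] at h2 ⊢
    -- In units of `2 ^ r` the bits can spoil the order of the parents by at most one, and the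
    -- parents' end points are even.
    have h3 : x i * 2 ≤ x i' * 2 + 1 := by
      refine Nat.le_of_mul_le_mul_right ?_ hpos
      calc x i * 2 * 2 ^ r = x i * (2 ^ r * 2) := by ring
        _ ≤ _ := h2
        _ = _ := by ring
    have h4 : x i ≤ x i' := by omega
    simp only
    gcongr
  · obtain ⟨i, h1, h2⟩ := (mem_filter.1 (hs ha)).2
    refine mem_filter.2 ⟨mem_univ _, i, (Nat.le_add_right _ _).trans h1, h2.trans_le ?_⟩
    simp only [childNode]
    have h3 : b / 2 ^ (i : ℕ) % 2 ≤ 1 := by omega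
    calc _ ≤ x i * 2 ^ (r + 1) + 1 * 2 ^ r + 2 ^ r := by gcongr
      _ = _ := by ring

open Classical in
/-- The number of good nodes with blocks of width `2 ^ r` in the search tree of height `L`. -/
def goodCount (k : ℕ) (F : Finset (Finset (Fin n))) (lab : Fin n → ℕ) (L r : ℕ) : ℕ :=
  #{x ∈ blockTuples k (L - r) | GoodNode F lab r fun i => x i * 2 ^ r}

/-- Pruning at bad nodes loses nothing, since their children are bad too; so the sum is the same at
every level. -/
theorem sum_leafCount (L r : ℕ) (hr : r ≤ L) :
    ∑ x ∈ blockTuples k (L - r), leafCount F lab r (fun i => x i * 2 ^ r) =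
      goodCount k F lab L 0 := by
  classical
  induction r with
  | zero =>
    rw [goodCount, Finset.card_filter]
    rfl
  | succ r ih =>
    rw [← ih (by omega), show L - r = L - (r + 1) + 1 by omega, ← sum_blockTuples_children]
    refine Finset.sum_congr rfl fun x _ => ?_
    rw [leafCount]
    split_ifs with hg
    · rfl
    · symm
      refine Finset.sum_eq_zero fun b _ => ?_
      have : ¬ GoodNode F lab r (childNode r (fun i => x i * 2 ^ (r + 1)) b) :=
        fun h => hg h.of_child
      cases r <;> exact if_neg this

/-- Only good nodes have children, `2 ^ k` each; hence the tree, bad nodes included, is controlled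
by the good nodes of positive height. -/
theorem sum_descCount_le (L r : ℕ) (hr : r ≤ L) :
    ∑ x ∈ blockTuples k (L - r), descCount F lab r (fun i => x i * 2 ^ r) ≤
      2 ^ k * ∑ j ∈ range r, goodCount k F lab L (j + 1) := by
  classical
  induction r with
  | zero => simp [descCount]
  | succ r ih =>
    rw [Finset.sum_range_succ, mul_add, add_comm (2 ^ k * _)]
    refine le_trans ?_ (add_le_add_right (ih (by omega)) _)
    rw [show L - r = L - (r + 1) + 1 by omega,
      ← sum_blockTuples_children k _ r fun v => descCount F lab r v, goodCount,
      Finset.card_filter, Finset.mul_sum, ← Finset.sum_add_distrib]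
    refine Finset.sum_le_sum fun x _ => ?_
    rw [descCount]
    split_ifs with hg
    · rw [Finset.sum_add_distrib]
      simp
    · exact Nat.zero_le _

theorem blockTuples_zero (k : ℕ) : blockTuples k 0 = {fun _ => 0} := by
  ext x
  simp [mem_blockTuples, funext_iff]

theorem leafCount_root (L : ℕ) :
    leafCount F lab L (fun _ : Fin k => 0) = goodCount k F lab L 0 := by
  have := sum_leafCount (k := k) (F := F) (lab := lab) L L le_rfl
  simpa [blockTuples_zero] using this

theorem descCount_root_le (L : ℕ) :
    descCount F lab L (fun _ : Fin k => 0) ≤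
      2 ^ k * ∑ j ∈ range L, goodCount k F lab L (j + 1) := by
  have := sum_descCount_le (k := k) (F := F) (lab := lab) L L le_rfl
  simpa [blockTuples_zero] using this

/-- If the labels are distinct, the good leaves correspond to the members of `F`. -/
theorem goodCount_zero (hF : ∀ W ∈ F, #W = k) (hinj : Function.Injective lab) {L : ℕ}
    (hlab : ∀ a, lab a < 2 ^ L) : goodCount k F lab L 0 = #F := by
  classical
  have hcard : ∀ W ∈ F, #(W.image lab) = k := fun W hW => by
    rw [Finset.card_image_of_injective _ hinj, hF W hW]
  -- At width one the tuple covers at most `k` labels, and the `k` distinct labels of the witness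
  -- use them all; so the tuple is their increasing enumeration.
  have key : ∀ v : Fin k → ℕ, Monotone v → ∀ W ∈ F, W ⊆ blockSet lab 0 v →
      Finset.univ.image v = W.image lab ∧ StrictMono v := by
    intro v hv W hW hs
    have h1 : W.image lab ⊆ Finset.univ.image v := by
      intro t ht
      obtain ⟨a, ha, rfl⟩ := Finset.mem_image.1 ht
      have := hs ha
      simp only [blockSet, mem_filter, mem_univ, true_and, pow_zero] at this
      obtain ⟨i, h1, h2⟩ := this
      exact Finset.mem_image.2 ⟨i, mem_univ _, by omega⟩
    have h2 : #(Finset.univ.image v) ≤ k := by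
      simpa using Finset.card_image_le (s := Finset.univ) (f := v)
    have h3 := Finset.eq_of_subset_of_card_le h1 (by rw [hcard W hW]; exact h2)
    refine ⟨h3.symm, hv.strictMono_of_injective ?_⟩
    have h4 : #(Finset.univ.image v) = #(Finset.univ : Finset (Fin k)) := by
      rw [← h3, hcard W hW, Finset.card_fin]
    exact fun a b hab => Finset.card_image_iff.1 h4 (mem_coe.2 (mem_univ a))
      (mem_coe.2 (mem_univ b)) hab
  unfold goodCount
  simp only [pow_zero, mul_one, Nat.sub_zero]
  symm
  refine Finset.card_bij (fun W hW => (W.image lab).orderEmbOfFin (hcard W hW)) ?_ ?_ ?_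
  · intro W hW
    refine mem_filter.2 ⟨mem_blockTuples.2 fun i => ?_, OrderEmbedding.monotone _, W, hW, ?_⟩
    · have := Finset.orderEmbOfFin_mem (W.image lab) (hcard W hW) i
      obtain ⟨a, -, ha⟩ := Finset.mem_image.1 this
      rw [← ha]
      exact hlab a
    · intro a ha
      have : lab a ∈ Set.range ((W.image lab).orderEmbOfFin (hcard W hW)) := by
        rw [Finset.range_orderEmbOfFin]
        exact mem_coe.2 (Finset.mem_image_of_mem _ ha)
      obtain ⟨i, hi⟩ := this
      simp only [blockSet, mem_filter, mem_univ, true_and, pow_zero]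
      exact ⟨i, hi.le, by omega⟩
  · intro W hW W' hW' h
    have h1 : ((W.image lab : Finset ℕ) : Set ℕ) = (W'.image lab : Finset ℕ) := by
      rw [← Finset.range_orderEmbOfFin _ (hcard W hW), ← Finset.range_orderEmbOfFin _ (hcard W' hW')]
      exact congrArg Set.range h
    exact Finset.image_injective hinj (Finset.coe_injective h1)
  · intro v hv
    obtain ⟨-, hm, W, hW, hs⟩ := mem_filter.1 hv
    obtain ⟨h1, h2⟩ := key v hm W hW hs
    refine ⟨W, hW, ?_⟩
    symm
    refine Finset.orderEmbOfFin_unique (hcard W hW) (fun i => ?_) h2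
    rw [← h1]
    exact Finset.mem_image_of_mem _ (mem_univ i)

end Tree

/-! ### Random labels -/

/-- Adding `i` to the `i`-th entry makes a sorted tuple strictly increasing, that is, a `k`-subset
of `range (B + k)`. -/
theorem card_monotone_le (k B : ℕ) [DecidablePred fun x : Fin k → ℕ => Monotone x] :
    #{x ∈ Fintype.piFinset fun _ : Fin k => range B | Monotone x} ≤ (B + k).choose k := by
  classical
  rw [← Finset.card_range (B + k), ← Finset.card_powersetCard]
  have hstrict : ∀ x : Fin k → ℕ, Monotone x → StrictMono fun i : Fin k => x i + i :=
    fun x hx i j hij => add_lt_add_of_le_of_lt (hx hij.le) hij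
  refine Finset.card_le_card_of_injOn (fun x => Finset.univ.image fun i : Fin k => x i + i) ?_ ?_
  · intro x hx
    obtain ⟨h1, h2⟩ := mem_filter.1 (mem_coe.1 hx)
    refine mem_coe.2 (mem_powersetCard.2 ⟨fun t ht => ?_, ?_⟩)
    · obtain ⟨i, -, rfl⟩ := Finset.mem_image.1 ht
      have := mem_range.1 (Fintype.mem_piFinset.1 h1 i)
      have := i.isLt
      exact mem_range.2 (by omega)
    · rw [Finset.card_image_of_injective _ (hstrict x h2).injective, Finset.card_fin]
  · intro x hx y hy hxy
    have hx' := hstrict x (mem_filter.1 (mem_coe.1 hx)).2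
    have hy' := hstrict y (mem_filter.1 (mem_coe.1 hy)).2
    have : (fun i : Fin k => x i + i) = fun i : Fin k => y i + i := by
      refine (StrictMono.range_inj hx' hy').1 ?_
      have := congrArg (fun s : Finset ℕ => (s : Set ℕ)) hxy
      simpa using this
    funext i
    have : x i + i = y i + i := congrFun this i
    omega

/-- One term of the exponential series gives `k ^ k / k! ≤ e ^ k`. -/
theorem pow_self_le (k : ℕ) : k ^ k ≤ 4 ^ k * k.factorial := by
  have h := Real.pow_div_factorial_le_exp (k : ℝ) (Nat.cast_nonneg k) k
  rw [div_le_iff₀ (by positivity), ← mul_one (k : ℝ), Real.exp_nat_mul, mul_one] at h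
  have h2 : Real.exp 1 ≤ 4 := by linarith [Real.exp_one_lt_d9]
  have h3 : (k : ℝ) ^ k ≤ 4 ^ k * k.factorial := h.trans (by gcongr)
  exact_mod_cast h3

/-- The balance behind the whole bound. For `k ≤ B` the factor `1 / k!` gained by sorting cancels
the `k ^ k` ways of distributing a witness over the blocks; for `B ≤ k` there are at most `4 ^ k`
sorted tuples anyway. -/
theorem choose_mul_min_pow_le (k B : ℕ) :
    (B + k).choose k * min k B ^ k ≤ 8 ^ k * B ^ k := by
  rcases le_total k B with h | h
  · rw [min_eq_left h]
    have h1 : (B + k).choose k * k.factorial ≤ (B + k) ^ k := by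
      rw [mul_comm, ← Nat.descFactorial_eq_factorial_mul_choose]
      exact Nat.descFactorial_le_pow _ _
    calc (B + k).choose k * k ^ k ≤ (B + k).choose k * (4 ^ k * k.factorial) := by
          gcongr
          exact pow_self_le k
      _ = 4 ^ k * ((B + k).choose k * k.factorial) := by ring
      _ ≤ 4 ^ k * (B + k) ^ k := by gcongr
      _ ≤ 4 ^ k * (2 * B) ^ k := by
          gcongr
          omega
      _ = 8 ^ k * B ^ k := by rw [mul_pow, ← mul_assoc, ← mul_pow]; norm_num
  · rw [min_eq_right h]
    gcongr
    calc (B + k).choose k ≤ 2 ^ (B + k) := Nat.choose_le_two_pow _ _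
      _ ≤ 2 ^ (2 * k) := by
        gcongr
        · norm_num
        · omega
      _ = 4 ^ k := by rw [pow_mul]; norm_num
      _ ≤ 8 ^ k := by gcongr; norm_num

section Random

variable {n k L : ℕ}

/-- The number of labellings for which a given set is contained in the blocks of a given node. -/
theorem card_labellings_subset_le {r : ℕ} (hr : r ≤ L) (x : Fin k → ℕ) {W : Finset (Fin n)}
    (hW : #W = k) :
    #{lab : Fin n → Fin (2 ^ L) | W ⊆ blockSet (fun a => lab a) r fun i => x i * 2 ^ r} *
      (2 ^ (L - r)) ^ k ≤ min k (2 ^ (L - r)) ^ k * (2 ^ L) ^ n := by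
  classical
  -- `S` is the set of covered labels. The labels on `W` must lie in `S`, those outside `W` are
  -- free, so the count is a product.
  set S : Finset (Fin (2 ^ L)) := {t | ∃ i, x i * 2 ^ r ≤ (t : ℕ) ∧ (t : ℕ) < x i * 2 ^ r + 2 ^ r}
  have hL : 2 ^ L = 2 ^ (L - r) * 2 ^ r := by rw [← pow_add, Nat.sub_add_cancel hr]
  have hS : #S ≤ min k (2 ^ (L - r)) * 2 ^ r := by
    rw [min_mul_of_nonneg _ _ (Nat.zero_le _)]
    refine le_min ?_ ?_
    · have h1 : S.map Fin.valEmbedding ⊆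
          Finset.univ.biUnion fun i : Fin k => Finset.Ico (x i * 2 ^ r) (x i * 2 ^ r + 2 ^ r) := by
        intro t ht
        obtain ⟨u, hu, rfl⟩ := Finset.mem_map.1 ht
        obtain ⟨i, h1, h2⟩ := (mem_filter.1 hu).2
        exact mem_biUnion.2 ⟨i, mem_univ _, mem_Ico.2 ⟨h1, h2⟩⟩
      have h2 := Finset.card_le_card h1
      rw [Finset.card_map] at h2
      refine h2.trans (Finset.card_biUnion_le.trans ?_)
      simp
    · rw [← hL]
      simpa using Finset.card_le_univ S
  have h1 : ({lab : Fin n → Fin (2 ^ L) |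
      W ⊆ blockSet (fun a => lab a) r fun i => x i * 2 ^ r} : Finset _) ⊆
      Fintype.piFinset fun a => if a ∈ W then S else Finset.univ := by
    intro lab hlab
    have := (mem_filter.1 hlab).2
    refine Fintype.mem_piFinset.2 fun a => ?_
    split_ifs with ha
    · have := this ha
      simpa [blockSet, S] using this
    · exact mem_univ _
  have h2 : #(Fintype.piFinset fun a => if a ∈ W then S else Finset.univ) =
      #S ^ k * (2 ^ L) ^ (n - k) := by
    rw [Fintype.card_piFinset]
    simp only [apply_ite Finset.card, Finset.card_univ, Fintype.card_fin]
    rw [Finset.prod_ite, Finset.prod_const, Finset.prod_const]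
    congr 2
    · simpa using hW
    · have : ({a ∈ (Finset.univ : Finset (Fin n)) | a ∉ W} : Finset _) = Wᶜ := by
        ext; simp
      rw [this, Finset.card_compl, hW, Fintype.card_fin]
  have hkn : k ≤ n := by
    rw [← hW]
    simpa using Finset.card_le_univ W
  calc _ ≤ (min k (2 ^ (L - r)) * 2 ^ r) ^ k * (2 ^ L) ^ (n - k) * (2 ^ (L - r)) ^ k := by
        gcongr
        refine (Finset.card_le_card h1).trans (h2.le.trans ?_)
        gcongr
    _ = min k (2 ^ (L - r)) ^ k * ((2 ^ (L - r) * 2 ^ r) ^ k * (2 ^ L) ^ (n - k)) := by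
        rw [mul_pow, mul_pow]
        ring
    _ = _ := by rw [← hL, ← pow_add, Nat.add_sub_cancel' hkn]

/-- A union bound over pairs of a witness and a sorted tuple; the sum over the labellings is an
unnormalised expectation. -/
theorem sum_goodCount_le {F : Finset (Finset (Fin n))} (hF : ∀ W ∈ F, #W = k) {r : ℕ}
    (hr : r ≤ L) :
    ∑ lab : Fin n → Fin (2 ^ L), goodCount k F (fun a => lab a) L r ≤
      8 ^ k * #F * (2 ^ L) ^ n := by
  classical
  set B := 2 ^ (L - r)
  have hB : 0 < B ^ k := by positivity
  have h1 : ∀ lab : Fin n → Fin (2 ^ L), goodCount k F (fun a => lab a) L r ≤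
      ∑ W ∈ F, ∑ x ∈ blockTuples k (L - r) with Monotone x,
        if W ⊆ blockSet (fun a => lab a) r (fun i => x i * 2 ^ r) then 1 else 0 := by
    intro lab
    rw [goodCount, Finset.sum_comm, Finset.card_eq_sum_ones]
    refine (Finset.sum_le_sum_of_subset (t := {x ∈ blockTuples k (L - r) | Monotone x ∧
      ∃ W ∈ F, W ⊆ blockSet (fun a => (lab a : ℕ)) r fun i => x i * 2 ^ r}) ?_).trans ?_
    · intro x hx
      obtain ⟨hx, hm, hW⟩ := mem_filter.1 hx
      refine mem_filter.2 ⟨hx, fun i j hij => ?_, hW⟩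
      exact Nat.le_of_mul_le_mul_right (hm hij) (by positivity)
    · rw [← Finset.filter_filter, Finset.sum_filter]
      refine Finset.sum_le_sum fun x _ => ?_
      split_ifs with h
      · obtain ⟨W, hW, hs⟩ := h
        refine le_trans ?_ (Finset.single_le_sum (fun _ _ => Nat.zero_le _) hW)
        rw [if_pos hs]
      · exact Nat.zero_le _
  refine Nat.le_of_mul_le_mul_right ?_ hB
  calc _ ≤ (∑ lab : Fin n → Fin (2 ^ L), ∑ W ∈ F, ∑ x ∈ blockTuples k (L - r) with Monotone x,
        if W ⊆ blockSet (fun a => (lab a : ℕ)) r (fun i => x i * 2 ^ r) then 1 else 0) * B ^ k := by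
        gcongr with lab
        exact h1 lab
    _ = ∑ W ∈ F, ∑ x ∈ blockTuples k (L - r) with Monotone x,
        #{lab : Fin n → Fin (2 ^ L) | W ⊆ blockSet (fun a => lab a) r fun i => x i * 2 ^ r} *
          B ^ k := by
        rw [Finset.sum_comm, Finset.sum_mul]
        refine Finset.sum_congr rfl fun W _ => ?_
        rw [Finset.sum_comm, Finset.sum_mul]
        refine Finset.sum_congr rfl fun x _ => ?_
        rw [Finset.card_filter]
    _ ≤ ∑ W ∈ F, ∑ x ∈ blockTuples k (L - r) with Monotone x,
        min k B ^ k * (2 ^ L) ^ n := by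
        refine Finset.sum_le_sum fun W hW => Finset.sum_le_sum fun x _ => ?_
        exact card_labellings_subset_le hr x (hF W hW)
    _ = #F * (#{x ∈ blockTuples k (L - r) | Monotone x} * min k B ^ k * (2 ^ L) ^ n) := by
        simp [mul_assoc]
    _ ≤ #F * ((B + k).choose k * min k B ^ k * (2 ^ L) ^ n) := by
        gcongr
        exact card_monotone_le k B
    _ ≤ #F * (8 ^ k * B ^ k * (2 ^ L) ^ n) := by
        gcongr #F * (?_ * _)
        exact choose_mul_min_pow_le k B
    _ = _ := by ring

theorem sum_descCount_root_le {F : Finset (Finset (Fin n))} (hF : ∀ W ∈ F, #W = k) :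
    ∑ lab : Fin n → Fin (2 ^ L), descCount F (fun a => lab a) L (fun _ : Fin k => 0) ≤
      16 ^ k * L * #F * (2 ^ L) ^ n := by
  calc _ ≤ ∑ lab : Fin n → Fin (2 ^ L),
        2 ^ k * ∑ j ∈ range L, goodCount k F (fun a => lab a) L (j + 1) :=
        Finset.sum_le_sum fun lab _ => descCount_root_le L
    _ = 2 ^ k * ∑ j ∈ range L, ∑ lab : Fin n → Fin (2 ^ L),
        goodCount k F (fun a => lab a) L (j + 1) := by rw [← Finset.mul_sum, Finset.sum_comm]
    _ ≤ 2 ^ k * ∑ j ∈ range L, 8 ^ k * #F * (2 ^ L) ^ n := by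
        gcongr with j hj
        exact sum_goodCount_le hF (by have := mem_range.1 hj; omega)
    _ = _ := by
        rw [Finset.sum_const, card_range, smul_eq_mul, show 16 = 2 * 8 by norm_num, mul_pow]
        ring

/-- Markov's inequality for the size of the search tree. -/
theorem card_large_tree_le {F : Finset (Finset (Fin n))} (hF : ∀ W ∈ F, #W = k) {M : ℕ}
    (hM : 1 ≤ M) (hFM : #F ≤ M) (hL : 1 ≤ L) :
    8 * #{lab : Fin n → Fin (2 ^ L) |
      L * (2 ^ (4 * k + 4) * M) < 1 + descCount F (fun a => lab a) L (fun _ : Fin k => 0)} ≤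
      (2 ^ L) ^ n := by
  -- The mean tree size is at most `2 * A`, root included, and the capacity is `16 * A`; Markov's
  -- inequality gives 1/8.
  have hcap : L * (2 ^ (4 * k + 4) * M) = 16 * (16 ^ k * L * M) := by
    rw [pow_add, pow_mul]
    norm_num
    ring
  set A := 16 ^ k * L * M with hA
  have hA1 : 1 ≤ A := by
    rw [hA]
    exact Nat.one_le_iff_ne_zero.2 (by positivity)
  rw [hcap]
  have h1 : #{lab : Fin n → Fin (2 ^ L) |
      16 * A < 1 + descCount F (fun a => lab a) L (fun _ : Fin k => 0)} * (16 * A) ≤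
      ∑ lab : Fin n → Fin (2 ^ L), (1 + descCount F (fun a => lab a) L (fun _ : Fin k => 0)) := by
    rw [← smul_eq_mul]
    refine (Finset.card_nsmul_le_sum _ _ _ fun lab h => (mem_filter.1 h).2.le).trans ?_
    exact Finset.sum_le_sum_of_subset (Finset.filter_subset _ _)
  have h2 : ∑ lab : Fin n → Fin (2 ^ L),
      (1 + descCount F (fun a => lab a) L (fun _ : Fin k => 0)) ≤ 2 * A * (2 ^ L) ^ n := by
    rw [Finset.sum_add_distrib]
    calc _ ≤ (2 ^ L) ^ n + 16 ^ k * L * #F * (2 ^ L) ^ n := by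
          gcongr
          · simp
          · exact sum_descCount_root_le hF
      _ ≤ A * (2 ^ L) ^ n + A * (2 ^ L) ^ n := by
          refine add_le_add (Nat.le_mul_of_pos_left _ hA1) ?_
          rw [hA]
          gcongr
      _ = _ := by ring
  have h3 := h1.trans h2
  refine Nat.le_of_mul_le_mul_right ?_ (show 0 < 2 * A by omega)
  calc _ = #{lab : Fin n → Fin (2 ^ L) |
      16 * A < 1 + descCount F (fun a => lab a) L (fun _ : Fin k => 0)} * (16 * A) := by ring
    _ ≤ _ := h3
    _ = _ := by ring

/-- Random labels are rarely equal. -/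
theorem card_not_injective_le (h : 16 * n ^ 2 ≤ 2 ^ L)
    [DecidablePred fun lab : Fin n → Fin (2 ^ L) => ¬ Function.Injective lab] :
    16 * #{lab : Fin n → Fin (2 ^ L) | ¬ Function.Injective lab} ≤ (2 ^ L) ^ n := by
  classical
  have h1 : ∀ p : Fin n × Fin n, p.1 ≠ p.2 →
      #{lab : Fin n → Fin (2 ^ L) | lab p.1 = lab p.2} * 2 ^ L ≤ (2 ^ L) ^ n := by
    rintro ⟨a, b⟩ hab
    have : #(({lab : Fin n → Fin (2 ^ L) | lab a = lab b} : Finset _) ×ˢ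
        (Finset.univ : Finset (Fin (2 ^ L)))) ≤
        #(Finset.univ : Finset (Fin n → Fin (2 ^ L))) := by
      -- If `a` and `b` share a label, that of `a` can be overwritten by an arbitrary value without
      -- loss: it is recovered from `b`.
      refine Finset.card_le_card_of_injOn (fun q => Function.update q.1 a q.2)
        (fun _ _ => mem_coe.2 (mem_univ _)) ?_
      rintro ⟨f, t⟩ hf ⟨g, u⟩ hg hfg
      simp only [coe_product, Set.mem_prod, mem_coe, mem_filter, mem_univ, true_and,
        and_true] at hf hg
      have h0 := congrFun hfg
      have ht : t = u := by simpa using h0 a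
      have hne : ∀ c, c ≠ a → f c = g c := fun c hc => by simpa [hc] using h0 c
      refine Prod.ext (funext fun c => ?_) ht
      by_cases hc : c = a
      · subst hc
        simp only
        rw [hf, hg]
        exact hne b (Ne.symm hab)
      · exact hne c hc
    rw [Finset.card_product] at this
    simpa using this
  have h2 : ({lab : Fin n → Fin (2 ^ L) | ¬ Function.Injective lab} : Finset _) ⊆
      ({p : Fin n × Fin n | p.1 ≠ p.2} : Finset _).biUnion
        fun p => {lab : Fin n → Fin (2 ^ L) | lab p.1 = lab p.2} := by
    intro lab hlab
    have := (mem_filter.1 hlab).2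
    simp only [Function.Injective, not_forall] at this
    obtain ⟨a, b, h1, h2⟩ := this
    exact mem_biUnion.2 ⟨(a, b), by simpa using h2, by simpa using h1⟩
  have h3 : #{lab : Fin n → Fin (2 ^ L) | ¬ Function.Injective lab} * 2 ^ L ≤
      n ^ 2 * (2 ^ L) ^ n := by
    calc _ ≤ (∑ p ∈ ({p : Fin n × Fin n | p.1 ≠ p.2} : Finset _),
          #{lab : Fin n → Fin (2 ^ L) | lab p.1 = lab p.2}) * 2 ^ L := by
          gcongr
          exact (Finset.card_le_card h2).trans Finset.card_biUnion_le
      _ ≤ ∑ p ∈ ({p : Fin n × Fin n | p.1 ≠ p.2} : Finset _), (2 ^ L) ^ n := by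
          rw [Finset.sum_mul]
          exact Finset.sum_le_sum fun p hp => h1 p (mem_filter.1 hp).2
      _ ≤ _ := by
          rw [Finset.sum_const, smul_eq_mul]
          gcongr
          refine (Finset.card_le_univ _).trans_eq ?_
          simp [sq]
  refine Nat.le_of_mul_le_mul_right ?_ (show 0 < 2 ^ L by positivity)
  calc _ = 16 * (#{lab : Fin n → Fin (2 ^ L) | ¬ Function.Injective lab} * 2 ^ L) := by ring
    _ ≤ 16 * (n ^ 2 * (2 ^ L) ^ n) := by gcongr
    _ = (16 * n ^ 2) * (2 ^ L) ^ n := by ring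
    _ ≤ 2 ^ L * (2 ^ L) ^ n := by gcongr
    _ = _ := by ring

end Random

/-! ### The program

Use of the variables: `0`, `1` output; `2` number `L` of bits of a label; `3` the product `k * L`;
`4` largest exponent; `5` number of oracle calls per query; `6` capped threshold; `7` capacity of
the queue; `8` number of trials; `9`–`12` loop counters; `13` auxiliary; `15` result of a trial;
`16`, `17` vote over the trials; `18` length of the queue; `19`, `20` positions for reading and
writing; `21` number of leaves found; `22` is the current node sorted; `23` its block width; `24`,
`25` vote over the oracle's answers; `26` the oracle's answer; `27` block width of the children;
`28` bits of the child; `29` logarithm of the block width; `30` unused.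
Use of the arrays: `0` the queried set; `1` labels; `2` powers of two; `3` the tuples in the queue;
`4` the logarithms of their block widths; `5` the current tuple. -/

namespace Cmd

/-- A command without effect. -/
def skip : Cmd := .assign 30 (.lit 0)

/-- Load the current node and test whether it is sorted. -/
def loadNode : Cmd :=
  .seq (.assign 29 (.arr 4 (.var 10))) (.seq (.assign 23 (.arr 2 (.var 29)))
    (.seq (.assign 22 (.lit 1)) (.forTo 11 .par
      (.seq (.write 5 (.var 11) (.arr 3 (.add (.var 19) (.var 11))))
        (.ite (.lt (.arr 5 (.var 11)) (.arr 5 (.sub (.var 11) (.lit 1)))) (.assign 22 (.lit 0))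
          skip)))))

/-- Compute the union of the blocks of the current node. -/
def buildSet : Cmd :=
  .forTo 11 .size (.seq (.write 0 (.var 11) (.lit 0)) (.forTo 12 .par
    (.ite (.lt (.lt (.arr 1 (.var 11)) (.arr 5 (.var 12)))
        (.lt (.arr 1 (.var 11)) (.add (.arr 5 (.var 12)) (.var 23))))
      (.write 0 (.var 11) (.lit 1)) skip)))

/-- Write the tuple of a child of the current node to the queue. -/
def writeTuple : Cmd :=
  .forTo 12 .par (.ite (.lt (.var 28) (.arr 2 (.sub (.sub .par (.lit 1)) (.var 12))))
    (.write 3 (.add (.var 20) (.sub (.sub .par (.lit 1)) (.var 12)))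
      (.arr 5 (.sub (.sub .par (.lit 1)) (.var 12))))
    (.seq (.write 3 (.add (.var 20) (.sub (.sub .par (.lit 1)) (.var 12)))
        (.add (.arr 5 (.sub (.sub .par (.lit 1)) (.var 12))) (.var 27)))
      (.assign 28 (.sub (.var 28) (.arr 2 (.sub (.sub .par (.lit 1)) (.var 12)))))))

/-- Append a child of the current node to the queue. -/
def appendChild : Cmd :=
  .seq (.assign 28 (.var 11)) (.seq writeTuple (.seq (.write 4 (.var 18) (.sub (.var 29) (.lit 1)))
    (.seq (.assign 18 (.add (.var 18) (.lit 1))) (.assign 20 (.add (.var 20) .par)))))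

/-- Append all children of the current node to the queue. -/
def expand : Cmd := .forTo 11 (.arr 2 .par) appendChild

end Cmd

/-! ### Specifications of the procedures for a single node -/

section Specs

variable {n : ℕ} {inp : Input n}

theorem Expr.eval_lt_ne_zero {s : Store} {e f : Expr} :
    (Expr.lt e f).eval inp s ≠ 0 ↔ e.eval inp s < f.eval inp s := by
  simp only [Expr.eval]
  split_ifs <;> simp_all

theorem Det.skip (s : Store) : Det inp .skip s 1 (s.setVar 30 0) := Det.assign 30 (.lit 0)

theorem exists_det_loadNode (s : Store) :
    ∃ t, Det inp .loadNode s (inp.k * 7 + 9) t ∧ t.var 29 = s.arr 4 (s.var 10) ∧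
      t.var 23 = s.arr 2 (s.arr 4 (s.var 10)) ∧
      (∀ i < inp.k, t.arr 5 i = s.arr 3 (s.var 19 + i)) ∧
      (t.var 22 ≠ 0 ↔ ∀ i < inp.k, s.arr 3 (s.var 19 + (i - 1)) ≤ s.arr 3 (s.var 19 + i)) := by
  set s1 := s.setVar 29 (s.arr 4 (s.var 10))
  set s2 := s1.setVar 23 (s1.arr 2 (s1.var 29))
  set s3 := s2.setVar 22 1
  obtain ⟨t, ht, h1, h2⟩ := Det.forTo (inp := inp) (x := 11) (e := .par) (s := s3) (N := inp.k)
    (c := .seq (.write 5 (.var 11) (.arr 3 (.add (.var 19) (.var 11))))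
        (.ite (.lt (.arr 5 (.var 11)) (.arr 5 (.sub (.var 11) (.lit 1)))) (.assign 22 (.lit 0))
          .skip)) (T := 4)
    (fun i t => (∀ j < i, t.arr 5 j = s.arr 3 (s.var 19 + j)) ∧
      (t.var 22 ≠ 0 ↔ ∀ j < i, s.arr 3 (s.var 19 + (j - 1)) ≤ s.arr 3 (s.var 19 + j)))
    (fun _ _ => rfl) rfl (by simp [s3, Store.var_setVar]) (by
      intro i hi t ht hti ⟨h1, h2⟩
      have h19 : t.var 19 = s.var 19 := ht.var 19 rfl
      have h3 : t.arr 3 = s.arr 3 := ht.arr 3 rfl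
      set t1 := t.setArr 5 i (s.arr 3 (s.var 19 + i))
      have hd : Det inp (.write 5 (.var 11) (.arr 3 (.add (.var 19) (.var 11)))) t 1 t1 := by
        simpa [Expr.eval, hti, h19, h3, t1] using Det.write (inp := inp) (s := t) 5 (.var 11)
          (.arr 3 (.add (.var 19) (.var 11)))
      have hv : ∀ j ≤ i, t1.arr 5 j = s.arr 3 (s.var 19 + j) := by
        intro j hj
        by_cases hji : j = i
        · simp [t1, Store.arr_setArr, hji]
        · simpa [t1, Store.arr_setArr, hji] using h1 j (by omega)
      -- For `i = 0` truncated subtraction compares the entry with itself, so the first test always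
      -- succeeds.
      have hc : (Expr.lt (.arr 5 (.var 11)) (.arr 5 (.sub (.var 11) (.lit 1)))).eval inp t1 ≠ 0 ↔
          ¬ s.arr 3 (s.var 19 + (i - 1)) ≤ s.arr 3 (s.var 19 + i) := by
        have : t1.var 11 = i := hti
        simp [Expr.eval, this, hv i le_rfl, hv (i - 1) (by omega)]
      by_cases hle : s.arr 3 (s.var 19 + (i - 1)) ≤ s.arr 3 (s.var 19 + i)
      · refine ⟨t1.setVar 30 0, hd.seq (Det.ite (T := 1) _ ?_) |>.mono (by omega), ?_, ?_⟩
        · rw [if_neg (by rw [hc]; exact not_not.2 hle)]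
          exact Det.skip t1
        · exact fun j hj => hv j (by omega)
        · have : ((t1.setVar 30 0).setVar 11 (i + 1)).var 22 = t.var 22 := rfl
          rw [this, h2]
          refine ⟨fun h j hj => ?_, fun h j hj => h j (by omega)⟩
          obtain hj | rfl : j < i ∨ j = i := by omega
          exacts [h j hj, hle]
      · refine ⟨t1.setVar 22 0, hd.seq (Det.ite (T := 1) _ ?_) |>.mono (by omega), ?_, ?_⟩
        · rw [if_pos (by rw [hc]; exact hle)]
          exact Det.assign 22 (.lit 0)
        · exact fun j hj => hv j (by omega)
        · have : ((t1.setVar 22 0).setVar 11 (i + 1)).var 22 = 0 := rfl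
          rw [this]
          exact ⟨fun h => absurd rfl h, fun h => absurd (h i (by omega)) hle⟩)
  refine ⟨t, ?_, (ht.1.var 29 rfl).trans rfl, (ht.1.var 23 rfl).trans rfl, h1, h2⟩
  refine ((Det.assign 29 (.arr 4 (.var 10))).seq ((Det.assign 23 (.arr 2 (.var 29))).seq
    ((Det.assign 22 (.lit 1)).seq ht))).mono ?_
  omega

theorem exists_det_buildSet (s : Store) :
    ∃ t, Det inp .buildSet s (n * (inp.k * 5 + 8) + 3) t ∧
      ∀ j < n, t.arr 0 j ≠ 0 ↔
        ∃ i < inp.k, s.arr 5 i ≤ s.arr 1 j ∧ s.arr 1 j < s.arr 5 i + s.var 23 := by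
  refine Det.forTo (T := inp.k * 5 + 5)
    (fun m t => ∀ j < m, t.arr 0 j ≠ 0 ↔
        ∃ i < inp.k, s.arr 5 i ≤ s.arr 1 j ∧ s.arr 1 j < s.arr 5 i + s.var 23)
    (fun _ _ => rfl) rfl (by simp) ?_
  intro m hm t ht htm hI
  set t1 := t.setArr 0 m 0
  have hd : Det inp (.write 0 (.var 11) (.lit 0)) t 1 t1 := by
    simpa [Expr.eval, htm, t1] using Det.write (inp := inp) (s := t) 0 (.var 11) (.lit 0)
  refine Exists.elim (Det.forTo (inp := inp) (x := 12) (e := .par) (s := t1) (N := inp.k)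
    (c := (.ite (.lt (.lt (.arr 1 (.var 11)) (.arr 5 (.var 12)))
        (.lt (.arr 1 (.var 11)) (.add (.arr 5 (.var 12)) (.var 23))))
      (.write 0 (.var 11) (.lit 1)) .skip)) (T := 2)
    (fun i u => (∀ j, j ≠ m → u.arr 0 j = t.arr 0 j) ∧ (u.arr 0 m ≠ 0 ↔
      ∃ i' < i, s.arr 5 i' ≤ s.arr 1 m ∧ s.arr 1 m < s.arr 5 i' + s.var 23))
    (fun _ _ => rfl) rfl ?_ ?_) ?_
  · refine ⟨fun j hj => ?_, ?_⟩
    · simp [t1, Store.arr_setVar, Store.arr_setArr, hj]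
    · simp [t1, Store.arr_setVar, Store.arr_setArr]
  · intro i hi u hu hui ⟨h1, h2⟩
    have e11 : u.var 11 = m := (hu.var 11 rfl).trans htm
    have e23 : u.var 23 = s.var 23 := (hu.var 23 rfl).trans (ht.var 23 rfl)
    have e1 : u.arr 1 = s.arr 1 := (hu.arr 1 rfl).trans (ht.arr 1 rfl)
    have e5 : u.arr 5 = s.arr 5 := (hu.arr 5 rfl).trans (ht.arr 5 rfl)
    -- The outer comparison of two truth values is `0 < 1` exactly if the first test fails and the
    -- second holds, which expresses membership in the block.
    have hc : (Expr.lt (.lt (.arr 1 (.var 11)) (.arr 5 (.var 12)))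
        (.lt (.arr 1 (.var 11)) (.add (.arr 5 (.var 12)) (.var 23)))).eval inp u ≠ 0 ↔
        s.arr 5 i ≤ s.arr 1 m ∧ s.arr 1 m < s.arr 5 i + s.var 23 := by
      simp only [Expr.eval, e11, e23, e1, e5, hui]
      split_ifs <;> simp <;> omega
    by_cases hb : s.arr 5 i ≤ s.arr 1 m ∧ s.arr 1 m < s.arr 5 i + s.var 23
    · refine ⟨u.setArr 0 m 1, Det.ite (T := 1) _ ?_, fun j hj => ?_, ?_⟩
      · rw [if_pos (hc.2 hb)]
        simpa [Expr.eval, e11] using Det.write (inp := inp) (s := u) 0 (.var 11) (.lit 1)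
      · simpa [Store.arr_setVar, Store.arr_setArr, hj] using h1 j hj
      · simp only [Store.arr_setVar, Store.arr_setArr]
        simpa using ⟨i, by omega, hb⟩
    · refine ⟨u.setVar 30 0, Det.ite (T := 1) _ ?_, h1, ?_⟩
      · rw [if_neg (by rw [hc]; exact hb)]
        exact Det.skip u
      · have : ((u.setVar 30 0).setVar 12 (i + 1)).arr 0 m = u.arr 0 m := rfl
        rw [this, h2]
        refine ⟨fun ⟨i', h, h'⟩ => ⟨i', by omega, h'⟩, fun ⟨i', h, h'⟩ => ⟨i', ?_, h'⟩⟩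
        have : i' ≠ i := by rintro rfl; exact hb h'
        omega
  · rintro u ⟨hu, h1, h2⟩
    refine ⟨u, (hd.seq hu).mono (by omega), fun j hj => ?_⟩
    obtain hj | rfl : j < m ∨ j = m := by omega
    · have : ((u.setVar 11 (m + 1)).arr 0 j) = t.arr 0 j := h1 j (by omega)
      rw [this]
      exact hI j hj
    · exact h2

/-- In the absence of division, the bits of the child's number are read from the top by comparing
with tabulated powers and subtracting. After `m` rounds the lowest `k - m` bits remain, and the last
`m` coordinates are written. -/
theorem exists_det_writeTuple (s : Store) (hp : ∀ i ≤ inp.k, s.arr 2 i = 2 ^ i)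
    (hb : s.var 28 < 2 ^ inp.k) :
    ∃ t, Det inp .writeTuple s (inp.k * 7 + 3) t ∧
      (∀ i < inp.k, t.arr 3 (s.var 20 + i) =
        s.arr 5 i + s.var 28 / 2 ^ i % 2 * s.var 27) ∧ ∀ j < s.var 20, t.arr 3 j = s.arr 3 j := by
  refine Exists.elim (Det.forTo (inp := inp) (x := 12) (e := .par) (s := s) (N := inp.k)
    (c := (.ite (.lt (.var 28) (.arr 2 (.sub (.sub .par (.lit 1)) (.var 12))))
    (.write 3 (.add (.var 20) (.sub (.sub .par (.lit 1)) (.var 12)))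
      (.arr 5 (.sub (.sub .par (.lit 1)) (.var 12))))
    (.seq (.write 3 (.add (.var 20) (.sub (.sub .par (.lit 1)) (.var 12)))
        (.add (.arr 5 (.sub (.sub .par (.lit 1)) (.var 12))) (.var 27)))
      (.assign 28 (.sub (.var 28) (.arr 2 (.sub (.sub .par (.lit 1)) (.var 12)))))))) (T := 4)
    (fun m t => t.var 28 = s.var 28 % 2 ^ (inp.k - m) ∧
      (∀ i < inp.k, inp.k ≤ i + m → t.arr 3 (s.var 20 + i) =
        s.arr 5 i + s.var 28 / 2 ^ i % 2 * s.var 27) ∧ ∀ j < s.var 20, t.arr 3 j = s.arr 3 j)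
    (fun _ _ => rfl) rfl ?_ ?_) ?_
  · refine ⟨?_, fun i h1 h2 => by omega, fun _ _ => rfl⟩
    simp [Store.var_setVar, Nat.mod_eq_of_lt hb]
  · intro m hm t ht htm ⟨h1, h2, h3⟩
    obtain ⟨q, hq⟩ : ∃ q, inp.k = q + m + 1 := ⟨inp.k - m - 1, by omega⟩
    have e20 : t.var 20 = s.var 20 := ht.var 20 rfl
    have e27 : t.var 27 = s.var 27 := ht.var 27 rfl
    have e5 : t.arr 5 = s.arr 5 := ht.arr 5 rfl
    have e2 : t.arr 2 q = 2 ^ q := by rw [ht.arr 2 rfl, hp q (by omega)]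
    have hidx : (Expr.sub (.sub .par (.lit 1)) (.var 12)).eval inp t = q := by
      simp only [Expr.eval, htm]
      omega
    have hmod : t.var 28 = s.var 28 % 2 ^ q + 2 ^ q * (s.var 28 / 2 ^ q % 2) := by
      rw [h1, show inp.k - m = q + 1 by omega, Nat.mod_pow_succ]
    have hlt : s.var 28 % 2 ^ q < 2 ^ q := Nat.mod_lt _ (by positivity)
    rw [show inp.k - (m + 1) = q by omega]
    rcases Nat.mod_two_eq_zero_or_one (s.var 28 / 2 ^ q) with hbit | hbit
    · rw [hbit, mul_zero, add_zero] at hmod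
      refine ⟨t.setArr 3 (s.var 20 + q) (s.arr 5 q), (Det.ite (T := 1) _ ?_).mono (by omega),
        hmod, ?_, ?_⟩
      · rw [if_pos]
        · have := Det.write (inp := inp) (s := t) 3
            (.add (.var 20) (.sub (.sub .par (.lit 1)) (.var 12)))
            (.arr 5 (.sub (.sub .par (.lit 1)) (.var 12)))
          simp only [Expr.eval] at this hidx
          rwa [hidx, e20, e5] at this
        · rw [Expr.eval_lt_ne_zero]
          simp only [Expr.eval] at hidx ⊢
          rwa [hidx, e2, hmod]
      · intro i hi hi'
        by_cases hiq : i = q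
        · subst hiq
          simp [Store.arr_setVar, Store.arr_setArr, hbit]
        · simpa [Store.arr_setVar, Store.arr_setArr, hiq] using h2 i hi (by omega)
      · intro j hj
        have : j ≠ s.var 20 + q := by omega
        simpa [Store.arr_setVar, Store.arr_setArr, this] using h3 j hj
    · rw [hbit, mul_one] at hmod
      refine ⟨(t.setArr 3 (s.var 20 + q) (s.arr 5 q + s.var 27)).setVar 28 (s.var 28 % 2 ^ q),
        Det.ite (T := 3) _ ?_, rfl, ?_, ?_⟩
      · rw [if_neg]
        · have h4 := Det.write (inp := inp) (s := t) 3
            (.add (.var 20) (.sub (.sub .par (.lit 1)) (.var 12)))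
            (.add (.arr 5 (.sub (.sub .par (.lit 1)) (.var 12))) (.var 27))
          simp only [Expr.eval] at h4 hidx
          rw [hidx, e20, e5, e27] at h4
          have h5 := Det.assign (inp := inp)
            (s := t.setArr 3 (s.var 20 + q) (s.arr 5 q + s.var 27)) 28
            (.sub (.var 28) (.arr 2 (.sub (.sub .par (.lit 1)) (.var 12))))
          simp only [Expr.eval, Store.var_setArr] at h5
          rw [hidx, Store.arr_setArr, if_neg (by omega), e2, hmod, Nat.add_sub_cancel] at h5
          exact h4.seq h5
        · rw [Expr.eval_lt_ne_zero]
          simp only [Expr.eval] at hidx ⊢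
          rw [hidx, e2, hmod]
          omega
      · intro i hi hi'
        by_cases hiq : i = q
        · subst hiq
          simp [Store.arr_setVar, Store.arr_setArr, hbit]
        · simpa [Store.arr_setVar, Store.arr_setArr, hiq] using h2 i hi (by omega)
      · intro j hj
        have : j ≠ s.var 20 + q := by omega
        simpa [Store.arr_setVar, Store.arr_setArr, this] using h3 j hj
  · rintro t ⟨ht, -, h1, h2⟩
    exact ⟨t, ht, fun i hi => h1 i hi (by omega), h2⟩

/-- Reading the bits destroys the number of the child, so it is done on a copy of the loop counter.
-/
theorem exists_det_appendChild (s : Store) (hp : ∀ i ≤ inp.k, s.arr 2 i = 2 ^ i)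
    (hb : s.var 11 < 2 ^ inp.k) :
    ∃ t, Det inp .appendChild s (inp.k * 7 + 11) t ∧ t.var 18 = s.var 18 + 1 ∧
      t.var 20 = s.var 20 + inp.k ∧ t.arr 4 (s.var 18) = s.var 29 - 1 ∧
      (∀ j < s.var 18, t.arr 4 j = s.arr 4 j) ∧
      (∀ i < inp.k, t.arr 3 (s.var 20 + i) =
        s.arr 5 i + s.var 11 / 2 ^ i % 2 * s.var 27) ∧ ∀ j < s.var 20, t.arr 3 j = s.arr 3 j := by
  obtain ⟨t, ht, h1, h2⟩ := exists_det_writeTuple (inp := inp) (s.setVar 28 (s.var 11)) hp hb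
  have e18 : t.var 18 = s.var 18 := ht.1.var 18 rfl
  have e20 : t.var 20 = s.var 20 := ht.1.var 20 rfl
  have e29 : t.var 29 = s.var 29 := ht.1.var 29 rfl
  have e4 : t.arr 4 = s.arr 4 := ht.1.arr 4 rfl
  refine ⟨_, ((Det.assign 28 (.var 11)).seq (ht.seq ((Det.write 4 _ _).seq
    ((Det.assign 18 _).seq (Det.assign 20 _))))).mono (by omega), ?_, ?_, ?_, ?_, ?_, ?_⟩
  · simp [Store.var_setVar, Store.var_setArr, Expr.eval, e18]
  · simp [Store.var_setVar, Store.var_setArr, Expr.eval, e20]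
  · simp [Store.arr_setVar, Store.arr_setArr, Expr.eval, e18, e29]
  · intro j hj
    simp [Store.arr_setVar, Store.arr_setArr, Expr.eval, e18, e4, hj.ne]
  · intro i hi
    simpa [Store.arr_setVar, Store.arr_setArr, Store.var_setVar] using h1 i hi
  · intro j hj
    simpa [Store.arr_setVar, Store.arr_setArr, Store.var_setVar] using h2 j hj

theorem exists_det_expand (s : Store) (hp : ∀ i ≤ inp.k, s.arr 2 i = 2 ^ i) :
    ∃ t, Det inp .expand s (2 ^ inp.k * (inp.k * 7 + 14) + 3) t ∧
      t.var 18 = s.var 18 + 2 ^ inp.k ∧ t.var 20 = s.var 20 + 2 ^ inp.k * inp.k ∧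
      (∀ b < 2 ^ inp.k, t.arr 4 (s.var 18 + b) = s.var 29 - 1) ∧
      (∀ j < s.var 18, t.arr 4 j = s.arr 4 j) ∧
      (∀ b < 2 ^ inp.k, ∀ i < inp.k, t.arr 3 (s.var 20 + b * inp.k + i) =
        s.arr 5 i + b / 2 ^ i % 2 * s.var 27) ∧ ∀ j < s.var 20, t.arr 3 j = s.arr 3 j := by
  refine Det.forTo (T := inp.k * 7 + 11) (fun m t =>
      t.var 18 = s.var 18 + m ∧ t.var 20 = s.var 20 + m * inp.k ∧
      (∀ b < m, t.arr 4 (s.var 18 + b) = s.var 29 - 1) ∧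
      (∀ j < s.var 18, t.arr 4 j = s.arr 4 j) ∧
      (∀ b < m, ∀ i < inp.k, t.arr 3 (s.var 20 + b * inp.k + i) =
        s.arr 5 i + b / 2 ^ i % 2 * s.var 27) ∧ ∀ j < s.var 20, t.arr 3 j = s.arr 3 j)
    (fun t ht => ?_) rfl ?_ ?_
  · simp only [Expr.eval]
    rw [ht.arr 2 rfl, hp _ le_rfl]
  · simp [Store.var_setVar, Store.arr_setVar]
  · intro m hm t ht htm ⟨h1, h2, h3, h4, h5, h6⟩
    have hp' : ∀ i ≤ inp.k, t.arr 2 i = 2 ^ i := by rwa [ht.arr 2 rfl]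
    obtain ⟨u, hu, g1, g2, g3, g4, g5, g6⟩ := exists_det_appendChild (inp := inp) t hp'
      (by rwa [htm])
    rw [h1] at g1 g3 g4
    rw [h2] at g2 g5 g6
    rw [htm, ht.var 27 rfl, ht.arr 5 rfl] at g5
    rw [ht.var 29 rfl] at g3
    refine ⟨u, hu, ?_, ?_, ?_, ?_, ?_, ?_⟩
    · simpa [Store.var_setVar, add_assoc] using g1
    · simp only [Store.var_setVar]
      simpa [add_mul, add_assoc] using g2
    · intro b hb
      obtain hb | rfl : b < m ∨ b = m := by omega
      · exact (g4 _ (by omega)).trans (h3 b hb)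
      · exact g3
    · intro j hj
      exact (g4 _ (by omega)).trans (h4 j hj)
    · intro b hb i hi
      obtain hb | rfl : b < m ∨ b = m := by omega
      · refine (g6 _ ?_).trans (h5 b hb i hi)
        have : (b + 1) * inp.k ≤ m * inp.k := Nat.mul_le_mul_right _ hb
        rw [add_mul, one_mul] at this
        omega
      · exact g5 i hi
    · intro j hj
      exact (g6 _ (by omega)).trans (h6 j hj)

end Specs

/-! ### The program of one trial -/

namespace Cmd

/-- Ask the oracle repeatedly about the union of the blocks of the current node. -/
def query : Cmd := .majority 11 (.var 5) (.ora 26 0) 26 24 25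

/-- Count or expand the current node if it is good. -/
def finishNode : Cmd :=
  .seq (.assign 19 (.add (.var 19) .par)) (.ite (.var 22) (.ite (.var 24) (.ite (.var 29)
    (.seq (.assign 27 (.arr 2 (.sub (.var 29) (.lit 1)))) expand)
    (.assign 21 (.add (.var 21) (.lit 1)))) skip) skip)

/-- Process the current node. -/
def processNode : Cmd := .seq loadNode (.seq buildSet (.seq query finishNode))

/-- Process the nodes in the queue, up to its capacity. -/
def search : Cmd := .forTo 10 (.var 7) (.ite (.lt (.var 10) (.var 18)) processNode skip)

/-- Draw random labels. -/
def drawLabels : Cmd :=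
  .forTo 10 .size (.seq (.rand 13 (.sub (.arr 2 (.var 2)) (.lit 1))) (.write 1 (.var 10) (.var 13)))

/-- Let the queue consist of the root. -/
def initQueue : Cmd :=
  .seq (.forTo 10 .par (.write 3 (.var 10) (.lit 0))) (.seq (.write 4 (.lit 0) (.var 2))
    (.seq (.assign 18 (.lit 1)) (.seq (.assign 19 (.lit 0)) (.seq (.assign 20 .par)
      (.assign 21 (.lit 0))))))

/-- The result of a trial: `0` stands for "more than `M`", `N + 1` for the number `N`. -/
def report : Cmd :=
  .ite (.lt (.var 7) (.var 18)) (.assign 15 (.lit 0))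
    (.ite (.lt (.num 0) (.var 21)) (.assign 15 (.lit 0)) (.assign 15 (.add (.var 21) (.lit 1))))

/-- Count the witnesses with random labels. -/
def trial : Cmd := .seq drawLabels (.seq initQueue (.seq search report))

end Cmd

/-- The tuple of the node with number `e` in the queue. -/
def tupleAt (s : Store) (k e : ℕ) : Fin k → ℕ := fun i => s.arr 3 (e * k + i)

/-- The first `p` nodes in the queue have been processed correctly. -/
structure QueueInv {n : ℕ} (F : Finset (Finset (Fin n))) (lab : Fin n → ℕ) (k L p : ℕ) (s : Store) :
    Prop where
  le : p ≤ s.var 18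
  read : s.var 19 = p * k
  write : s.var 20 = s.var 18 * k
  height : ∀ e < s.var 18, s.arr 4 e ≤ L
  leaves : s.var 21 + ∑ e ∈ Ico p (s.var 18), leafCount F lab (s.arr 4 e) (tupleAt s k e) =
    leafCount F lab L fun _ : Fin k => 0
  size : p + ∑ e ∈ Ico p (s.var 18), (1 + descCount F lab (s.arr 4 e) (tupleAt s k e)) =
    1 + descCount F lab L fun _ : Fin k => 0

/-! ### Preservation of the queue invariant -/

section Queue

variable {n : ℕ} {F : Finset (Finset (Fin n))} {lab : Fin n → ℕ} {k L p : ℕ} {s t : Store}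

theorem QueueInv.congr (h : QueueInv F lab k L p s) (h18 : t.var 18 = s.var 18)
    (h19 : t.var 19 = s.var 19) (h20 : t.var 20 = s.var 20) (h21 : t.var 21 = s.var 21)
    (h3 : t.arr 3 = s.arr 3) (h4 : t.arr 4 = s.arr 4) : QueueInv F lab k L p t := by
  have ht : tupleAt t k = tupleAt s k := by
    unfold tupleAt
    rw [h3]
  constructor
  · rw [h18]; exact h.le
  · rw [h19]; exact h.read
  · rw [h18, h20]; exact h.write
  · rw [h18, h4]; exact h.height
  · rw [h18, h21, h4, ht]; exact h.leaves
  · rw [h18, h4, ht]; exact h.size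

theorem QueueInv.skip_bad (h : QueueInv F lab k L p s) (hp : p < s.var 18)
    (hbad : ¬ GoodNode F lab (s.arr 4 p) (tupleAt s k p)) (h18 : t.var 18 = s.var 18)
    (h19 : t.var 19 = s.var 19 + k) (h20 : t.var 20 = s.var 20) (h21 : t.var 21 = s.var 21)
    (h3 : t.arr 3 = s.arr 3) (h4 : t.arr 4 = s.arr 4) : QueueInv F lab k L (p + 1) t := by
  have ht : tupleAt t k = tupleAt s k := by
    unfold tupleAt
    rw [h3]
  have hl := h.leaves
  have hs := h.size
  rw [Finset.sum_eq_sum_Ico_succ_bot hp] at hl hs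
  have h0 : leafCount F lab (s.arr 4 p) (tupleAt s k p) = 0 := by
    cases hr : s.arr 4 p <;> rw [hr] at hbad <;> exact if_neg hbad
  have h1 : descCount F lab (s.arr 4 p) (tupleAt s k p) = 0 := by
    cases hr : s.arr 4 p <;> rw [hr] at hbad
    · rfl
    · exact if_neg hbad
  constructor
  · omega
  · rw [h19, h.read]; ring
  · rw [h18, h20]; exact h.write
  · rw [h18, h4]; exact h.height
  · rw [h18, h21, h4, ht]; omega
  · rw [h18, h4, ht]; omega

theorem QueueInv.count_leaf (h : QueueInv F lab k L p s) (hp : p < s.var 18)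
    (hgood : GoodNode F lab (s.arr 4 p) (tupleAt s k p)) (hr : s.arr 4 p = 0)
    (h18 : t.var 18 = s.var 18) (h19 : t.var 19 = s.var 19 + k) (h20 : t.var 20 = s.var 20)
    (h21 : t.var 21 = s.var 21 + 1) (h3 : t.arr 3 = s.arr 3) (h4 : t.arr 4 = s.arr 4) :
    QueueInv F lab k L (p + 1) t := by
  have ht : tupleAt t k = tupleAt s k := by
    unfold tupleAt
    rw [h3]
  have hl := h.leaves
  have hs := h.size
  rw [Finset.sum_eq_sum_Ico_succ_bot hp] at hl hs
  have h0 : leafCount F lab (s.arr 4 p) (tupleAt s k p) = 1 := by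
    rw [hr] at hgood ⊢
    exact if_pos hgood
  have h1 : descCount F lab (s.arr 4 p) (tupleAt s k p) = 0 := by
    rw [hr]
    rfl
  constructor
  · omega
  · rw [h19, h.read]; ring
  · rw [h18, h20]; exact h.write
  · rw [h18, h4]; exact h.height
  · rw [h18, h21, h4, ht]; omega
  · rw [h18, h4, ht]; omega

/-- The children take over the contribution of their parent in both conserved sums; the recursions
for `leafCount` and `descCount` are tailored to this exchange. -/
theorem QueueInv.expand (h : QueueInv F lab k L p s) (hp : p < s.var 18) {r : ℕ}
    (hr : s.arr 4 p = r + 1) (hgood : GoodNode F lab (s.arr 4 p) (tupleAt s k p))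
    (h18 : t.var 18 = s.var 18 + 2 ^ k) (h19 : t.var 19 = s.var 19 + k)
    (h20 : t.var 20 = s.var 20 + 2 ^ k * k) (h21 : t.var 21 = s.var 21)
    (h4 : ∀ b < 2 ^ k, t.arr 4 (s.var 18 + b) = r) (h4' : ∀ j < s.var 18, t.arr 4 j = s.arr 4 j)
    (h3 : ∀ b < 2 ^ k, ∀ i : Fin k, t.arr 3 (s.var 20 + b * k + i) =
      childNode r (tupleAt s k p) b i) (h3' : ∀ j < s.var 20, t.arr 3 j = s.arr 3 j) :
    QueueInv F lab k L (p + 1) t := by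
  have hpos : 0 < 2 ^ k := by positivity
  have ht : ∀ e < s.var 18, tupleAt t k e = tupleAt s k e := by
    intro e he
    refine funext fun i => h3' _ ?_
    have h1 : (e + 1) * k ≤ s.var 18 * k := Nat.mul_le_mul_right _ he
    rw [h.write]
    rw [add_mul, one_mul] at h1
    have := i.isLt
    omega
  have ht' : ∀ b < 2 ^ k, tupleAt t k (s.var 18 + b) = childNode r (tupleAt s k p) b := by
    intro b hb
    refine funext fun i => ?_
    rw [← h3 b hb i, h.write, ← add_mul]
    rfl
  have hsum : ∀ g : ℕ → (Fin k → ℕ) → ℕ,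
      ∑ e ∈ Ico (p + 1) (t.var 18), g (t.arr 4 e) (tupleAt t k e) =
      ∑ e ∈ Ico (p + 1) (s.var 18), g (s.arr 4 e) (tupleAt s k e) +
        ∑ b ∈ range (2 ^ k), g r (childNode r (tupleAt s k p) b) := by
    intro g
    rw [← Finset.sum_Ico_consecutive _ (show p + 1 ≤ s.var 18 by omega)
      (show s.var 18 ≤ t.var 18 by omega)]
    congr 1
    · refine Finset.sum_congr rfl fun e he => ?_
      have := (mem_Ico.1 he).2
      rw [h4' e this, ht e this]
    · rw [Finset.sum_Ico_eq_sum_range, h18, Nat.add_sub_cancel_left]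
      refine Finset.sum_congr rfl fun b hb => ?_
      have := mem_range.1 hb
      rw [h4 b this, ht' b this]
  have hl := h.leaves
  have hs := h.size
  rw [Finset.sum_eq_sum_Ico_succ_bot hp] at hl hs
  have hr' : r ≤ L := by
    have := h.height p hp
    omega
  rw [hr] at hgood
  have h0 : leafCount F lab (s.arr 4 p) (tupleAt s k p) =
      ∑ b ∈ range (2 ^ k), leafCount F lab r (childNode r (tupleAt s k p) b) := by
    rw [hr]
    exact if_pos hgood
  have h1 : descCount F lab (s.arr 4 p) (tupleAt s k p) =
      ∑ b ∈ range (2 ^ k), (1 + descCount F lab r (childNode r (tupleAt s k p) b)) := by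
    rw [hr]
    exact if_pos hgood
  constructor
  · omega
  · rw [h19, h.read]; ring
  · rw [h18, h20, h.write]; ring
  · intro e he
    by_cases hes : e < s.var 18
    · rw [h4' e hes]
      exact h.height e hes
    · obtain ⟨b, rfl⟩ := Nat.exists_eq_add_of_le (not_lt.1 hes)
      rw [h4 b (by omega)]
      exact hr'
  · rw [hsum fun r v => leafCount F lab r v, h21]
    omega
  · rw [hsum fun r v => 1 + descCount F lab r v]
    omega

end Queue

/-- The constants that a trial relies on. -/
structure Ready (k L m : ℕ) (s : Store) : Prop where
  levels : s.var 2 = L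
  pow : ∀ i ≤ L + k, s.arr 2 i = 2 ^ i
  calls : s.var 5 = m

theorem Ready.of_keeps {k L m : ℕ} {s t : Store} {c : Cmd} (h : Ready k L m s) (hk : Keeps c s t)
    (h2 : c.modVar 2 = false) (h5 : c.modVar 5 = false) (ha : c.modArr 2 = false) :
    Ready k L m t := by
  constructor
  · rw [hk.var 2 h2, h.levels]
  · rw [hk.arr 2 ha]
    exact h.pow
  · rw [hk.var 5 h5, h.calls]

theorem monotone_fin_iff (k : ℕ) (f : ℕ → ℕ) :
    (∀ i < k, f (i - 1) ≤ f i) ↔ Monotone fun i : Fin k => f i := by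
  constructor
  · intro h
    have key : ∀ a b, a ≤ b → b < k → f a ≤ f b := by
      intro a b hab
      induction b, hab using Nat.le_induction with
      | base => exact fun _ => le_rfl
      | succ b _ ih => exact fun hb => (ih (by omega)).trans (by simpa using h (b + 1) hb)
    exact fun i j hij => key i j hij j.isLt
  · intro h i hi
    exact h (a := ⟨i - 1, by omega⟩) (b := ⟨i, hi⟩) (by simp)

/-! ### Processing a node and running the search -/

section Node

variable {n : ℕ} {inp : Input n} {F : Finset (Finset (Fin n))} {lab : Fin n → ℕ} {L m : ℕ}

theorem exists_det_finishNode (s : Store) (hp : ∀ i ≤ inp.k, s.arr 2 i = 2 ^ i) :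
    ∃ t, Det inp .finishNode s (2 ^ inp.k * (inp.k * 7 + 14) + 10) t ∧
      t.var 19 = s.var 19 + inp.k ∧
      (¬ (s.var 22 ≠ 0 ∧ s.var 24 ≠ 0) → t.var 18 = s.var 18 ∧ t.var 20 = s.var 20 ∧
        t.var 21 = s.var 21 ∧ t.arr 3 = s.arr 3 ∧ t.arr 4 = s.arr 4) ∧
      (s.var 22 ≠ 0 ∧ s.var 24 ≠ 0 → s.var 29 = 0 → t.var 18 = s.var 18 ∧ t.var 20 = s.var 20 ∧
        t.var 21 = s.var 21 + 1 ∧ t.arr 3 = s.arr 3 ∧ t.arr 4 = s.arr 4) ∧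
      (s.var 22 ≠ 0 ∧ s.var 24 ≠ 0 → s.var 29 ≠ 0 → t.var 18 = s.var 18 + 2 ^ inp.k ∧
        t.var 20 = s.var 20 + 2 ^ inp.k * inp.k ∧ t.var 21 = s.var 21 ∧
        (∀ b < 2 ^ inp.k, t.arr 4 (s.var 18 + b) = s.var 29 - 1) ∧
        (∀ j < s.var 18, t.arr 4 j = s.arr 4 j) ∧
        (∀ b < 2 ^ inp.k, ∀ i < inp.k, t.arr 3 (s.var 20 + b * inp.k + i) =
          s.arr 5 i + b / 2 ^ i % 2 * s.arr 2 (s.var 29 - 1)) ∧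
        ∀ j < s.var 20, t.arr 3 j = s.arr 3 j) := by
  set s1 := s.setVar 19 (s.var 19 + inp.k)
  have hd : Det inp (.assign 19 (.add (.var 19) .par)) s 1 s1 := Det.assign _ _
  by_cases h22 : s.var 22 = 0
  · refine ⟨s1.setVar 30 0, (hd.seq (Det.ite (T := 1) _ ?_)).mono (by omega), rfl,
      fun _ => ⟨rfl, rfl, rfl, rfl, rfl⟩, fun h => absurd h22 h.1, fun h => absurd h22 h.1⟩
    rw [if_neg (by simpa [Expr.eval, s1, Store.var_setVar] using h22)]
    exact Det.skip _
  by_cases h24 : s.var 24 = 0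
  · refine ⟨s1.setVar 30 0, (hd.seq (Det.ite (T := 2) _ ?_)).mono (by omega), rfl,
      fun _ => ⟨rfl, rfl, rfl, rfl, rfl⟩, fun h => absurd h24 h.2, fun h => absurd h24 h.2⟩
    rw [if_pos (by simpa [Expr.eval, s1, Store.var_setVar] using h22)]
    refine Det.ite (T := 1) _ ?_
    rw [if_neg (by simpa [Expr.eval, s1, Store.var_setVar] using h24)]
    exact Det.skip _
  by_cases h29 : s.var 29 = 0
  · refine ⟨s1.setVar 21 (s.var 21 + 1), (hd.seq (Det.ite (T := 3) _ ?_)).mono (by omega), rfl,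
      fun h => absurd ⟨h22, h24⟩ h, fun _ _ => ⟨rfl, rfl, rfl, rfl, rfl⟩, fun _ h => absurd h29 h⟩
    rw [if_pos (by simpa [Expr.eval, s1, Store.var_setVar] using h22)]
    refine Det.ite (T := 2) _ ?_
    rw [if_pos (by simpa [Expr.eval, s1, Store.var_setVar] using h24)]
    refine Det.ite (T := 1) _ ?_
    rw [if_neg (by simpa [Expr.eval, s1, Store.var_setVar] using h29)]
    exact Det.assign 21 (.add (.var 21) (.lit 1))
  · obtain ⟨t, ht, g1, g2, g3, g4, g5, g6⟩ := exists_det_expand (inp := inp)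
      (s1.setVar 27 (s.arr 2 (s.var 29 - 1))) hp
    refine ⟨t, (hd.seq (Det.ite (T := 2 ^ inp.k * (inp.k * 7 + 14) + 7) _ ?_)).mono (by omega),
      ht.1.var 19 rfl, fun h => absurd ⟨h22, h24⟩ h, fun _ h => absurd h h29,
      fun _ _ => ⟨g1, g2, ht.1.var 21 rfl, g3, g4, g5, g6⟩⟩
    rw [if_pos (by simpa [Expr.eval, s1, Store.var_setVar] using h22)]
    refine Det.ite (T := 2 ^ inp.k * (inp.k * 7 + 14) + 6) _ ?_
    rw [if_pos (by simpa [Expr.eval, s1, Store.var_setVar] using h24)]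
    refine Det.ite (T := 2 ^ inp.k * (inp.k * 7 + 14) + 5) _ ?_
    rw [if_pos (by simpa [Expr.eval, s1, Store.var_setVar] using h29)]
    exact (Det.seq (Det.assign 27 (.arr 2 (.sub (.var 29) (.lit 1)))) ht).mono (by omega)

/-- A decision oracle for the family `F`, with error probability at most `p`. -/
def Decides (F : Finset (Finset (Fin n))) (p : ℝ≥0∞) (O : Finset (Fin n) → PMF Bool) : Prop :=
  ∀ X, ((∃ W ∈ F, W ⊆ X) → O X false ≤ p) ∧ (¬ (∃ W ∈ F, W ⊆ X) → O X true ≤ p)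

/-- The time for processing a node. -/
def nodeTime (n k m : ℕ) : ℕ :=
  k * 7 + 9 + (n * (k * 5 + 8) + 3 + (m * 9 + 5 + (2 ^ k * (k * 7 + 14) + 10) + 1) + 1) + 1

open Classical in
theorem Triple.query {M : Machine inp} {p α β ρ : ℝ≥0∞} (hO : Decides F p M.O) (hα : 1 ≤ α)
    (hαβ : α * β = 1) (hρ : β + (α - β) * p ≤ ρ) {s : Store} (hs : s.var 5 = m) :
    Triple M .query s (m * 9 + 5) m
      (fun u => if u.var 24 = (if ∃ W ∈ F, W ⊆ s.query n 0 then 1 else 0) then 0 else 1)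
      (ρ ^ m) := by
  have := Triple.majority (M := M) (i := 11) (e := .var 5) (c := .ora 26 0) (x := 26) (y := 24)
    (z := 25) (s := s) (N := m) (T := 1) (B := 1) (p := p)
    (w := if ∃ W ∈ F, W ⊆ s.query n 0 then 1 else 0) hα hαβ hρ (by decide) (by decide) (by decide)
    rfl rfl rfl (fun t ht => (ht.var 5 rfl).trans hs) (by
      intro t ht
      refine (Triple.ora 26 0).conseq le_rfl le_rfl (fun _ _ => le_rfl) ?_
      have hq : t.query n 0 = s.query n 0 := by
        unfold Store.query
        rw [ht.arr 0 rfl]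
      rw [hq]
      by_cases h : ∃ W ∈ F, W ⊆ s.query n 0
      · simpa [h, Store.var_setVar] using (hO _).1 h
      · simpa [h, Store.var_setVar] using (hO _).2 h)
  rw [mul_one] at this
  exact this

-- All commands besides the vote are deterministic, so a wrong vote on the union of blocks is the
-- only way to lose the invariant. The event is an implication because the triple must also hold
-- from memories in which something has already failed.
open Classical in
theorem Triple.processNode {M : Machine inp} {p α β ρ : ℝ≥0∞} (hO : Decides F p M.O) (hα : 1 ≤ α)
    (hαβ : α * β = 1) (hρ : β + (α - β) * p ≤ ρ) {s : Store} (hs : Ready inp.k L m s)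
    (hlab : ∀ a : Fin n, s.arr 1 a = lab a) :
    Triple M .processNode s (nodeTime n inp.k m) m
      (fun u => if QueueInv F lab inp.k L (s.var 10) s → s.var 10 < s.var 18 →
        QueueInv F lab inp.k L (s.var 10 + 1) u then 0 else 1) (ρ ^ m) := by
  obtain ⟨t, ht, t29, t23, t5, t22⟩ := exists_det_loadNode (inp := inp) s
  obtain ⟨u, hu, u0⟩ := exists_det_buildSet (inp := inp) t
  have hru : Ready inp.k L m u := (hs.of_keeps ht.1 rfl rfl rfl).of_keeps hu.1 rfl rfl rfl
  refine ht.triple_seq (hu.triple_seq (B := m + 0) (Triple.seq (Triple.query hO hα hαβ hρ hru.calls)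
    fun w hw => ?_))
  obtain ⟨x, hx, x19, xA, xB, xC⟩ := exists_det_finishNode (inp := inp) w
    (fun i hi => (hru.of_keeps hw rfl rfl rfl).pow i (by omega))
  refine (hx.triple M _).conseq le_rfl le_rfl (fun _ _ => le_rfl) ?_
  by_cases h24 : w.var 24 = if ∃ W ∈ F, W ⊆ u.query n 0 then 1 else 0
  swap
  · rw [if_neg h24]
    split_ifs <;> simp
  rw [if_pos h24, if_pos]
  intro hq hlt
  set P := s.var 10
  have w18 : w.var 18 = s.var 18 :=
    (hw.var 18 rfl).trans ((hu.1.var 18 rfl).trans (ht.1.var 18 rfl))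
  have w19 : w.var 19 = s.var 19 :=
    (hw.var 19 rfl).trans ((hu.1.var 19 rfl).trans (ht.1.var 19 rfl))
  have w20 : w.var 20 = s.var 20 :=
    (hw.var 20 rfl).trans ((hu.1.var 20 rfl).trans (ht.1.var 20 rfl))
  have w21 : w.var 21 = s.var 21 :=
    (hw.var 21 rfl).trans ((hu.1.var 21 rfl).trans (ht.1.var 21 rfl))
  have w22 : w.var 22 = t.var 22 := (hw.var 22 rfl).trans (hu.1.var 22 rfl)
  have w29 : w.var 29 = s.arr 4 P := (hw.var 29 rfl).trans ((hu.1.var 29 rfl).trans t29)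
  have w3 : w.arr 3 = s.arr 3 := (hw.arr 3 rfl).trans ((hu.1.arr 3 rfl).trans (ht.1.arr 3 rfl))
  have w4 : w.arr 4 = s.arr 4 := (hw.arr 4 rfl).trans ((hu.1.arr 4 rfl).trans (ht.1.arr 4 rfl))
  have w2 : w.arr 2 = s.arr 2 := (hw.arr 2 rfl).trans ((hu.1.arr 2 rfl).trans (ht.1.arr 2 rfl))
  have w5 : w.arr 5 = t.arr 5 := (hw.arr 5 rfl).trans (hu.1.arr 5 rfl)
  have htup : ∀ i : Fin inp.k, t.arr 5 i = tupleAt s inp.k P i := by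
    intro i
    rw [t5 i i.isLt, hq.read]
    rfl
  have hr := hq.height P hlt
  have hset : u.query n 0 = blockSet lab (s.arr 4 P) (tupleAt s inp.k P) := by
    ext a
    have e1 : t.arr 1 a = lab a := by rw [ht.1.arr 1 rfl, hlab]
    simp only [Store.query, blockSet, mem_filter, mem_univ, true_and]
    rw [u0 a a.isLt, t23, hs.pow _ (by omega), e1]
    constructor
    · rintro ⟨i, hi, h⟩
      rw [htup ⟨i, hi⟩] at h
      exact ⟨⟨i, hi⟩, h⟩
    · rintro ⟨i, h⟩
      rw [← htup] at h
      exact ⟨i, i.isLt, h⟩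
  have hgood : (w.var 22 ≠ 0 ∧ w.var 24 ≠ 0) ↔ GoodNode F lab (s.arr 4 P) (tupleAt s inp.k P) := by
    unfold GoodNode
    rw [← hset, w22, t22, monotone_fin_iff inp.k fun i => s.arr 3 (s.var 19 + i), hq.read]
    refine and_congr Iff.rfl ?_
    rw [h24]
    split_ifs with h <;> simp [h]
  by_cases hg : GoodNode F lab (s.arr 4 P) (tupleAt s inp.k P)
  · obtain hr0 | ⟨r, hr1⟩ : s.arr 4 P = 0 ∨ ∃ r, s.arr 4 P = r + 1 := by
      rcases Nat.eq_zero_or_eq_succ_pred (s.arr 4 P) with h | h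
      exacts [.inl h, .inr ⟨_, h⟩]
    · obtain ⟨a1, a2, a3, a4, a5⟩ := xB (hgood.2 hg) (by omega)
      exact hq.count_leaf hlt hg hr0 (a1.trans w18) (by omega) (a2.trans w20) (by omega)
        (a4.trans w3) (a5.trans w4)
    · obtain ⟨a1, a2, a3, a4, a5, a6, a7⟩ := xC (hgood.2 hg) (by omega)
      rw [w18] at a4 a5
      rw [w20] at a6 a7
      refine hq.expand hlt hr1 hg (by omega) (by omega) (by omega) (by omega)
        (fun b hb => (a4 b hb).trans (by omega)) (fun j hj => (a5 j hj).trans (by rw [w4]))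
        (fun b hb i => (a6 b hb i i.isLt).trans ?_) fun j hj => (a7 j hj).trans (by rw [w3])
      rw [w5, htup, w29, hr1, Nat.add_sub_cancel, w2, hs.pow r (by omega)]
      rfl
  · obtain ⟨a1, a2, a3, a4, a5⟩ := xA (fun h => hg (hgood.1 h))
    exact hq.skip_bad hlt hg (a1.trans w18) (by omega) (a2.trans w20) (a3.trans w21)
      (a4.trans w3) (a5.trans w4)

open Classical in
/-- The potential of the search: if all went well for the first `i` nodes, the probability that
something goes wrong with the others, and `1` otherwise. -/
def searchPotential (F : Finset (Finset (Fin n))) (lab : Fin n → ℕ) (k L cap : ℕ) (η : ℝ≥0∞)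
    (i : ℕ) (s : Store) : ℝ≥0∞ :=
  if QueueInv F lab k L (min i (s.var 18)) s then (cap - i : ℕ) * η else 1

theorem searchPotential_le_one {k cap : ℕ} {η : ℝ≥0∞} (h : cap * η ≤ 1) (i : ℕ) (s : Store) :
    searchPotential F lab k L cap η i s ≤ 1 := by
  unfold searchPotential
  split_ifs
  · refine le_trans ?_ h
    gcongr
    omega
  · exact le_rfl

/-- A union bound in the form of a potential: each processed node uses up one share `ρ ^ m` of the
failure probability. -/
theorem Triple.search {M : Machine inp} {p α β ρ : ℝ≥0∞} (hO : Decides F p M.O) (hα : 1 ≤ α)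
    (hαβ : α * β = 1) (hρ : β + (α - β) * p ≤ ρ) {s : Store} {cap : ℕ} (hs : Ready inp.k L m s)
    (hlab : ∀ a : Fin n, s.arr 1 a = lab a) (hcap : s.var 7 = cap) (hη : cap * ρ ^ m ≤ 1)
    (hq : QueueInv F lab inp.k L 0 s) :
    Triple M .search s (cap * (nodeTime n inp.k m + 4) + 3) (cap * m)
      (searchPotential F lab inp.k L cap (ρ ^ m) cap) (cap * ρ ^ m) := by
  classical
  have hset : ∀ (t : Store) (i v : ℕ), searchPotential F lab inp.k L cap (ρ ^ m) i (t.setVar 10 v) =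
      searchPotential F lab inp.k L cap (ρ ^ m) i t := by
    intro t i v
    unfold searchPotential
    have : QueueInv F lab inp.k L (min i (t.var 18)) (t.setVar 10 v) ↔
        QueueInv F lab inp.k L (min i (t.var 18)) t :=
      ⟨fun h => h.congr rfl rfl rfl rfl rfl rfl, fun h => h.congr rfl rfl rfl rfl rfl rfl⟩
    exact if_congr this rfl rfl
  refine (Triple.forTo (x := 10) (e := .var 7) (inp := inp) (N := cap)
    (T := nodeTime n inp.k m + 1) (B := m)
    (searchPotential F lab inp.k L cap (ρ ^ m)) (fun t ht => (ht.var 7 rfl).trans hcap) rfl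
    ?_).conseq le_rfl le_rfl (fun _ _ => le_rfl) ?_
  · intro i hi t ht hti
    simp only [hset]
    have hrt : Ready inp.k L m t := hs.of_keeps ht rfl rfl rfl
    have hlt : ∀ a : Fin n, t.arr 1 a = lab a := by rwa [ht.arr 1 rfl]
    refine Triple.ite _ ?_
    by_cases h : i < t.var 18
    · rw [if_pos (by rw [Expr.eval_lt_ne_zero]; simpa [Expr.eval, hti] using h)]
      have h1 := Triple.processNode (L := L) hO hα hαβ hρ hrt hlt
      rw [hti] at h1
      -- The minimum accounts for an exhausted queue: from then on the number of processed nodes is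
      -- the queue length, and the remaining rounds do nothing.
      by_cases hqt : QueueInv F lab inp.k L (min i (t.var 18)) t
      · have hqi : QueueInv F lab inp.k L i t := by rwa [min_eq_left h.le] at hqt
        refine (h1.affine ((cap - (i + 1) : ℕ) * ρ ^ m) 1).conseq le_rfl le_rfl (fun u hu => ?_) ?_
        · by_cases hu' : QueueInv F lab inp.k L (i + 1) u
          · unfold searchPotential
            rw [min_eq_left hu'.le, if_pos hu']
            exact le_self_add
          · rw [if_neg fun h' => hu' (h' hqi h)]
            exact (searchPotential_le_one hη _ _).trans (by simp)
        · unfold searchPotential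
          rw [if_pos hqt, one_mul, ← add_one_mul]
          gcongr
          norm_cast
          omega
      · refine (h1.const 1).conseq le_rfl le_rfl (fun u _ => searchPotential_le_one hη _ _) ?_
        unfold searchPotential
        rw [if_neg hqt]
    · rw [if_neg (by rw [Expr.eval_lt_ne_zero]; simpa [Expr.eval, hti] using h)]
      refine ((Det.skip t).triple M _).conseq (by unfold nodeTime; omega) (Nat.zero_le _)
        (fun _ _ => le_rfl) ?_
      unfold searchPotential
      have e18 : (t.setVar 30 0).var 18 = t.var 18 := rfl
      rw [e18, min_eq_right (by omega), min_eq_right (by omega)]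
      by_cases hqt : QueueInv F lab inp.k L (t.var 18) t
      · have hqt' : QueueInv F lab inp.k L (t.var 18) (t.setVar 30 0) :=
          hqt.congr rfl rfl rfl rfl rfl rfl
        rw [if_pos hqt, if_pos hqt']
        gcongr
        omega
      · have hqt' : ¬ QueueInv F lab inp.k L (t.var 18) (t.setVar 30 0) :=
          fun h => hqt (h.congr rfl rfl rfl rfl rfl rfl)
        rw [if_neg hqt, if_neg hqt']
  · rw [hset]
    unfold searchPotential
    rw [Nat.zero_min, if_pos hq]
    simp

end Node

/-- Replacing one coordinate of a uniform function by a fresh uniform value leaves it uniform;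
exchanging the old and the new value is an involution. -/
theorem sum_sum_update {ι β : Type*} [Fintype ι] [DecidableEq ι] [Fintype β] (i : ι)
    (H : (ι → β) → ℝ≥0∞) :
    ∑ r : β, ∑ f : ι → β, H (Function.update f i r) = Fintype.card β * ∑ f : ι → β, H f := by
  have h1 : ∑ x : β × (ι → β), H (Function.update x.2 i x.1) = ∑ x : β × (ι → β), H x.2 := by
    have hinv : Function.Involutive fun x : β × (ι → β) => (x.2 i, Function.update x.2 i x.1) := by
      rintro ⟨r, f⟩
      simp
    exact Fintype.sum_equiv hinv.toPerm _ _ fun x => rfl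
  rw [Fintype.sum_prod_type, Fintype.sum_prod_type] at h1
  rw [h1]
  simp

/-! ### The success probability of one trial -/

section Trial

variable {n : ℕ} {inp : Input n} {F : Finset (Finset (Fin n))} {L m : ℕ}

theorem Triple.rand_of_eq {M : Machine inp} {s : Store} {f : Store → ℝ≥0∞} (x : ℕ) (e : Expr)
    {B : ℕ} (he : e.eval inp s + 1 = B) :
    Triple M (.rand x e) s 1 0 f ((B : ℝ≥0∞)⁻¹ * ∑ r : Fin B, f (s.setVar x r)) := by
  subst he
  rw [Finset.mul_sum]
  exact Triple.rand x e

/-- The invariant averages `G` over uniform labellings whose first `i` values have been replaced by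
those already drawn. -/
theorem Triple.drawLabels {M : Machine inp} {s : Store} (hs : Ready inp.k L m s)
    (G : (Fin n → ℕ) → ℝ≥0∞) :
    Triple M .drawLabels s (n * 6 + 3) 0 (fun u => G fun a => u.arr 1 a)
      ((((2 ^ L) ^ n : ℕ) : ℝ≥0∞)⁻¹ * ∑ lab : Fin n → Fin (2 ^ L), G fun a => lab a) := by
  classical
  have hB0 : ((2 ^ L : ℕ) : ℝ≥0∞) ≠ 0 := by positivity
  have hBt : ((2 ^ L : ℕ) : ℝ≥0∞) ≠ ⊤ := ENNReal.natCast_ne_top _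
  refine (Triple.forTo (x := 10) (e := .size) (inp := inp) (N := n) (T := 3) (B := 0)
    (fun i t => (((2 ^ L) ^ n : ℕ) : ℝ≥0∞)⁻¹ * ∑ lab : Fin n → Fin (2 ^ L),
      G fun a => if (a : ℕ) < i then t.arr 1 a else lab a) (fun _ _ => rfl) rfl ?_).conseq le_rfl
      (by simp) ?_ ?_
  · intro i hi t ht hti
    have hr := hs.of_keeps ht rfl rfl rfl
    have he : (Expr.sub (.arr 2 (.var 2)) (.lit 1)).eval inp t + 1 = 2 ^ L := by
      simp only [Expr.eval, hr.levels, hr.pow L (by omega)]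
      have : 0 < 2 ^ L := by positivity
      omega
    refine (Triple.seq (T := 1) (B := 0) (T' := 1) (B' := 0) (Triple.rand_of_eq 13 _ he)
      (fun u hu => (Det.write 1 (.var 10) (.var 13)).triple M _)).conseq le_rfl le_rfl
      (fun _ _ => le_rfl) ?_
    set H : (Fin n → Fin (2 ^ L)) → ℝ≥0∞ := fun lab =>
      G fun a => if (a : ℕ) < i then t.arr 1 a else lab a
    have h1 : ∀ r : Fin (2 ^ L), (∑ lab : Fin n → Fin (2 ^ L),
        G fun a => if (a : ℕ) < i + 1 then (((t.setVar 13 r).setArr 1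
          ((Expr.var 10).eval inp (t.setVar 13 r)) ((Expr.var 13).eval inp (t.setVar 13 r))).setVar
            10 (i + 1)).arr 1 a else lab a) =
        ∑ lab : Fin n → Fin (2 ^ L), H (Function.update lab ⟨i, hi⟩ r) := by
      intro r
      refine Finset.sum_congr rfl fun lab _ => congrArg G (funext fun a => ?_)
      simp only [Expr.eval, Store.arr_setVar, Store.arr_setArr, Store.var_setVar]
      by_cases ha : (a : ℕ) = i
      · have : a = ⟨i, hi⟩ := Fin.ext ha
        simp [this, hti]
      · have : a ≠ ⟨i, hi⟩ := fun h => ha (congrArg Fin.val h)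
        have hlt : (a : ℕ) < i + 1 ↔ (a : ℕ) < i := by omega
        simp [this, ha, hti, hlt]
    simp only [h1]
    rw [← Finset.mul_sum, sum_sum_update, Fintype.card_fin, mul_left_comm,
      ← mul_assoc _ _ (∑ f, H f), ENNReal.inv_mul_cancel hB0 hBt, one_mul]
  · intro t _
    refine le_of_eq ?_
    simp only [Fin.is_lt, if_true, Finset.sum_const, Finset.card_univ, Fintype.card_pi,
      Fintype.card_fin, Finset.prod_const, nsmul_eq_mul]
    rw [← mul_assoc, ENNReal.inv_mul_cancel, one_mul]
    · positivity
    · exact ENNReal.natCast_ne_top _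
  · simp

theorem exists_det_initQueue (lab : Fin n → ℕ) (s : Store) (hs : s.var 2 = L) :
    ∃ t, Det inp .initQueue s (inp.k * 4 + 13) t ∧ QueueInv F lab inp.k L 0 t := by
  obtain ⟨t, ht, h⟩ := Det.forTo (inp := inp) (x := 10) (e := .par)
    (c := .write 3 (.var 10) (.lit 0)) (s := s) (N := inp.k) (T := 1)
    (fun i t => ∀ j < i, t.arr 3 j = 0) (fun _ _ => rfl) rfl (by simp) (by
      intro i hi t ht hti h
      refine ⟨_, Det.write 3 (.var 10) (.lit 0), fun j hj => ?_⟩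
      simp only [Expr.eval, hti, Store.arr_setVar, Store.arr_setArr]
      by_cases hji : j = i
      · simp [hji]
      · simpa [hji] using h j (by omega))
  refine ⟨_, (ht.seq ((Det.write 4 (.lit 0) (.var 2)).seq ((Det.assign 18 (.lit 1)).seq
    ((Det.assign 19 (.lit 0)).seq ((Det.assign 20 .par).seq (Det.assign 21 (.lit 0))))))).mono
    (by omega), ?_⟩
  have h2 : t.var 2 = L := (ht.1.var 2 rfl).trans hs
  simp only [Expr.eval, h2]
  set u := (((((t.setArr 4 0 L).setVar 18 1).setVar 19 0).setVar 20 inp.k).setVar 21 0)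
  have u18 : u.var 18 = 1 := rfl
  have u4 : u.arr 4 0 = L := by simp [u, Store.arr_setVar, Store.arr_setArr]
  have u3 : tupleAt u inp.k 0 = fun _ => 0 := by
    refine funext fun i => ?_
    have := h i i.isLt
    simpa [tupleAt, u, Store.arr_setVar, Store.arr_setArr] using this
  constructor
  · exact Nat.zero_le _
  · simp [u, Store.var_setVar]
  · simp [u, Store.var_setVar]
  · intro e he
    obtain rfl : e = 0 := by omega
    exact u4.le
  · rw [u18]
    simp [u4, u3, show u.var 21 = 0 from rfl]
  · rw [u18]
    simp [u4, u3]

/-- The code of the correct result of a trial: `0` for "more than `M`", `N + 1` for `N`. -/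
def correctCode (N M : ℕ) : ℕ := if N ≤ M then N + 1 else 0

theorem exists_det_report (s : Store) :
    ∃ t, Det inp .report s 3 t ∧ t.var 15 = if s.var 7 < s.var 18 then 0 else
      correctCode (s.var 21) (inp.nums.getD 0 0) := by
  by_cases h : s.var 7 < s.var 18
  · refine ⟨s.setVar 15 0, (Det.ite (T := 1) _ ?_).mono (by omega), ?_⟩
    · rw [if_pos ((Expr.eval_lt_ne_zero (e := .var 7) (f := .var 18)).2 h)]
      exact Det.assign 15 (.lit 0)
    · rw [if_pos h]
      rfl
  rw [if_neg h]
  by_cases h' : inp.nums.getD 0 0 < s.var 21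
  · refine ⟨s.setVar 15 0, Det.ite (T := 2) _ ?_, ?_⟩
    · rw [if_neg (fun hn => h ((Expr.eval_lt_ne_zero (e := .var 7) (f := .var 18)).1 hn))]
      refine Det.ite (T := 1) _ ?_
      rw [if_pos ((Expr.eval_lt_ne_zero (e := .num 0) (f := .var 21)).2 h')]
      exact Det.assign 15 (.lit 0)
    · rw [correctCode, if_neg (by omega)]
      rfl
  · refine ⟨s.setVar 15 (s.var 21 + 1), Det.ite (T := 2) _ ?_, ?_⟩
    · rw [if_neg (fun hn => h ((Expr.eval_lt_ne_zero (e := .var 7) (f := .var 18)).1 hn))]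
      refine Det.ite (T := 1) _ ?_
      rw [if_neg (fun hn => h' ((Expr.eval_lt_ne_zero (e := .num 0) (f := .var 21)).1 hn))]
      exact Det.assign 15 (.add (.var 21) (.lit 1))
    · rw [correctCode, if_pos (by omega)]
      rfl

/-- Labels for which the search gives the correct result if the oracle makes no error. -/
def GoodLabels (F : Finset (Finset (Fin n))) (k L M cap : ℕ) (lab : Fin n → ℕ) : Prop :=
  Function.Injective lab ∧ (∀ a, lab a < 2 ^ L) ∧
    (#F ≤ M → 1 + descCount F lab L (fun _ : Fin k => 0) ≤ cap)

/-- If a node is left over after `cap` rounds, the conserved size shows that the tree has more than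
`cap` nodes, which good labels exclude for `#F ≤ M`. If none is left, the conserved number of leaves
has become the counter. -/
theorem QueueInv.report_eq {lab : Fin n → ℕ} {k M cap : ℕ} {s : Store} (hF : ∀ W ∈ F, #W = k)
    (hlab : GoodLabels F k L M cap lab) (h : QueueInv F lab k L (min cap (s.var 18)) s) :
    (if cap < s.var 18 then 0 else correctCode (s.var 21) M) = correctCode #F M := by
  split_ifs with hc
  · rw [correctCode, if_neg]
    intro hM
    have h1 := h.size
    rw [min_eq_left hc.le, Finset.sum_eq_sum_Ico_succ_bot hc] at h1
    have := hlab.2.2 hM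
    omega
  · have h1 := h.leaves
    rw [min_eq_right (by omega), Ico_self, Finset.sum_empty, add_zero, leafCount_root,
      goodCount_zero hF hlab.1 hlab.2.1] at h1
    rw [h1]

open Classical in
theorem sum_goodLabels_le {k M M' : ℕ} (hF : ∀ W ∈ F, #W = k) (hL : 16 * n ^ 2 ≤ 2 ^ L)
    (hL1 : 1 ≤ L) (hM' : 1 ≤ M') (hMM : #F ≤ M → #F ≤ M') {η : ℝ≥0∞} (hη : η ≤ 16⁻¹) :
    (((2 ^ L) ^ n : ℕ) : ℝ≥0∞)⁻¹ * ∑ lab : Fin n → Fin (2 ^ L),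
      (if GoodLabels F k L M (L * (2 ^ (4 * k + 4) * M')) (fun a => (lab a : ℕ)) then η else 1) ≤
      4⁻¹ := by
  set cap := L * (2 ^ (4 * k + 4) * M')
  set Ω := (2 ^ L) ^ n with hΩ
  have hΩ0 : (Ω : ℝ≥0∞) ≠ 0 := by
    rw [hΩ]
    positivity
  have hΩt : (Ω : ℝ≥0∞) ≠ ⊤ := ENNReal.natCast_ne_top _
  set bad : Finset (Fin n → Fin (2 ^ L)) := {lab | ¬ GoodLabels F k L M cap (fun a => (lab a : ℕ))}
  -- Repeated labels contribute 1/16, large trees 2/16; the latter matter only for `#F ≤ M`, as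
  -- overflow is the correct verdict otherwise.
  have hbad : 16 * #bad ≤ 3 * Ω := by
    have h1 := card_not_injective_le hL
    have hsub : #F ≤ M → #bad ≤ #{lab : Fin n → Fin (2 ^ L) | ¬ Function.Injective lab} +
        #{lab : Fin n → Fin (2 ^ L) |
          cap < 1 + descCount F (fun a => lab a) L (fun _ : Fin k => 0)} := by
      intro _
      refine (Finset.card_le_card fun lab hlab => ?_).trans (Finset.card_union_le _ _)
      rw [mem_union, mem_filter, mem_filter]
      by_contra! hcon
      refine (mem_filter.1 hlab).2 ⟨?_, fun a => (lab a).isLt, fun _ => ?_⟩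
      · exact Fin.val_injective.comp (hcon.1 (mem_univ _))
      · exact hcon.2 (mem_univ _)
    by_cases hFM : #F ≤ M
    · have h2 : 8 * #{lab : Fin n → Fin (2 ^ L) |
          cap < 1 + descCount F (fun a => lab a) L (fun _ : Fin k => 0)} ≤ Ω :=
        card_large_tree_le hF hM' (hMM hFM) hL1
      have := hsub hFM
      omega
    · have : #bad ≤ #{lab : Fin n → Fin (2 ^ L) | ¬ Function.Injective lab} := by
        refine Finset.card_le_card fun lab hlab => mem_filter.2 ⟨mem_univ _, fun hinj => ?_⟩
        exact (mem_filter.1 hlab).2 ⟨Fin.val_injective.comp hinj, fun a => (lab a).isLt,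
          fun h => absurd h hFM⟩
      omega
  have h1 : ∑ lab : Fin n → Fin (2 ^ L),
      (if GoodLabels F k L M cap (fun a => (lab a : ℕ)) then η else 1) ≤
      (Ω : ℝ≥0∞) * 16⁻¹ + #bad := by
    calc _ ≤ ∑ lab : Fin n → Fin (2 ^ L), ((16⁻¹ : ℝ≥0∞) +
          if ¬ GoodLabels F k L M cap (fun a => (lab a : ℕ)) then 1 else 0) := by
          refine Finset.sum_le_sum fun lab _ => ?_
          by_cases h : GoodLabels F k L M cap fun a => (lab a : ℕ)
          · simpa [h] using hη
          · simp [h]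
      _ = _ := by
          rw [Finset.sum_add_distrib, Finset.sum_boole]
          simp [bad, hΩ]
  have h2 : (#bad : ℝ≥0∞) ≤ Ω * (3 * 16⁻¹) := by
    have : ((16 * #bad : ℕ) : ℝ≥0∞) ≤ ((3 * Ω : ℕ) : ℝ≥0∞) := by exact_mod_cast hbad
    push_cast at this
    calc (#bad : ℝ≥0∞) = 16⁻¹ * (16 * #bad) := by
          rw [← mul_assoc, ENNReal.inv_mul_cancel (by norm_num) (by norm_num), one_mul]
      _ ≤ 16⁻¹ * (3 * Ω) := by gcongr
      _ = _ := by ring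
  calc _ ≤ (Ω : ℝ≥0∞)⁻¹ * (Ω * 16⁻¹ + Ω * (3 * 16⁻¹)) := by
        gcongr
        exact h1.trans (by gcongr)
    _ = ((Ω : ℝ≥0∞)⁻¹ * Ω) * (4 * 16⁻¹) := by ring
    _ = 4 * 16⁻¹ := by rw [ENNReal.inv_mul_cancel hΩ0 hΩt, one_mul]
    _ = 4⁻¹ := by
        rw [show (16 : ℝ≥0∞) = 4 * 4 by norm_num, ENNReal.mul_inv (by norm_num) (by norm_num),
          ← mul_assoc, ENNReal.mul_inv_cancel (by norm_num) (by norm_num), one_mul]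

/-- The time for a trial. -/
def trialTime (n k m cap : ℕ) : ℕ :=
  n * 6 + 3 + (k * 4 + 13 + (cap * (nodeTime n k m + 4) + 3 + 3 + 1) + 1) + 1

-- The labels are averaged over at the end: bad labels are charged `1`, good ones the failure
-- probability of the search.
open Classical in
theorem Triple.trial {M : Machine inp} {p α β ρ : ℝ≥0∞} (hO : Decides F p M.O) (hα : 1 ≤ α)
    (hαβ : α * β = 1) (hρ : β + (α - β) * p ≤ ρ) {s : Store} {cap M' : ℕ}
    (hs : Ready inp.k L m s) (hcap : s.var 7 = cap) (hcap' : cap = L * (2 ^ (4 * inp.k + 4) * M'))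
    (hη : cap * ρ ^ m ≤ 16⁻¹) (hF : ∀ W ∈ F, #W = inp.k) (hL : 16 * n ^ 2 ≤ 2 ^ L) (hL1 : 1 ≤ L)
    (hM' : 1 ≤ M') (hMM : #F ≤ inp.nums.getD 0 0 → #F ≤ M') :
    Triple M .trial s (trialTime n inp.k m cap) (cap * m)
      (fun u => if u.var 15 = correctCode #F (inp.nums.getD 0 0) then 0 else 1) 4⁻¹ := by
  have hη1 : cap * ρ ^ m ≤ 1 := hη.trans (by simp)
  refine (Triple.seq (B := 0) (B' := cap * m) (Triple.drawLabels hs fun lab =>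
    if GoodLabels F inp.k L (inp.nums.getD 0 0) cap lab then cap * ρ ^ m else 1)
    fun t ht => ?_).conseq le_rfl (by simp) (fun _ _ => le_rfl) ?_
  · have hrt := hs.of_keeps ht rfl rfl rfl
    obtain ⟨u, hu, hq⟩ := exists_det_initQueue (inp := inp) (F := F) (fun a : Fin n => t.arr 1 a) t
      hrt.levels
    have hru := hrt.of_keeps hu.1 rfl rfl rfl
    have hsearch := Triple.search (M := M) (cap := cap) hO hα hαβ hρ hru
      (fun a => by rw [hu.1.arr 1 rfl])
      ((hu.1.var 7 rfl).trans ((ht.var 7 rfl).trans hcap)) hη1 hq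
    have hall := Triple.seq (T' := 3) (B' := 0) (d := .report)
      (f := fun u => if GoodLabels F inp.k L (inp.nums.getD 0 0) cap (fun a : Fin n => t.arr 1 a) →
        u.var 15 = correctCode #F (inp.nums.getD 0 0) then 0 else 1) hsearch (by
      intro w hw
      obtain ⟨x, hx, hx15⟩ := exists_det_report (inp := inp) w
      refine (hx.triple M _).conseq le_rfl le_rfl (fun _ _ => le_rfl) ?_
      have w7 : w.var 7 = cap :=
        (hw.var 7 rfl).trans ((hu.1.var 7 rfl).trans ((ht.var 7 rfl).trans hcap))
      by_cases hqw : QueueInv F (fun a : Fin n => t.arr 1 a) inp.k L (min cap (w.var 18)) w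
      · rw [if_pos]
        · exact zero_le
        · intro hg
          rw [hx15, w7]
          exact hqw.report_eq hF hg
      · unfold searchPotential
        rw [if_neg hqw]
        split_ifs <;> simp)
    by_cases hg : GoodLabels F inp.k L (inp.nums.getD 0 0) cap (fun a : Fin n => t.arr 1 a)
    · rw [if_pos hg]
      simp only [hg, true_imp_iff] at hall
      exact hu.triple_seq hall
    · rw [if_neg hg]
      refine hu.triple_seq ((hall.const 1).conseq le_rfl le_rfl (fun x _ => ?_) le_rfl)
      split_ifs <;> simp
  · subst hcap'
    exact sum_goodLabels_le hF hL hL1 hM' hMM hη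

end Trial

/-! ### The constants, the output and the complete program -/

namespace Cmd

/-- Compute the number of bits of a label. -/
def initLevels : Cmd :=
  .seq (.assign 13 (.lit 1)) (.seq (.assign 2 (.lit 4)) (.forTo 10 .size
    (.ite (.lt (.var 13) .size) (.seq (.assign 13 (.add (.var 13) (.var 13)))
      (.assign 2 (.add (.var 2) (.lit 2)))) skip)))

/-- `y := e * f` -/
def product (y : ℕ) (e f : Expr) : Cmd :=
  .seq (.assign y (.lit 0)) (.forTo 10 e (.assign y (.add (.var y) f)))

/-- Tabulate the powers of two. -/
def initPowers : Cmd :=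
  .seq (.assign 13 (.lit 1)) (.forTo 10 (.add (.var 4) (.lit 1))
    (.seq (.write 2 (.var 10) (.var 13)) (.assign 13 (.add (.var 13) (.var 13)))))

/-- Cap the threshold. -/
def capThreshold : Cmd :=
  .ite (.lt (.arr 2 (.var 3)) (.num 0)) (.assign 6 (.arr 2 (.var 3))) (.assign 6 (.num 0))

/-- Multiply the capped threshold by a power of two. -/
def scaleThreshold : Cmd :=
  .seq (.assign 13 (.var 6)) (.forTo 10 (.add (.add (.add .par .par) (.add .par .par)) (.lit 4))
    (.assign 13 (.add (.var 13) (.var 13))))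

/-- Compute the number of trials. -/
def countTrials (r : ℕ) : Cmd :=
  .seq (.assign 8 (.lit 0)) (.seq (.assign 13 (.num 3)) (.loop (.lt (.var 13) (.num 4))
    (.seq (.assign 13 (.add (.var 13) (.var 13))) (.assign 8 (.add (.var 8) (.lit r))))))

/-- Compute the constants of the algorithm. -/
def setup (r r' : ℕ) : Cmd :=
  .seq initLevels (.seq (product 3 .par (.var 2)) (.seq
    (.assign 4 (.add (.add (.add .par .par) (.add .par .par)) (.add (.lit 8)
      (.add (.var 2) (.var 3))))) (.seq initPowers (.seq (product 5 (.var 4) (.lit r))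
    (.seq capThreshold (.seq scaleThreshold (.seq (product 7 (.var 2) (.var 13))
      (countTrials r'))))))))

/-- Write the output. -/
def writeOutput : Cmd :=
  .ite (.var 16) (.seq (.assign 0 (.lit 0)) (.assign 1 (.sub (.var 16) (.lit 1))))
    (.assign 0 (.lit 1))

/-- The counting algorithm. -/
def countWitnesses (r r' : ℕ) : Cmd :=
  .seq (setup r r') (.seq (.majority 9 (.var 8) trial 15 16 17) writeOutput)

end Cmd

/-! ### Verification of the complete program -/

section Setup

variable {n : ℕ} {inp : Input n}

/-- A power of two is doubled until it reaches `n`, and two bits are added each time, which makes `2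
^ L = 16 * (2 ^ l) ^ 2`. A loop of `n` rounds suffices since `n < 2 ^ n`. -/
theorem exists_det_initLevels (hn : 1 ≤ n) (s : Store) :
    ∃ t l, Det inp .initLevels s (n * 7 + 7) t ∧ t.var 2 = 2 * l + 4 ∧ n ≤ 2 ^ l ∧
      2 ^ l ≤ 2 * n := by
  refine Exists.elim (Det.forTo (inp := inp) (x := 10) (e := .size)
    (c := .ite (.lt (.var 13) .size) (.seq (.assign 13 (.add (.var 13) (.var 13)))
      (.assign 2 (.add (.var 2) (.lit 2)))) .skip) (s := (s.setVar 13 1).setVar 2 4) (N := n)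
    (T := 4) (fun i t => ∃ l, t.var 13 = 2 ^ l ∧ t.var 2 = 2 * l + 4 ∧ 2 ^ l < 2 * n ∧
      (n ≤ 2 ^ l ∨ l = i)) (fun _ _ => rfl) rfl ?_ ?_) ?_
  · exact ⟨0, rfl, rfl, by rw [pow_zero]; omega, .inr rfl⟩
  · rintro i hi t ht hti ⟨l, h1, h2, h3, h4⟩
    by_cases hl : 2 ^ l < n
    · refine ⟨(t.setVar 13 (2 ^ (l + 1))).setVar 2 (2 * (l + 1) + 4), Det.ite (T := 3) _ ?_,
        l + 1, rfl, rfl, by rw [pow_succ]; omega, .inr (by omega)⟩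
      rw [if_pos ((Expr.eval_lt_ne_zero (e := .var 13) (f := .size)).2 (by
        simpa [Expr.eval, h1] using hl))]
      have e1 := Det.assign (inp := inp) (s := t) 13 (.add (.var 13) (.var 13))
      have e2 := Det.assign (inp := inp) (s := t.setVar 13 (2 ^ (l + 1))) 2
        (.add (.var 2) (.lit 2))
      simp only [Expr.eval, h1, ← two_mul, ← pow_succ'] at e1
      simp only [Expr.eval, Store.var_setVar, h2] at e2
      exact e1.seq e2
    · refine ⟨t.setVar 30 0, (Det.ite (T := 1) _ ?_).mono (by omega), l, h1, h2, h3,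
        .inl (by omega)⟩
      rw [if_neg]
      · exact Det.skip t
      · rw [Expr.eval_lt_ne_zero]
        simpa [Expr.eval, h1] using hl
  · rintro t ⟨ht, l, h1, h2, h3, h4⟩
    refine ⟨t, l, ((Det.assign 13 (.lit 1)).seq ((Det.assign 2 (.lit 4)).seq ht)).mono (by omega),
      h2, ?_, h3.le⟩
    rcases h4 with h | rfl
    · exact h
    · exact Nat.lt_two_pow_self.le

theorem exists_det_product {y N v : ℕ} {e f : Expr} (hy : y ≠ 10) (s : Store)
    (he : ∀ t, Keeps (.product y e f) s t → e.eval inp t = N)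
    (hf : ∀ t, Keeps (.product y e f) s t → f.eval inp t = v) :
    ∃ t, Det inp (.product y e f) s (N * 4 + 5) t ∧ t.var y = N * v := by
  have hk : ∀ t, Keeps (.forTo 10 e (.assign y (.add (.var y) f))) (s.setVar y 0) t →
      Keeps (.product y e f) s t := fun t ht =>
    Keeps.trans (t := s.setVar y 0) (Keeps.setVar _ (by simp [Cmd.product, Cmd.modVar]))
      ht.seq_right
  refine Exists.elim (Det.forTo (inp := inp) (x := 10) (e := e)
    (c := .assign y (.add (.var y) f)) (s := s.setVar y 0) (N := N) (T := 1)
    (fun i t => t.var y = i * v) (fun t ht => he t (hk t ht))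
    (by simpa [Cmd.modVar] using hy) ?_ ?_) ?_
  · simp [Store.var_setVar, hy]
  · intro i hi t ht hti h
    refine ⟨_, Det.assign y (.add (.var y) f), ?_⟩
    simp [Store.var_setVar, hy, Expr.eval, h, hf t (hk t ht), add_mul]
  · rintro t ⟨ht, h⟩
    exact ⟨t, ((Det.assign y (.lit 0)).seq ht).mono (by omega), h⟩

theorem exists_det_initPowers (s : Store) :
    ∃ t, Det inp .initPowers s ((s.var 4 + 1) * 6 + 5) t ∧ ∀ i ≤ s.var 4, t.arr 2 i = 2 ^ i := by
  refine Exists.elim (Det.forTo (inp := inp) (x := 10) (e := .add (.var 4) (.lit 1))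
    (c := .seq (.write 2 (.var 10) (.var 13)) (.assign 13 (.add (.var 13) (.var 13))))
    (s := s.setVar 13 1) (N := s.var 4 + 1) (T := 3)
    (fun i t => t.var 13 = 2 ^ i ∧ ∀ j < i, t.arr 2 j = 2 ^ j) (fun t ht => ?_) rfl ?_ ?_) ?_
  · simp only [Expr.eval, ht.var 4 rfl]
    rfl
  · exact ⟨rfl, by simp⟩
  · rintro i hi t ht hti ⟨h1, h2⟩
    refine ⟨_, (Det.write 2 (.var 10) (.var 13)).seq (Det.assign 13 (.add (.var 13) (.var 13))),
      ?_, fun j hj => ?_⟩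
    · simp [Store.var_setVar, Store.var_setArr, Expr.eval, h1, pow_succ, mul_two]
    · by_cases hji : j = i
      · simp [Store.arr_setVar, Store.arr_setArr, Expr.eval, hti, h1, hji]
      · simpa [Store.arr_setVar, Store.arr_setArr, Expr.eval, hti, hji] using h2 j (by omega)
  · rintro t ⟨ht, -, h⟩
    exact ⟨t, ((Det.assign 13 (.lit 1)).seq ht).mono (by omega), fun i hi => h i (by omega)⟩

theorem exists_det_capThreshold (s : Store) :
    ∃ t, Det inp .capThreshold s 2 t ∧ t.var 6 = min (inp.nums.getD 0 0) (s.arr 2 (s.var 3)) := by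
  by_cases h : s.arr 2 (s.var 3) < inp.nums.getD 0 0
  · refine ⟨s.setVar 6 (s.arr 2 (s.var 3)), Det.ite (T := 1) _ ?_, ?_⟩
    · rw [if_pos ((Expr.eval_lt_ne_zero (e := .arr 2 (.var 3)) (f := .num 0)).2 h)]
      exact Det.assign 6 (.arr 2 (.var 3))
    · rw [min_eq_right h.le]
      rfl
  · refine ⟨s.setVar 6 (inp.nums.getD 0 0), Det.ite (T := 1) _ ?_, ?_⟩
    · rw [if_neg fun hn => h ((Expr.eval_lt_ne_zero (e := .arr 2 (.var 3)) (f := .num 0)).1 hn)]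
      exact Det.assign 6 (.num 0)
    · rw [min_eq_left (not_lt.1 h)]
      rfl

theorem exists_det_scaleThreshold (s : Store) :
    ∃ t, Det inp .scaleThreshold s ((4 * inp.k + 4) * 4 + 5) t ∧
      t.var 13 = 2 ^ (4 * inp.k + 4) * s.var 6 := by
  refine Exists.elim (Det.forTo (inp := inp) (x := 10)
    (e := .add (.add (.add .par .par) (.add .par .par)) (.lit 4))
    (c := .assign 13 (.add (.var 13) (.var 13)))
    (s := s.setVar 13 (s.var 6)) (N := 4 * inp.k + 4) (T := 1)
    (fun i t => t.var 13 = 2 ^ i * s.var 6) (fun t ht => ?_) rfl ?_ ?_) ?_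
  · simp only [Expr.eval]
    ring
  · simp [Store.var_setVar]
  · intro i hi t ht hti h
    refine ⟨_, Det.assign 13 (.add (.var 13) (.var 13)), ?_⟩
    simp only [Store.var_setVar, Expr.eval, h]
    simp only [show (13 : ℕ) ≠ 10 by decide, if_false, if_true]
    ring
  · rintro t ⟨ht, h⟩
    exact ⟨t, ((Det.assign 13 (.var 6)).seq ht).mono (by omega), h⟩

/-- The numerator of `δ'` is doubled until it reaches the denominator. Stopping makes `2⁻¹ ^ j` at
most `δ'`; minimality of `j` later bounds the number of trials. -/
theorem exists_det_countTrials (r : ℕ) (h3 : 1 ≤ inp.nums.getD 3 0) (s : Store) :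
    ∃ t j, Det inp (.countTrials r) s (j * 4 + 5) t ∧ t.var 8 = j * r ∧
      inp.nums.getD 4 0 ≤ inp.nums.getD 3 0 * 2 ^ j ∧
      ∀ i < j, inp.nums.getD 3 0 * 2 ^ i < inp.nums.getD 4 0 := by
  classical
  have hex : ∃ j, inp.nums.getD 4 0 ≤ inp.nums.getD 3 0 * 2 ^ j :=
    ⟨inp.nums.getD 4 0, Nat.lt_two_pow_self.le.trans (Nat.le_mul_of_pos_left _ h3)⟩
  have key : ∀ j (t : Store), inp.nums.getD 4 0 ≤ t.var 13 * 2 ^ j →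
      (∀ i < j, t.var 13 * 2 ^ i < inp.nums.getD 4 0) →
      ∃ u, Det inp (.loop (.lt (.var 13) (.num 4))
        (.seq (.assign 13 (.add (.var 13) (.var 13))) (.assign 8 (.add (.var 8) (.lit r))))) t
        (j * 4 + 1) u ∧ u.var 8 = t.var 8 + j * r := by
    intro j
    induction j with
    | zero =>
      intro t h1 _
      refine ⟨t, (Det.loop_done ?_).mono (by omega), by simp⟩
      by_contra hn
      have := Expr.eval_lt_ne_zero.1 hn
      simp only [Expr.eval] at this
      omega
    | succ j ih =>
      intro t h1 h2
      have hd := (Det.assign (inp := inp) (s := t) 13 (.add (.var 13) (.var 13))).seq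
        (Det.assign 8 (.add (.var 8) (.lit r)))
      set t' := (t.setVar 13 (Expr.eval inp t (.add (.var 13) (.var 13)))).setVar 8
        (Expr.eval inp (t.setVar 13 (Expr.eval inp t (.add (.var 13) (.var 13))))
          (.add (.var 8) (.lit r)))
      have t13 : t'.var 13 = t.var 13 * 2 := (mul_two _).symm
      have t8 : t'.var 8 = t.var 8 + r := rfl
      obtain ⟨u, hu, hu8⟩ := ih t' (by rw [t13, mul_assoc, ← pow_succ']; exact h1) (by
        intro i hi
        rw [t13, mul_assoc, ← pow_succ']
        exact h2 (i + 1) (by omega))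
      refine ⟨u, (hd.loop_step ?_ hu).mono (by omega), ?_⟩
      · refine Expr.eval_lt_ne_zero.2 ?_
        simpa [Expr.eval] using h2 0 (by omega)
      · rw [hu8, t8, add_mul]
        ring
  obtain ⟨u, hu, hu8⟩ := key (Nat.find hex) ((s.setVar 8 0).setVar 13 (inp.nums.getD 3 0))
    (Nat.find_spec hex) (fun i hi => not_le.1 (Nat.find_min hex hi))
  refine ⟨u, Nat.find hex, ((Det.assign 8 (.lit 0)).seq ((Det.assign 13 (.num 3)).seq hu)).mono
    (by omega), ?_, Nat.find_spec hex, fun i hi => not_le.1 (Nat.find_min hex hi)⟩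
  rw [hu8]
  simp [Store.var_setVar]

/-- The largest exponent of a tabulated power of two. -/
def maxExponent (k L : ℕ) : ℕ := 4 * k + (8 + (L + k * L))

/-- The capacity of the queue. -/
def capacity (k L M : ℕ) : ℕ := L * (2 ^ (4 * k + 4) * min M (2 ^ (k * L)))

/-- The time for the computation of the constants. -/
def setupTime (n k L j : ℕ) : ℕ :=
  n * 7 + k * 4 + (maxExponent k L + 1) * 10 + (4 * k + 4) * 4 + L * 4 + j * 4 + 50

theorem exists_det_setup (hn : 1 ≤ n) (r r' : ℕ) (h3 : 1 ≤ inp.nums.getD 3 0) (s : Store) :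
    ∃ t l j, n ≤ 2 ^ l ∧ 2 ^ l ≤ 2 * n ∧
      Det inp (.setup r r') s (setupTime n inp.k (2 * l + 4) j) t ∧
      Ready inp.k (2 * l + 4) (maxExponent inp.k (2 * l + 4) * r) t ∧
      t.var 7 = capacity inp.k (2 * l + 4) (inp.nums.getD 0 0) ∧ t.var 8 = j * r' ∧
      inp.nums.getD 4 0 ≤ inp.nums.getD 3 0 * 2 ^ j ∧
      ∀ i < j, inp.nums.getD 3 0 * 2 ^ i < inp.nums.getD 4 0 := by
  obtain ⟨t1, l, d1, a2, hl1, hl2⟩ := exists_det_initLevels (inp := inp) hn s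
  set L := 2 * l + 4
  obtain ⟨t2, d2, a3⟩ := exists_det_product (inp := inp) (y := 3) (e := .par) (f := .var 2)
    (N := inp.k) (v := L) (by decide) t1 (fun _ _ => rfl) (fun t ht => (ht.var 2 rfl).trans a2)
  have b2 : t2.var 2 = L := (d2.1.var 2 rfl).trans a2
  set E := maxExponent inp.k L with hE
  set t3 := t2.setVar 4 E
  have d3 : Det inp (.assign 4 (.add (.add (.add .par .par) (.add .par .par)) (.add (.lit 8)
      (.add (.var 2) (.var 3))))) t2 1 t3 := by
    have := Det.assign (inp := inp) (s := t2) 4 (.add (.add (.add .par .par) (.add .par .par))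
      (.add (.lit 8) (.add (.var 2) (.var 3))))
    simp only [Expr.eval, a3, b2] at this
    rwa [show inp.k + inp.k + (inp.k + inp.k) + (8 + (L + inp.k * L)) = E by
      rw [hE, maxExponent]; ring] at this
  obtain ⟨t4, d4, a4⟩ := exists_det_initPowers (inp := inp) t3
  have e3 : t3.var 4 = E := rfl
  rw [e3] at d4 a4
  have c2 : t4.var 2 = L := (d4.1.var 2 rfl).trans b2
  have c3 : t4.var 3 = inp.k * L := (d4.1.var 3 rfl).trans a3
  have c4 : t4.var 4 = E := d4.1.var 4 rfl
  obtain ⟨t5, d5, a5⟩ := exists_det_product (inp := inp) (y := 5) (e := .var 4) (f := .lit r)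
    (N := E) (v := r) (by decide) t4 (fun t ht => (ht.var 4 rfl).trans c4) (fun _ _ => rfl)
  obtain ⟨t6, d6, a6⟩ := exists_det_capThreshold (inp := inp) t5
  -- The table of powers must reach the exponent `k * L` of the cap as well as `L + k`; the largest
  -- exponent exceeds both.
  rw [d5.1.var 3 rfl, c3, d5.1.arr 2 rfl, a4 _ (by rw [hE, maxExponent]; omega)] at a6
  obtain ⟨t7, d7, a7⟩ := exists_det_scaleThreshold (inp := inp) t6
  have f2 : t7.var 2 = L :=
    (d7.1.var 2 rfl).trans ((d6.1.var 2 rfl).trans ((d5.1.var 2 rfl).trans c2))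
  rw [a6] at a7
  obtain ⟨t8, d8, a8⟩ := exists_det_product (inp := inp) (y := 7) (e := .var 2) (f := .var 13)
    (N := L) (v := 2 ^ (4 * inp.k + 4) * min (inp.nums.getD 0 0) (2 ^ (inp.k * L)))
    (by decide) t7 (fun t ht => (ht.var 2 rfl).trans f2) (fun t ht => (ht.var 13 rfl).trans a7)
  obtain ⟨t9, j, d9, a9, hj1, hj2⟩ := exists_det_countTrials (inp := inp) r' h3 t8
  refine ⟨t9, l, j, hl1, hl2, ?_, ⟨?_, ?_, ?_⟩, (d9.1.var 7 rfl).trans a8, a9, hj1, hj2⟩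
  · refine (d1.seq (d2.seq (d3.seq (d4.seq (d5.seq (d6.seq (d7.seq (d8.seq d9)))))))).mono ?_
    unfold setupTime
    rw [← hE]
    omega
  · exact (d9.1.var 2 rfl).trans ((d8.1.var 2 rfl).trans f2)
  · intro i hi
    rw [d9.1.arr 2 rfl, d8.1.arr 2 rfl, d7.1.arr 2 rfl, d6.1.arr 2 rfl, d5.1.arr 2 rfl]
    exact a4 i (by rw [hE, maxExponent]; omega)
  · exact (d9.1.var 5 rfl).trans ((d8.1.var 5 rfl).trans ((d7.1.var 5 rfl).trans
      ((d6.1.var 5 rfl).trans a5)))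

theorem exists_det_writeOutput (s : Store) {N M : ℕ} (h : s.var 16 = correctCode N M) :
    ∃ t, Det inp .writeOutput s 4 t ∧ t.output = if N ≤ M then some N else none := by
  unfold correctCode at h
  split_ifs at h ⊢ with hNM
  · refine ⟨(s.setVar 0 0).setVar 1 N, Det.ite (T := 3) _ ?_, rfl⟩
    rw [if_pos (by simp [Expr.eval, h])]
    have := (Det.assign (inp := inp) (s := s) 0 (.lit 0)).seq
      (Det.assign 1 (.sub (.var 16) (.lit 1)))
    simpa [Expr.eval, Store.var_setVar, h] using this
  · refine ⟨s.setVar 0 1, (Det.ite (T := 1) _ ?_).mono (by omega), rfl⟩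
    rw [if_neg (by simp [Expr.eval, h])]
    exact Det.assign 0 (.lit 1)

theorem exists_det_writeOutput_total (s : Store) : ∃ t, Det inp .writeOutput s 4 t := by
  by_cases h : s.var 16 = 0
  · obtain ⟨t, ht, -⟩ := exists_det_writeOutput (inp := inp) s (N := 1) (M := 0) h
    exact ⟨t, ht⟩
  · obtain ⟨t, ht, -⟩ := exists_det_writeOutput (inp := inp) s (N := s.var 16 - 1)
      (M := s.var 16) (by rw [correctCode, if_pos (by omega)]; omega)
    exact ⟨t, ht⟩

variable {F : Finset (Finset (Fin n))}

/-- Capping the threshold at this value for the capacity is harmless, however large `M` is. -/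
theorem card_le_two_pow {k l L : ℕ} (hF : ∀ W ∈ F, #W = k) (hl : n ≤ 2 ^ l) (hL : l ≤ L) :
    #F ≤ 2 ^ (k * L) := by
  have h1 : F ⊆ powersetCard k univ := fun W hW => mem_powersetCard.2 ⟨subset_univ _, hF W hW⟩
  calc #F ≤ n.choose k := by simpa using Finset.card_le_card h1
    _ ≤ n ^ k := Nat.choose_le_pow _ _
    _ ≤ (2 ^ L) ^ k := by
      gcongr
      exact hl.trans (Nat.pow_le_pow_right (by norm_num) hL)
    _ = 2 ^ (k * L) := by rw [← pow_mul, mul_comm]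

/-- The summands of `maxExponent` pay for the factors `L`, `2 ^ (4 * k + 4)`, the cap and the final
16. Thanks to the cap, the number of repetitions per query does not depend on `M`. -/
theorem capacity_mul_le {k L M : ℕ} {ρ : ℝ≥0∞} {r : ℕ} (hρ : ρ ^ r ≤ 2⁻¹) :
    (capacity k L M : ℝ≥0∞) * ρ ^ (maxExponent k L * r) ≤ 16⁻¹ := by
  have h1 : capacity k L M * 16 ≤ 2 ^ maxExponent k L := by
    calc capacity k L M * 16 ≤ (2 ^ L * (2 ^ (4 * k + 4) * 2 ^ (k * L))) * 16 := by
          unfold capacity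
          gcongr
          · exact Nat.lt_two_pow_self.le
          · exact min_le_right _ _
      _ = 2 ^ maxExponent k L := by
          rw [← pow_add, ← pow_add, show 16 = 2 ^ 4 by norm_num, ← pow_add, maxExponent]
          congr 1
          ring
  have h2 : (capacity k L M : ℝ≥0∞) * 16 ≤ 2 ^ maxExponent k L := by exact_mod_cast h1
  rw [mul_comm (maxExponent k L), pow_mul]
  calc _ ≤ (capacity k L M : ℝ≥0∞) * 2⁻¹ ^ maxExponent k L := by gcongr
    _ = (capacity k L M : ℝ≥0∞) * 16 * 2⁻¹ ^ maxExponent k L * 16⁻¹ := by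
        rw [mul_right_comm _ 16, mul_assoc _ (16 : ℝ≥0∞),
          ENNReal.mul_inv_cancel (by norm_num) (by norm_num), mul_one]
    _ ≤ 2 ^ maxExponent k L * 2⁻¹ ^ maxExponent k L * 16⁻¹ := by gcongr
    _ = 16⁻¹ := by
        rw [← mul_pow, ENNReal.mul_inv_cancel (by norm_num) (by norm_num), one_pow, one_mul]

/-- The time of the whole algorithm. -/
def totalTime (n k L M r r' j : ℕ) : ℕ :=
  setupTime n k L j + (j * r' * (trialTime n k (maxExponent k L * r) (capacity k L M) + 8) + 5 +
    4 + 1) + 1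

/-- The number of oracle calls of the whole algorithm. -/
def totalCalls (k L M r r' j : ℕ) : ℕ := j * r' * (capacity k L M * (maxExponent k L * r))

-- The outer vote treats a trial as an answer with error 1/4; every block of `r'` trials halves the
-- failure probability.
open Classical in
theorem exists_triple_countWitnesses {M : Machine inp} {p α β α' β' : ℝ≥0∞} {r r' : ℕ}
    (hO : Decides F p M.O) (hα : 1 ≤ α) (hαβ : α * β = 1) (hr : (β + (α - β) * p) ^ r ≤ 2⁻¹)
    (hα' : 1 ≤ α') (hαβ' : α' * β' = 1) (hr' : (β' + (α' - β') * 4⁻¹) ^ r' ≤ 2⁻¹)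
    (hF : ∀ W ∈ F, #W = inp.k) (hn : 1 ≤ n) (h0 : 1 ≤ inp.nums.getD 0 0)
    (h3 : 1 ≤ inp.nums.getD 3 0) :
    ∃ l j, n ≤ 2 ^ l ∧ 2 ^ l ≤ 2 * n ∧ inp.nums.getD 4 0 ≤ inp.nums.getD 3 0 * 2 ^ j ∧
      (∀ i < j, inp.nums.getD 3 0 * 2 ^ i < inp.nums.getD 4 0) ∧
      Triple M (.countWitnesses r r') Store.init
        (totalTime n inp.k (2 * l + 4) (inp.nums.getD 0 0) r r' j)
        (totalCalls inp.k (2 * l + 4) (inp.nums.getD 0 0) r r' j)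
        (fun s => if s.output = (if #F ≤ inp.nums.getD 0 0 then some #F else none) then 0 else 1)
        (2⁻¹ ^ j) := by
  obtain ⟨t, l, j, hl1, hl2, hd, hrdy, h7, h8, hj1, hj2⟩ :=
    exists_det_setup (inp := inp) hn r r' h3 Store.init
  refine ⟨l, j, hl1, hl2, hj1, hj2, ?_⟩
  set L := 2 * l + 4
  set Mt := inp.nums.getD 0 0
  have hL : 16 * n ^ 2 ≤ 2 ^ L := by
    calc 16 * n ^ 2 ≤ 16 * (2 ^ l) ^ 2 := by gcongr
      _ = 2 ^ L := by
        rw [show L = 4 + l * 2 by omega, pow_add, pow_mul]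
        norm_num
  have hvote := Triple.majority (M := M) (i := 9) (e := .var 8) (c := .trial) (x := 15) (y := 16)
    (z := 17) (s := t) (N := j * r')
    (T := trialTime n inp.k (maxExponent inp.k L * r) (capacity inp.k L Mt))
    (B := capacity inp.k L Mt * (maxExponent inp.k L * r)) (p := 4⁻¹)
    (w := correctCode #F Mt) hα' hαβ' le_rfl (by decide) (by decide) (by decide)
    rfl rfl rfl (fun u hu => (hu.var 8 rfl).trans h8) (fun u hu =>
      Triple.trial (M' := min Mt (2 ^ (inp.k * L))) hO hα hαβ le_rfl
        (hrdy.of_keeps hu rfl rfl rfl) ((hu.var 7 rfl).trans h7) rfl (capacity_mul_le hr) hF hL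
        (by omega) (le_min h0 Nat.one_le_two_pow)
        fun h => le_min h (card_le_two_pow hF hl1 (by omega)))
  refine hd.triple_seq ((Triple.seq (T' := 4) (B' := 0) hvote fun u _ => ?_).conseq le_rfl
    (by simp [totalCalls]) (fun _ _ => le_rfl) ?_)
  · by_cases hu : u.var 16 = correctCode #F Mt
    · obtain ⟨x, hx, hx'⟩ := exists_det_writeOutput (inp := inp) u hu
      refine (hx.triple M _).conseq le_rfl le_rfl (fun _ _ => le_rfl) ?_
      rw [if_pos hx']
      exact zero_le
    · obtain ⟨x, hx⟩ := exists_det_writeOutput_total (inp := inp) u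
      refine (hx.triple M _).conseq le_rfl le_rfl (fun _ _ => le_rfl) ?_
      rw [if_neg hu]
      split_ifs <;> simp
  · rw [mul_comm j r', pow_mul]
    gcongr

end Setup

/-! ### Estimates for the number of oracle calls and the running time -/

section Bounds

theorem maxExponent_le {k L : ℕ} (hL : 4 ≤ L) : maxExponent k L ≤ 3 * 2 ^ k * L := by
  have hk : k + 1 ≤ 2 ^ k := Nat.lt_two_pow_self
  unfold maxExponent
  calc 4 * k + (8 + (L + k * L)) ≤ 3 * (k + 1) * L := by nlinarith
    _ ≤ 3 * 2 ^ k * L := by gcongr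

theorem capacity_le (k L M : ℕ) : capacity k L M ≤ 16 * L * (2 ^ k) ^ 4 * M := by
  unfold capacity
  calc L * (2 ^ (4 * k + 4) * min M (2 ^ (k * L))) ≤ L * (2 ^ (4 * k + 4) * M) := by
        gcongr
        exact min_le_left _ _
    _ = 16 * L * (2 ^ k) ^ 4 * M := by
        rw [pow_add, mul_comm 4 k, pow_mul]
        ring

theorem totalCalls_le {k L : ℕ} (hL : 4 ≤ L) (M r r' j : ℕ) :
    totalCalls k L M r r' j ≤ 48 * r * r' * (2 ^ k) ^ 5 * L ^ 2 * M * j := by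
  unfold totalCalls
  calc j * r' * (capacity k L M * (maxExponent k L * r))
      ≤ j * r' * (16 * L * (2 ^ k) ^ 4 * M * (3 * 2 ^ k * L * r)) := by
        gcongr
        · exact capacity_le k L M
        · exact maxExponent_le hL
    _ = _ := by ring

theorem nodeTime_le {n k m : ℕ} (hn : 1 ≤ n) :
    nodeTime n k m ≤ 52 * (2 ^ k) ^ 2 * n + m * 9 := by
  have hk : k + 1 ≤ 2 ^ k := Nat.lt_two_pow_self
  unfold nodeTime
  set K := 2 ^ k
  have h1 : n * (k * 5 + 8) ≤ 8 * (K ^ 2 * n) := by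
    have : k * 5 + 8 ≤ 8 * K ^ 2 := by nlinarith
    nlinarith
  have h2 : K * (k * 7 + 14) ≤ 14 * (K ^ 2 * n) := by
    have : K * (k * 7 + 14) ≤ K * (14 * K) := by
      gcongr
      omega
    nlinarith [Nat.le_mul_of_pos_right (K ^ 2) hn]
  have h3 : k * 7 + 30 ≤ 30 * (K ^ 2 * n) := by
    have : k + 1 ≤ K ^ 2 * n := by nlinarith [Nat.le_mul_of_pos_right (K ^ 2) hn]
    omega
  linarith

/-- The crude bound `L ≤ 6 * n` suffices for a polynomial time bound. As `j` and `r'` are positive,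
the time for the setup is absorbed by that for the trials. -/
theorem totalTime_le {n k l M r r' j : ℕ} (hn : 1 ≤ n) (hl : 2 ^ l ≤ 2 * n) (hM : 1 ≤ M)
    (hr : 1 ≤ r) (hr' : 1 ≤ r') (hj : 1 ≤ j) :
    totalTime n k (2 * l + 4) M r r' j ≤ 22000 * r * r' * (2 ^ k) ^ 6 * n ^ 2 * M * j := by
  have hk : k + 1 ≤ 2 ^ k := Nat.lt_two_pow_self
  have hln : l ≤ n := by
    by_contra! h
    have h1 : 2 ^ (n + 1) ≤ 2 ^ l := Nat.pow_le_pow_right (by norm_num) h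
    have h2 : n < 2 ^ n := Nat.lt_two_pow_self
    rw [pow_succ] at h1
    omega
  have hL : 2 * l + 4 ≤ 6 * n := by omega
  set L := 2 * l + 4
  have he : maxExponent k L ≤ 18 * (2 ^ k * n) :=
    (maxExponent_le (by omega)).trans (by nlinarith [Nat.mul_le_mul_left (3 * 2 ^ k) hL])
  have hc : capacity k L M ≤ 96 * (n * (2 ^ k) ^ 4 * M) :=
    (capacity_le k L M).trans (by nlinarith [Nat.mul_le_mul_left (16 * (2 ^ k) ^ 4 * M) hL])
  set K := 2 ^ k
  have hK : 1 ≤ K := by omega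
  have hKn : 1 ≤ K * n := Nat.mul_pos hK hn
  have hKnk : k ≤ K * n := by nlinarith
  have hnK : n ≤ K * n := Nat.le_mul_of_pos_left n hK
  have hnode : nodeTime n k (maxExponent k L * r) + 4 ≤ 218 * (K ^ 2 * n * r) := by
    have h1 : K * n ≤ K ^ 2 * n := by nlinarith
    have h2 : K ^ 2 * n ≤ K ^ 2 * n * r := Nat.le_mul_of_pos_right _ hr
    have h3 : maxExponent k L * r ≤ 18 * (K ^ 2 * n * r) := by
      calc maxExponent k L * r ≤ 18 * (K * n) * r := by gcongr
        _ ≤ 18 * (K ^ 2 * n) * r := by gcongr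
        _ = _ := by ring
    have : _ ≤ 52 * K ^ 2 * n + _ := nodeTime_le (k := k) (m := maxExponent k L * r) hn
    linarith
  set S := K ^ 6 * n ^ 2 * M * r
  have hKS : K * n ≤ S := by
    calc K * n = K ^ 1 * n ^ 1 * 1 * 1 := by ring
      _ ≤ K ^ 6 * n ^ 2 * M * r := by gcongr <;> omega
  have htrial : trialTime n k (maxExponent k L * r) (capacity k L M) + 8 ≤ 20971 * S := by
    have h : capacity k L M * (nodeTime n k (maxExponent k L * r) + 4) ≤ 20928 * S := by
      calc _ ≤ 96 * (n * K ^ 4 * M) * (218 * (K ^ 2 * n * r)) := by gcongr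
        _ = 20928 * S := by ring
    unfold trialTime
    linarith
  have hset : setupTime n k L j + 11 ≤ 330 * S * j := by
    have h : setupTime n k L j + 11 ≤ 330 * (K * n) * j := by
      unfold setupTime
      have h1 : K * n ≤ K * n * j := Nat.le_mul_of_pos_right _ hj
      have h2 : j ≤ K * n * j := Nat.le_mul_of_pos_left _ hKn
      linarith
    exact h.trans (by gcongr)
  have hrj : 330 * S * j ≤ 330 * S * j * r' := Nat.le_mul_of_pos_right _ hr'
  have := Nat.mul_le_mul_left (j * r') htrial
  calc totalTime n k L M r r' j = setupTime n k L j + 11 +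
        j * r' * (trialTime n k (maxExponent k L * r) (capacity k L M) + 8) := by
        unfold totalTime
        ring
    _ ≤ 22000 * (S * j * r') := by linarith
    _ = _ := by ring

theorem natCast_le_log_of_two_pow_le {i : ℕ} {x : ℝ} (h : 2 ^ i ≤ x) :
    (i : ℝ) ≤ 2 * Real.log x := by
  have h1 : Real.log (2 ^ i) ≤ Real.log x := Real.log_le_log (by positivity) h
  rw [Real.log_pow] at h1
  nlinarith [Real.log_two_gt_d9, (Nat.cast_nonneg i : (0 : ℝ) ≤ i)]

theorem totalCalls_le_log {n k l M r r' j : ℕ} {x : ℝ} (hn : 2 ≤ n) (hl : 2 ^ l ≤ 2 * n)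
    (hj : (j : ℝ) ≤ 6 * x) : (totalCalls k (2 * l + 4) M r r' j : ℝ) ≤
      (147456 * r * r' : ℕ) * (2 ^ k) ^ 5 * Real.log n ^ 3 * M * x := by
  have hn' : (2 : ℝ) ≤ n := by exact_mod_cast hn
  -- This lower bound turns the constant in `L` into a multiple of `log n`, and later `log n ^ 2`
  -- into `log n ^ 3`.
  have hlog : 1 / 2 ≤ Real.log n := by
    have := Real.log_le_log (by norm_num) hn'
    linarith [Real.log_two_gt_d9]
  have hL : ((2 * l + 4 : ℕ) : ℝ) ≤ 16 * Real.log n := by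
    have h1 : (2 : ℝ) ^ l ≤ (n : ℝ) ^ 2 := by
      calc (2 : ℝ) ^ l ≤ 2 * n := by exact_mod_cast hl
        _ ≤ (n : ℝ) ^ 2 := by nlinarith
    have h2 := natCast_le_log_of_two_pow_le h1
    rw [Real.log_pow] at h2
    push_cast at h2 ⊢
    linarith
  have hL2 : ((2 * l + 4 : ℕ) : ℝ) ^ 2 ≤ 512 * Real.log n ^ 3 := by
    calc ((2 * l + 4 : ℕ) : ℝ) ^ 2 ≤ (16 * Real.log n) ^ 2 := by gcongr
      _ ≤ 512 * Real.log n ^ 3 := by nlinarith [sq_nonneg (Real.log n)]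
  have h : (totalCalls k (2 * l + 4) M r r' j : ℝ) ≤
      48 * r * r' * (2 ^ k) ^ 5 * ((2 * l + 4 : ℕ) : ℝ) ^ 2 * M * j := by
    exact_mod_cast totalCalls_le (by omega) M r r' j
  calc _ ≤ 48 * r * r' * (2 ^ k) ^ 5 * ((2 * l + 4 : ℕ) : ℝ) ^ 2 * M * j := h
    _ ≤ 48 * r * r' * (2 ^ k) ^ 5 * (512 * Real.log n ^ 3) * M * (6 * x) := by
      have : 0 ≤ Real.log n := by linarith
      gcongr
    _ = _ := by
      push_cast
      ring

end Bounds

/-! ### From the program's bounds to the stated guarantees -/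

section Guarantee

theorem Presents.one_le_num {d : ℚ} {δ : ℝ} (h : Presents d δ) (hδ : 0 < δ) :
    1 ≤ d.num.toNat := by
  have : 0 < d := by
    have : (0 : ℝ) < d := lt_of_lt_of_le (by linarith) h.1
    exact_mod_cast this
  have := Rat.num_pos.2 this
  omega

theorem Presents.cast_eq {d : ℚ} {δ : ℝ} (h : Presents d δ) (hδ : 0 < δ) :
    (d : ℝ) * d.den = d.num.toNat := by
  have h1 := h.one_le_num hδ
  have h2 : ((d.num.toNat : ℤ) : ℝ) = d.num := by rw [Int.toNat_of_nonneg (by omega)]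
  rw [← Int.cast_natCast (R := ℝ) d.num.toNat, h2]
  exact_mod_cast Rat.mul_den_eq_num d

variable {d : ℚ} {δ : ℝ} {j : ℕ}

/-- The hypothesis says `1 ≤ d * 2 ^ j`, and `d ≤ δ`. -/
theorem Presents.two_inv_pow_le (h : Presents d δ) (hδ : 0 < δ)
    (hj : d.den ≤ d.num.toNat * 2 ^ j) : (2⁻¹ : ℝ) ^ j ≤ δ := by
  have h1 : (d.den : ℝ) ≤ d.num.toNat * 2 ^ j := by exact_mod_cast hj
  rw [← h.cast_eq hδ] at h1
  have h2 : (0 : ℝ) < d.den := by exact_mod_cast d.den_pos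
  have h3 : 1 ≤ (d : ℝ) * 2 ^ j := by
    by_contra! h4
    nlinarith
  rw [inv_pow, inv_le_iff_one_le_mul₀ (by positivity)]
  exact h3.trans (by gcongr; exact h.2)

theorem Presents.one_le_of_den_le (h : Presents d δ) (hδ : 0 < δ) (hδ' : δ ≤ 1 / 2)
    (hj : d.den ≤ d.num.toNat * 2 ^ j) : 1 ≤ j := by
  by_contra! h0
  have h1 := h.two_inv_pow_le hδ hj
  obtain rfl : j = 0 := by omega
  rw [pow_zero] at h1
  linarith

theorem Presents.le_log (h : Presents d δ) (hδ : 0 < δ) (hδ' : δ ≤ 1 / 2)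
    (hj : ∀ i < j, d.num.toNat * 2 ^ i < d.den) : (j : ℝ) ≤ 6 * Real.log δ⁻¹ := by
  have h2 : 2 ≤ δ⁻¹ := (le_inv_comm₀ (by norm_num) hδ).2 (by linarith)
  rcases j with _ | j
  · have := Real.log_nonneg (by linarith : 1 ≤ δ⁻¹)
    push_cast
    linarith
  have h1 : (d.num.toNat : ℝ) * 2 ^ j < d.den := by exact_mod_cast hj j (by omega)
  rw [← h.cast_eq hδ] at h1
  have h3 : (0 : ℝ) < d.den := by exact_mod_cast d.den_pos
  have h4 : (d : ℝ) * 2 ^ j < 1 := by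
    by_contra! h5
    nlinarith
  have h5 : (2 : ℝ) ^ j ≤ 2 * δ⁻¹ := by
    have : δ / 2 * 2 ^ j ≤ 1 := le_trans (by gcongr; exact h.1) h4.le
    rw [← div_eq_mul_inv, le_div_iff₀ hδ]
    linarith
  -- The left side is at most `4 * δ⁻¹`, and `2 ≤ δ⁻¹` absorbs the factor 4.
  have h6 : (2 : ℝ) ^ (j + 1) ≤ δ⁻¹ ^ 3 := by
    rw [pow_succ]
    nlinarith [mul_le_mul h2 h2 (by norm_num) (by linarith)]
  have h7 := natCast_le_log_of_two_pow_le h6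
  rw [Real.log_pow] at h7
  push_cast at h7 ⊢
  linarith

theorem PMF.apply_not_le {p : PMF Bool} {c : ℝ} {b : Bool}
    (h : ENNReal.ofReal (1 - c) ≤ p b) : p (!b) ≤ ENNReal.ofReal c := by
  have hs : p b + p (!b) = 1 := by
    have := p.tsum_coe
    rw [tsum_bool] at this
    cases b
    · simpa using this
    · simpa [add_comm] using this
  have hne : p b ≠ ∞ := p.apply_ne_top b
  rw [ENNReal.eq_sub_of_add_eq' ENNReal.one_ne_top ((add_comm _ _).trans hs)]
  calc 1 - p b ≤ 1 - ENNReal.ofReal (1 - c) := by gcongr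
    _ ≤ ENNReal.ofReal c := by
      rw [tsub_le_iff_right, ← ENNReal.ofReal_one]
      exact (ENNReal.ofReal_le_ofReal (by linarith)).trans ENNReal.ofReal_add_le

variable {Q : WitnessProblem} {I : Q.Instance}

theorem WitnessProblem.decides_of_le {c : ℝ} {O : Finset (Fin (Q.size I)) → PMF Bool}
    (h : ∀ X, ENNReal.ofReal (1 - c) ≤ O X (Q.answer I X)) :
    Decides (Q.witnesses I) (ENNReal.ofReal (max c 0)) O := by
  intro X
  have hX := PMF.apply_not_le (c := max c 0)
    ((ENNReal.ofReal_le_ofReal (by linarith [le_max_left c 0])).trans (h X))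
  refine ⟨fun hW => ?_, fun hW => ?_⟩
  · rwa [show Q.answer I X = true from decide_eq_true hW] at hX
  · rwa [show Q.answer I X = false from decide_eq_false hW] at hX

theorem WitnessProblem.goodOutput_exact {N M : ℕ} {ε : ℝ} (hε : 0 < ε) {o : Option ℕ}
    (ho : o = if N ≤ M then some N else none) : WitnessProblem.GoodOutput N M ε o := by
  have hN : (1 - ε) * (N : ℝ) ≤ N := by nlinarith [(Nat.cast_nonneg N : (0 : ℝ) ≤ N)]
  refine ⟨fun h => ⟨N, by rw [ho, if_pos h], hN, le_rfl⟩, fun h => ?_⟩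
  by_cases h' : N ≤ M
  · exact .inl ⟨N, by rw [ho, if_pos h'], hN, h'⟩
  · exact .inr (by rw [ho, if_neg h'])

theorem ofReal_one_sub_le (hj : (2⁻¹ : ℝ) ^ j ≤ δ) :
    ENNReal.ofReal (1 - δ) ≤ 1 - 2⁻¹ ^ j := by
  calc ENNReal.ofReal (1 - δ) ≤ ENNReal.ofReal (1 - 2⁻¹ ^ j) :=
        ENNReal.ofReal_le_ofReal (by linarith)
    _ = 1 - 2⁻¹ ^ j := by
        rw [ENNReal.ofReal_sub _ (by positivity), ENNReal.ofReal_one,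
          ENNReal.ofReal_pow (by positivity), ENNReal.ofReal_inv_of_pos (by norm_num)]
        norm_num

/-- The initial configuration still has the program to execute. This allows the cost `T + 2` of a
call to be bounded by `3 * T`. -/
theorem HaltsWithin.pos {n T : ℕ} {O : Finset (Fin n) → PMF Bool} {P : Cmd} {inp : Input n}
    (h : HaltsWithin O P inp T) : 1 ≤ T := by
  by_contra! hT
  obtain rfl : T = 0 := by omega
  have := h ⟨⟨inp, Store.init, [P]⟩, [], 0⟩ (by simp [run])
  simp [Config.Halted] at this

/-- The algorithm on the counting input, on a machine whose oracle errs with probability at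
most `c`. -/
theorem WitnessProblem.exists_triple_countingInput {c ε : ℝ} {M : ℕ} {e : ℚ}
    {α β α' β' : ℝ≥0∞} {r r' : ℕ} (hα : 1 ≤ α) (hαβ : α * β = 1)
    (hr : (β + (α - β) * ENNReal.ofReal (max c 0)) ^ r ≤ 2⁻¹) (hα' : 1 ≤ α')
    (hαβ' : α' * β' = 1) (hr' : (β' + (α' - β') * ENNReal.ofReal (1 / 4)) ^ r' ≤ 2⁻¹)
    (Ma : Machine (Q.countingInput I M e d))
    (hO : ∀ X, ENNReal.ofReal (1 - c) ≤ Ma.O X (Q.answer I X)) (hε : 0 < ε) (hδ : 0 < δ)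
    (hδ' : δ ≤ 1 / 2) (hM : 1 ≤ M) (hd : Presents d δ) :
    ∃ (l j : ℕ) (f : Store → ℝ≥0∞) (v : ℝ≥0∞), 2 ^ l ≤ 2 * Q.size I ∧ 1 ≤ j ∧
      (j : ℝ) ≤ 6 * Real.log δ⁻¹ ∧ ENNReal.ofReal (1 - δ) ≤ 1 - v ∧
      (∀ s, s ∉ {s | WitnessProblem.GoodOutput (Q.count I) M ε s.output} → 1 ≤ f s) ∧
      Triple Ma (.countWitnesses r r') Store.init
        (totalTime (Q.size I) (Q.par I) (2 * l + 4) M r r' j)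
        (totalCalls (Q.par I) (2 * l + 4) M r r' j) f v := by
  have h4 : ENNReal.ofReal (1 / 4) = 4⁻¹ := by
    rw [one_div, ENNReal.ofReal_inv_of_pos (by norm_num)]
    norm_num
  rw [h4] at hr'
  obtain ⟨l, j, -, hl, hj1, hj2, ht⟩ := exists_triple_countWitnesses
    (Q.decides_of_le hO) hα hαβ hr hα' hαβ' hr' (Q.card_eq I) (Q.size_pos I) hM
    (hd.one_le_num hδ)
  refine ⟨l, j, _, _, hl, hd.one_le_of_den_le hδ hδ' hj1, hd.le_log hδ hδ' hj2,
    ofReal_one_sub_le (hd.two_inv_pow_le hδ hj1), fun s hs => ?_, ht⟩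
  rw [if_neg]
  exact fun h => hs (WitnessProblem.goodOutput_exact hε h)

end Guarantee

end

/-! ### The main theorem -/

theorem mainTheorem4 (c : ℝ) (hc : c < 1 / 2) :
    ∃ (P : Cmd) (C : ℕ),
      -- number of oracle calls and correctness, with any randomised oracle of error at most `c`
      (∀ (Q : WitnessProblem) (I : Q.Instance) (O : Finset (Fin (Q.size I)) → PMF Bool)
        (ε δ : ℝ) (M : ℕ) (e d : ℚ),
        Q.IsOracle I c O → 0 < ε → ε < 1 → 0 < δ → δ ≤ 1 / 2 → 1 ≤ M →
        Presents e ε → Presents d δ →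
        ENNReal.ofReal (1 - δ) ≤ haltProb O P (Q.countingInput I M e d)
            {s | WitnessProblem.GoodOutput (Q.count I) M ε s.output} ∧
        (2 ≤ Q.size I → CallsAtMost O P (Q.countingInput I M e d)
            ((C : ℝ) * 2 ^ (C * Q.par I) * Real.log (Q.size I) ^ 3 * M * Real.log δ⁻¹))) ∧
      -- expected running time, with the oracle calls executed by a randomised decision algorithm
      (∀ (Q : WitnessProblem) (D : Cmd) (g : ℕ → ℕ) (a : ℕ),
        Q.DecidedBy c D →
        (∀ (I : Q.Instance) (X : Finset (Fin (Q.size I))),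
          HaltsWithin (noOracle _) D (Q.decisionInput I X) (g (Q.par I) * Q.size I ^ a)) →
        ∀ (I : Q.Instance) (ε δ : ℝ) (M : ℕ) (e d : ℚ),
        0 < ε → ε < 1 → 0 < δ → δ ≤ 1 / 2 → 1 ≤ M → Presents e ε → Presents d δ →
        ENNReal.ofReal (1 - δ) ≤ haltProb (noOracle _) (P.link D) (Q.countingInput I M e d)
            {s | WitnessProblem.GoodOutput (Q.count I) M ε s.output} ∧
        expectedTime (noOracle _) (P.link D) (Q.countingInput I M e d) ≤
          ENNReal.ofReal ((C : ℝ) * 2 ^ (C * Q.par I) * g (Q.par I) * (Q.size I : ℝ) ^ (a + C)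
            * M * Real.log δ⁻¹)) := by
  obtain ⟨α, β, r, hα, hαβ, hr1, hr⟩ :=
    -- The bound `c` may be negative, hence the maximum with `0`.
    exists_vote_constants (le_max_right c 0) (max_lt hc (by norm_num))
  obtain ⟨α', β', r', hα', hαβ', hr1', hr'⟩ :=
    exists_vote_constants (c := 1 / 4) (by norm_num) (by norm_num)
  have hrr : 1 ≤ r * r' := Nat.mul_pos hr1 hr1'
  -- Here 396000 is 22000 from `totalTime_le`, times 3 for the cost of a call, times 6 from
  -- `Presents.le_log`.
  refine ⟨.countWitnesses r r', 396000 * r * r', ?_, ?_⟩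
  · intro Q I O ε δ M e d hO hε _ hδ hδ' hM _ hd
    obtain ⟨l, j, f, v, hl, -, hj, hv, hf, ht⟩ := Q.exists_triple_countingInput
      hα hαβ hr hα' hαβ' hr' (oracleMachine (Q.countingInput I M e d) O) hO hε hδ hδ' hM hd
    refine ⟨hv.trans (ht.le_haltProb hf), fun hn => ht.callsAtMost ?_⟩
    have hx : 0 ≤ Real.log δ⁻¹ := by
      have := (Nat.cast_nonneg j : (0 : ℝ) ≤ j)
      linarith
    have hlog : 0 ≤ Real.log (Q.size I) := Real.log_natCast_nonneg _
    refine (totalCalls_le_log hn hl hj).trans ?_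
    gcongr
    · norm_num
    · rw [← pow_mul]
      exact pow_le_pow_right₀ (by norm_num) (by nlinarith)
  · intro Q D g a hD hT I ε δ M e d hε _ hδ hδ' hM _ hd
    obtain ⟨l, j, f, v, hl, hj1, hj, hv, hf, ht⟩ := Q.exists_triple_countingInput
      hα hαβ hr hα' hαβ' hr' (linkMachine (Q.countingInput I M e d) D _ (hT I))
      (fun X => (hD.2 I X).trans (haltProb_le_answerLaw (hT I X) _)) hε hδ hδ' hM hd
    refine ⟨hv.trans (ht.le_haltProb_link hf), ht.expectedTime_le_link.trans ?_⟩
    have hx : 0 ≤ Real.log δ⁻¹ := by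
      have := (Nat.cast_nonneg j : (0 : ℝ) ≤ j)
      linarith
    have hT1 : 1 ≤ g (Q.par I) * Q.size I ^ a := (hT I ∅).pos
    have hn : (1 : ℝ) ≤ Q.size I := by exact_mod_cast Q.size_pos I
    have hle := Nat.mul_le_mul
      (totalTime_le (k := Q.par I) (Q.size_pos I) hl hM hr1 hr1' hj1)
      (show g (Q.par I) * Q.size I ^ a + 2 ≤ 3 * (g (Q.par I) * Q.size I ^ a) by omega)
    rw [← ENNReal.ofReal_natCast]
    refine ENNReal.ofReal_le_ofReal ((Nat.cast_le.2 hle).trans ?_)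
    have h6 : ((2 : ℝ) ^ Q.par I) ^ 6 ≤ 2 ^ (396000 * r * r' * Q.par I) := by
      rw [← pow_mul]
      exact pow_le_pow_right₀ (by norm_num) (by nlinarith)
    have h2 : (Q.size I : ℝ) ^ 2 ≤ (Q.size I : ℝ) ^ (396000 * r * r') :=
      pow_le_pow_right₀ hn (by nlinarith)
    calc _ = (66000 * r * r') * (2 ^ Q.par I) ^ 6 * g (Q.par I) *
          ((Q.size I : ℝ) ^ a * (Q.size I : ℝ) ^ 2) * M * j := by
          push_cast
          ring
      _ ≤ (66000 * r * r') * 2 ^ (396000 * r * r' * Q.par I) * g (Q.par I) *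
          ((Q.size I : ℝ) ^ a * (Q.size I : ℝ) ^ (396000 * r * r')) * M *
          (6 * Real.log δ⁻¹) := by gcongr
      _ = _ := by
          rw [pow_add]
          push_cast
          ring
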